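/- **Theorem ($C^1$-regularity of the blow-up curve).** Let $\mu>0$, $1<p<1+\frac2\mu$, and suppose that $s\mapsto s^p$ is of class $C^4$ on $[0,\infty)$. Let $R^*,T^*>0$, and for $r>0$ put $B_r=\{x\in\mathbb R:|x|<r\}$. Let $\gamma_1,\gamma_2>0$ satisfy $$\gamma_1+\gamma_2>\max\bigl(1,(\mu p2^p)^{1/(p-1)}\bigr),$$ and let $T_1$ be the blow-up time of $a+b$ for the ODE system $$a'=b'=2^{-p}|a+b|^p-\tfrac{\mu}{2}(a+b),\qquad a(0)=\gamma_1,\quad b(0)=\gamma_2 .$$ Let $f,g$ be real functions and put $M=\sup_{x\in B_{R^*+T^*}}(|f'(x)|+|g'(x)|)$ and $N=2^{-p}(\gamma_1+\gamma_2)^p-\frac\mu2(\gamma_1+\gamma_2)$. Assume: * (A1) $T_1<T^*$; * (A2) $f\ge\gamma_1$ and $g\ge\gamma_2$ on $B_{R^*+T^*}$; * (A3) $f,g\in C^4(\overline{B_{R^*+T^*}})$; * (A4) there is $\varepsilon_0>0$ with $N\ge(2+\varepsilon_0)M$; * (A5) there is $\varepsilon_1\ne-1$ with $2^{-p}(2p-1)\bigl(1+\frac{\varepsilon_1}{2(1+\varepsilon_1)}\bigr)\bigl(1-\frac1{2p}\bigr)-2^{-p+1}p-\mu>0$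 and $N\ge(2+\varepsilon_1)M$. Let $u_0,u_1$ be functions on $B_{R^*+T^*}$, $u_0$ differentiable, with $f=u_1+u_0'$ and $g=u_1-u_0'$ there. For a function $T:B_{R^*}\to(0,T^*)$ let $D_T=\bigcup_{x_0\in B_{R^*}}\{(x,t):t>0,\ |x-x_0|<T(x_0)-t\}$ be the union of the open backward light cones with apex on the graph of $T$; it contains all $(x,t)$ with $|x|<R^*$, $0<t<T(x)$. Call $T$ a *blow-up curve of the system* if there is a $C^1$ solution $(\phi,\psi)$ on $D_T$ of $$(\partial_t-\partial_x)\phi=(\partial_t+\partial_x)\psi=2^{-p}|\phi+\psi|^p-\frac{\mu}{1+t}\,\frac{\phi+\psi}{2},$$ which attains the values $\phi(x,0)=f(x)$, $\psi(x,0)=g(x)$ continuously on the base of $D_T$ (the union of the intervals $|x-x_0|<T(x_0)$, $x_0\in B_{R^*}$), and such that $\phi(x,t)\to\infty$ and $\psi(x,t)\to\infty$ as $t\nearrow T(x)$ for every $x\in B_{R^*}$. Call $T$ a *blow-up curve of the wave equation* if there is a $C^2$ solution $u$ on $D_T$ of $$\partial_t^2u-\partial_x^2u+\frac{\mu}{1+t}\partial_tu=|\partial_tu|^p,$$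 such that $(u,\partial_tu)$ attains the values $(u_0,u_1)$ at $t=0$ continuously on the base of $D_T$, and $\partial_tu(x,t)\to\infty$ as $t\nearrow T(x)$ for every $x\in B_{R^*}$. Then the system has exactly one blow-up curve $T$ on $B_{R^*}$, the same $T$ is the only blow-up curve of the wave equation, and $T$ is of class $C^1$ on $B_{R^*}$. -/

import Mathlib

open Set Filter Topology

noncomputable section

namespace DampedWave

/-- Partial derivative in the space variable; points of the plane are `z = (x, t)`. -/
def dx (F : ℝ × ℝ → ℝ) (z : ℝ × ℝ) : ℝ := fderiv ℝ F z (1, 0)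

/-- Partial derivative in the time variable. -/
def dt (F : ℝ × ℝ → ℝ) (z : ℝ × ℝ) : ℝ := fderiv ℝ F z (0, 1)

/-- The characteristic derivative `D₋ = ∂ₜ - ∂ₓ`. -/
def Dminus (F : ℝ × ℝ → ℝ) (z : ℝ × ℝ) : ℝ := dt F z - dx F z

/-- The characteristic derivative `D₊ = ∂ₜ + ∂ₓ`. -/
def Dplus (F : ℝ × ℝ → ℝ) (z : ℝ × ℝ) : ℝ := dt F z + dx F z

/-- The open backward light cone `{(x, t) : t > 0, |x - x₀| < t₀ - t}`. -/
def backwardCone (x₀ t₀ : ℝ) : Set (ℝ × ℝ) :=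
  {z | 0 < z.2 ∧ |z.1 - x₀| < t₀ - z.2}

/-- The union of the backward light cones with apex `(x, T x)` on the curve, `|x| < R`.
It contains `{(x, t) : |x| < R, 0 < t < T x}`, and it is a domain of determinacy: a solution on it
is determined by the initial data on its base. -/
def domainBelow (R : ℝ) (T : ℝ → ℝ) : Set (ℝ × ℝ) :=
  ⋃ x ∈ Metric.ball (0 : ℝ) R, backwardCone x (T x)

/-- The base of `domainBelow R T` on the line `t = 0`. -/
def baseBelow (R : ℝ) (T : ℝ → ℝ) : Set ℝ :=
  ⋃ x ∈ Metric.ball (0 : ℝ) R, Metric.ball x (T x)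

/-- The common right-hand side `2⁻ᵖ |φ + ψ|ᵖ - μ / (1 + t) * (φ + ψ) / 2` of the first-order system,
as a function of `t` and of the sum `w = φ + ψ`. -/
def source (μ p t w : ℝ) : ℝ :=
  (2 : ℝ) ^ (-p) * |w| ^ p - μ / (1 + t) * (w / 2)

/-- `(φ, ψ)` is a classical solution of the first-order system on `domainBelow R T`, and it attains
the initial data `(f, g)` continuously. -/
structure IsSystemSolution (μ p : ℝ) (f g : ℝ → ℝ) (R : ℝ) (T : ℝ → ℝ)
    (φ ψ : ℝ × ℝ → ℝ) : Prop where
  contDiffOn_left : ContDiffOn ℝ 1 φ (domainBelow R T)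
  contDiffOn_right : ContDiffOn ℝ 1 ψ (domainBelow R T)
  eq_left : ∀ z ∈ domainBelow R T, Dminus φ z = source μ p z.2 (φ z + ψ z)
  eq_right : ∀ z ∈ domainBelow R T, Dplus ψ z = source μ p z.2 (φ z + ψ z)
  init_left : ∀ x ∈ baseBelow R T,
    Tendsto φ (𝓝[domainBelow R T] (x, 0)) (𝓝 (f x))
  init_right : ∀ x ∈ baseBelow R T,
    Tendsto ψ (𝓝[domainBelow R T] (x, 0)) (𝓝 (g x))

/-- `T` is a blow-up curve over `|x| < R`, with values in `(0, Ts)`, for the first-order system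
with initial data `(f, g)`: a solution exists below the curve, and both components tend to `+∞`
at it. -/
def IsSystemBlowUpCurve (μ p : ℝ) (f g : ℝ → ℝ) (R Ts : ℝ) (T : ℝ → ℝ) : Prop :=
  (∀ x ∈ Metric.ball (0 : ℝ) R, 0 < T x ∧ T x < Ts) ∧
  ∃ φ ψ : ℝ × ℝ → ℝ, IsSystemSolution μ p f g R T φ ψ ∧
    ∀ x ∈ Metric.ball (0 : ℝ) R,
      Tendsto (fun t => φ (x, t)) (𝓝[<] (T x)) atTop ∧
      Tendsto (fun t => ψ (x, t)) (𝓝[<] (T x)) atTop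

/-- `u` is a classical solution of `uₜₜ - uₓₓ + μ / (1 + t) uₜ = |uₜ|ᵖ` on `domainBelow R T`, and
`(u, uₜ)` attains the initial data `(u₀, u₁)` continuously. -/
structure IsWaveSolution (μ p : ℝ) (u₀ u₁ : ℝ → ℝ) (R : ℝ) (T : ℝ → ℝ)
    (u : ℝ × ℝ → ℝ) : Prop where
  contDiffOn : ContDiffOn ℝ 2 u (domainBelow R T)
  eq : ∀ z ∈ domainBelow R T,
    dt (dt u) z - dx (dx u) z + μ / (1 + z.2) * dt u z = |dt u z| ^ p
  init : ∀ x ∈ baseBelow R T,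
    Tendsto u (𝓝[domainBelow R T] (x, 0)) (𝓝 (u₀ x))
  init_dt : ∀ x ∈ baseBelow R T,
    Tendsto (dt u) (𝓝[domainBelow R T] (x, 0)) (𝓝 (u₁ x))

/-- `T` is a blow-up curve over `|x| < R`, with values in `(0, Ts)`, for the time derivative of the
solution of the damped wave equation with initial data `(u₀, u₁)`. -/
def IsWaveBlowUpCurve (μ p : ℝ) (u₀ u₁ : ℝ → ℝ) (R Ts : ℝ) (T : ℝ → ℝ) : Prop :=
  (∀ x ∈ Metric.ball (0 : ℝ) R, 0 < T x ∧ T x < Ts) ∧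
  ∃ u : ℝ × ℝ → ℝ, IsWaveSolution μ p u₀ u₁ R T u ∧
    ∀ x ∈ Metric.ball (0 : ℝ) R, Tendsto (fun t => dt u (x, t)) (𝓝[<] (T x)) atTop

/-- `T₁` is the blow-up time of the comparison system
`a' = b' = 2⁻ᵖ |a + b|ᵖ - (μ / 2) (a + b)`, `a 0 = γ₁`, `b 0 = γ₂`. -/
def IsODEBlowUpTime (μ p γ₁ γ₂ T₁ : ℝ) : Prop :=
  0 < T₁ ∧ ∃ a b : ℝ → ℝ,
    ContinuousOn a (Ico 0 T₁) ∧ ContinuousOn b (Ico 0 T₁) ∧ a 0 = γ₁ ∧ b 0 = γ₂ ∧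
    (∀ t ∈ Ioo 0 T₁,
      HasDerivAt a ((2 : ℝ) ^ (-p) * |a t + b t| ^ p - μ / 2 * (a t + b t)) t ∧
      HasDerivAt b ((2 : ℝ) ^ (-p) * |a t + b t| ^ p - μ / 2 * (a t + b t)) t) ∧
    Tendsto (fun t => a t + b t) (𝓝[<] T₁) atTop

/-- The maximum (supremum) of `|f'| + |g'|` over `|x| < r`. -/
def maxSlope (f g : ℝ → ℝ) (r : ℝ) : ℝ :=
  sSup ((fun x => |deriv f x| + |deriv g x|) '' Metric.ball (0 : ℝ) r)

end DampedWave

end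

/-! ### Minimum, comparison and uniqueness principles in backward cones -/

namespace DampedWave

/-! The blow-up curve is the limit of the level curves of `φ + ψ`, and its regularity comes from an
oscillation estimate for the slopes of these curves.

Existence. The power in the source is continued linearly outside a compact interval, so that global
`C¹` solutions exist by contraction. The lower bound on `γ₁ + γ₂` makes the source nondecreasing in
`φ + ψ`, and a minimum principle along the two families of characteristics applies. It yields `φ ≥
γ₁` and `ψ ≥ γ₂`, domination of the comparison ODE (`exists_level_time_le`) and, applied to `∂ₜφ + c
∂ₓφ` and `∂ₜψ + c ∂ₓψ` with `|c| ≤ k = 1 + ε₀`, the bounds `k |∂ₓφ| ≤ ∂ₜφ` and `k |∂ₓψ| ≤ ∂ₜψ`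
(`slope_bound`); (A4) makes these quantities nonnegative at `t = 0`. Hence `φ + ψ` increases in a
cone of directions wider than the light cone. Truncated solutions therefore agree below the lower
truncation level, and their level curves are Lipschitz with constant `1 / k < 1` and increase to a
curve `T ≤ T₁` (`exists_blowUpProfile`).

Regularity. The quotients `ρ = ∂ₓφ / ∂ₜφ` and `σ = ∂ₓψ / ∂ₜψ` are bounded by 1, and the slope of a
level curve is minus a weighted mean of them. Differentiating the system gives `D₋ρ = A (σ - ρ) - b
ρ` and `D₊σ = A' (ρ - σ) - b' σ` with bounded `b, b'`. Since `(φ + ψ) ^ (1 - p)` is comparable with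
the distance to the curve (`rate`), `A` and `A'` are comparable with `1 / (T x₀ - t)` in the
backward cone with apex `(x₀, T x₀)` (`exists_isExchangeAt`). Such an exchange is scale invariant. A
lower bound of Harnack type (`exchange_lower_bound`) shows that shrinking the cone to an eighth
contracts the joint oscillation of `ρ` and `σ` by a fixed factor, up to an error of the size of the
cone. The constants do not depend on the apex (`exchange_modulus`), so the slopes of the level
curves converge uniformly and `T` is `C¹`.

Uniqueness and the wave equation. Two solutions agree where both exist, and a solution that is
continuous at a point does not blow up there, so neither of two curves can lie below the other. The
wave equation corresponds to the system through `φ = uₜ + uₓ`, `ψ = uₜ - uₓ`; conversely `(φ - ψ) /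
2 dx + (φ + ψ) / 2 dt` is closed precisely because `D₋φ = D₊ψ`. -/

/-- The closed backward light cone with apex `z₁`, truncated at the time `t₀`. -/
def closedCone (t₀ : ℝ) (z₁ : ℝ × ℝ) : Set (ℝ × ℝ) :=
  {z | t₀ ≤ z.2 ∧ |z.1 - z₁.1| ≤ z₁.2 - z.2}

theorem isCompact_closedCone (t₀ : ℝ) (z₁ : ℝ × ℝ) : IsCompact (closedCone t₀ z₁) := by
  have hK : IsCompact (Icc (z₁.1 - (z₁.2 - t₀)) (z₁.1 + (z₁.2 - t₀)) ×ˢ Icc t₀ z₁.2) :=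
    isCompact_Icc.prod isCompact_Icc
  refine hK.of_isClosed_subset ?_ ?_
  · have h1 : IsClosed {z : ℝ × ℝ | t₀ ≤ z.2} := isClosed_le (by fun_prop) (by fun_prop)
    have h2 : IsClosed {z : ℝ × ℝ | |z.1 - z₁.1| ≤ z₁.2 - z.2} :=
      isClosed_le (by fun_prop) (by fun_prop)
    exact h1.inter h2
  · rintro z ⟨h1, h2⟩
    have h3 := abs_le.1 h2
    have h4 := abs_nonneg (z.1 - z₁.1)
    exact ⟨⟨by linarith, by linarith⟩, ⟨h1, by linarith⟩⟩

/-- The cone is a domain of dependence: backward characteristics of both families stay inside it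
down to its base. Besides compactness this is all that the minimum principle needs. -/
theorem closedCone_back_minus {t₀ : ℝ} {z₁ z : ℝ × ℝ} (hz : z ∈ closedCone t₀ z₁) {r : ℝ}
    (hr : r ≤ 0) (hr' : t₀ ≤ z.2 + r) : z + r • ((-1, 1) : ℝ × ℝ) ∈ closedCone t₀ z₁ := by
  obtain ⟨_, h2⟩ := hz
  have h3 := abs_le.1 h2
  refine ⟨by simpa using hr', ?_⟩
  rw [abs_le]
  simp only [Prod.fst_add, Prod.snd_add, Prod.smul_fst, Prod.smul_snd, smul_eq_mul]
  constructor <;> linarith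

theorem closedCone_back_plus {t₀ : ℝ} {z₁ z : ℝ × ℝ} (hz : z ∈ closedCone t₀ z₁) {r : ℝ}
    (hr : r ≤ 0) (hr' : t₀ ≤ z.2 + r) : z + r • ((1, 1) : ℝ × ℝ) ∈ closedCone t₀ z₁ := by
  obtain ⟨_, h2⟩ := hz
  have h3 := abs_le.1 h2
  refine ⟨by simpa using hr', ?_⟩
  rw [abs_le]
  simp only [Prod.fst_add, Prod.snd_add, Prod.smul_fst, Prod.smul_snd, smul_eq_mul]
  constructor <;> linarith

theorem apex_mem_closedCone {t₀ : ℝ} {z : ℝ × ℝ} (h : t₀ ≤ z.2) : z ∈ closedCone t₀ z :=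
  ⟨h, by simp⟩

/-- A function that is at least `a z` on a backward segment ending in `z` does not have a positive
derivative there. -/
theorem not_pos_of_le_backward {a : ℝ × ℝ → ℝ} {z e : ℝ × ℝ} {v δ : ℝ} (hδ : 0 < δ)
    (hmin : ∀ r, -δ ≤ r → r ≤ 0 → a z ≤ a (z + r • e)) (h : HasLineDerivAt ℝ a v z e) :
    v ≤ 0 := by
  by_contra hv
  push Not at hv
  have h2 := h.tendsto_slope_zero_left
  have h3 : ∀ᶠ r : ℝ in 𝓝[<] 0, 0 < r⁻¹ • (a (z + r • e) - a z) :=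
    h2.eventually_const_lt hv
  have h4 : ∀ᶠ r : ℝ in 𝓝[<] 0, -δ < r ∧ r < 0 := by
    have : Ioo (-δ) 0 ∈ 𝓝[<] (0:ℝ) := Ioo_mem_nhdsLT (by linarith)
    exact this
  obtain ⟨r, hr, hr1, hr2⟩ := (h3.and h4).exists
  have h5 := hmin r hr1.le hr2.le
  simp only [smul_eq_mul] at hr
  have h6 : r⁻¹ < 0 := inv_neg''.2 hr2
  nlinarith

/-- Minimum principle for a pair of functions that are transported along the two families of
characteristics. -/
theorem nonneg_of_lineDeriv_pos {t₀ : ℝ} {z₁ : ℝ × ℝ} {a b : ℝ × ℝ → ℝ}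
    (ha : ContinuousOn a (closedCone t₀ z₁)) (hb : ContinuousOn b (closedCone t₀ z₁))
    (ha0 : ∀ z ∈ closedCone t₀ z₁, z.2 = t₀ → 0 ≤ a z)
    (hb0 : ∀ z ∈ closedCone t₀ z₁, z.2 = t₀ → 0 ≤ b z)
    (hda : ∀ z ∈ closedCone t₀ z₁, t₀ < z.2 → a z < 0 → a z ≤ b z →
      ∃ v > 0, HasLineDerivAt ℝ a v z (-1, 1))
    (hdb : ∀ z ∈ closedCone t₀ z₁, t₀ < z.2 → b z < 0 → b z ≤ a z →
      ∃ v > 0, HasLineDerivAt ℝ b v z (1, 1)) :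
    ∀ z ∈ closedCone t₀ z₁, 0 ≤ a z ∧ 0 ≤ b z := by
  intro z hz
  -- At a negative minimum of `min a b` the smaller component is also minimal along its own backward
  -- characteristic, which contradicts its positive derivative there.
  obtain ⟨y, hy, hmin⟩ := (isCompact_closedCone t₀ z₁).exists_isMinOn ⟨z, hz⟩ (ContinuousOn.inf ha hb)
  have hmin' : ∀ x ∈ closedCone t₀ z₁, min (a y) (b y) ≤ min (a x) (b x) := fun x hx => isMinOn_iff.1 hmin x hx
  suffices h : 0 ≤ min (a y) (b y) by
    have := h.trans (hmin' z hz)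
    exact le_min_iff.1 this
  by_contra hneg
  push Not at hneg
  have hyt : t₀ < y.2 := by
    refine lt_of_le_of_ne hy.1 fun h => ?_
    exact absurd (le_min (ha0 y hy h.symm) (hb0 y hy h.symm)) (not_le.2 hneg)
  rcases le_total (a y) (b y) with hab | hab
  · rw [min_eq_left hab] at hneg hmin'
    obtain ⟨v, hv, h⟩ := hda y hy hyt hneg hab
    refine absurd (not_pos_of_le_backward (δ := y.2 - t₀) (by linarith) ?_ h) (not_le.2 hv)
    intro r hr hr'
    exact (hmin' _ (closedCone_back_minus hy hr' (by linarith))).trans (min_le_left _ _)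
  · rw [min_eq_right hab] at hneg hmin'
    obtain ⟨v, hv, h⟩ := hdb y hy hyt hneg hab
    refine absurd (not_pos_of_le_backward (δ := y.2 - t₀) (by linarith) ?_ h) (not_le.2 hv)
    intro r hr hr'
    exact (hmin' _ (closedCone_back_plus hy hr' (by linarith))).trans (min_le_right _ _)

/-- The derivative of `exp (-l t) a` along a direction with unit time component. -/
theorem hasLineDerivAt_exp_mul {a : ℝ × ℝ → ℝ} {v c : ℝ} {z : ℝ × ℝ} (l : ℝ)
    (h : HasLineDerivAt ℝ a v z (c, 1)) :
    HasLineDerivAt ℝ (fun z => Real.exp (-l * z.2) * a z)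
      (Real.exp (-l * z.2) * (v - l * a z)) z (c, 1) := by
  have h1 : HasDerivAt (fun r : ℝ => a (z + r • ((c, 1) : ℝ × ℝ))) v 0 := h
  have h2 : HasDerivAt (fun r : ℝ => Real.exp (-l * (z + r • ((c, 1) : ℝ × ℝ)).2))
      (Real.exp (-l * z.2) * (-l)) 0 := by
    have h3 : HasDerivAt (fun r : ℝ => -l * (z.2 + r)) (-l) 0 := by
      simpa using ((hasDerivAt_id (0:ℝ)).const_add z.2).const_mul (-l)
    simpa using h3.exp
  have h3 := h2.mul h1
  refine (h3.congr_deriv ?_ : HasDerivAt _ _ _)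
  simp
  ring

/-- Comparison principle for the linear system with nonnegative bounded coupling. -/
theorem nonneg_of_lineDeriv_ge {t₀ L : ℝ} (hL : 0 ≤ L) {z₁ : ℝ × ℝ} {a b va vb : ℝ × ℝ → ℝ}
    (ha : ContinuousOn a (closedCone t₀ z₁)) (hb : ContinuousOn b (closedCone t₀ z₁))
    (ha0 : ∀ z ∈ closedCone t₀ z₁, z.2 = t₀ → 0 ≤ a z)
    (hb0 : ∀ z ∈ closedCone t₀ z₁, z.2 = t₀ → 0 ≤ b z)
    (hda : ∀ z ∈ closedCone t₀ z₁, t₀ < z.2 → HasLineDerivAt ℝ a (va z) z (-1, 1))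
    (hdb : ∀ z ∈ closedCone t₀ z₁, t₀ < z.2 → HasLineDerivAt ℝ b (vb z) z (1, 1))
    (hva : ∀ z ∈ closedCone t₀ z₁, t₀ < z.2 → L * min (a z + b z) 0 ≤ va z)
    (hvb : ∀ z ∈ closedCone t₀ z₁, t₀ < z.2 → L * min (a z + b z) 0 ≤ vb z) :
    ∀ z ∈ closedCone t₀ z₁, 0 ≤ a z ∧ 0 ≤ b z := by
  -- At a negative minimum `x ≤ y` the coupling is at least `2 * L * x`; a weight `exp (-l t)` with
  -- `l > 2 * L` makes the derivative strictly positive.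
  set l := 2 * L + 1
  have hexp : ContinuousOn (fun z : ℝ × ℝ => Real.exp (-l * z.2)) (closedCone t₀ z₁) := by fun_prop
  have key : ∀ x y : ℝ, x < 0 → x ≤ y → l * x < L * min (x + y) 0 := by
    intro x y hx hxy
    have h : 2 * x ≤ min (x + y) 0 := le_min (by linarith) (by linarith)
    have := mul_le_mul_of_nonneg_left h hL
    simp only [l]
    linarith
  have := nonneg_of_lineDeriv_pos (a := fun z => Real.exp (-l * z.2) * a z)
    (b := fun z => Real.exp (-l * z.2) * b z) (hexp.mul ha) (hexp.mul hb)
    (fun z hz h => mul_nonneg (Real.exp_pos _).le (ha0 z hz h))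
    (fun z hz h => mul_nonneg (Real.exp_pos _).le (hb0 z hz h)) ?_ ?_
  · intro z hz
    obtain ⟨h1, h2⟩ := this z hz
    exact ⟨(mul_nonneg_iff_of_pos_left (Real.exp_pos _)).1 h1,
      (mul_nonneg_iff_of_pos_left (Real.exp_pos _)).1 h2⟩
  · intro z hz hzt h1 h2
    have h1' : a z < 0 := by
      by_contra h
      exact absurd (mul_nonneg (Real.exp_pos _).le (not_lt.1 h)) (not_le.2 h1)
    have h2' : a z ≤ b z := le_of_mul_le_mul_left h2 (Real.exp_pos _)
    refine ⟨_, mul_pos (Real.exp_pos (-l * z.2)) ?_, hasLineDerivAt_exp_mul l (hda z hz hzt)⟩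
    linarith [key _ _ h1' h2', hva z hz hzt]
  · intro z hz hzt h1 h2
    have h1' : b z < 0 := by
      by_contra h
      exact absurd (mul_nonneg (Real.exp_pos _).le (not_lt.1 h)) (not_le.2 h1)
    have h2' : b z ≤ a z := le_of_mul_le_mul_left h2 (Real.exp_pos _)
    refine ⟨_, mul_pos (Real.exp_pos (-l * z.2)) ?_, hasLineDerivAt_exp_mul l (hdb z hz hzt)⟩
    have := key _ _ h1' h2'
    rw [add_comm (b z)] at this
    linarith [hvb z hz hzt]

/-- Uniqueness for systems with a Lipschitz coupling. -/
theorem eq_zero_of_abs_lineDeriv_le {t₀ L : ℝ} (hL : 0 ≤ L) {z₁ : ℝ × ℝ}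
    {a b va vb : ℝ × ℝ → ℝ}
    (ha : ContinuousOn a (closedCone t₀ z₁)) (hb : ContinuousOn b (closedCone t₀ z₁))
    (ha0 : ∀ z ∈ closedCone t₀ z₁, z.2 = t₀ → a z = 0)
    (hb0 : ∀ z ∈ closedCone t₀ z₁, z.2 = t₀ → b z = 0)
    (hda : ∀ z ∈ closedCone t₀ z₁, t₀ < z.2 → HasLineDerivAt ℝ a (va z) z (-1, 1))
    (hdb : ∀ z ∈ closedCone t₀ z₁, t₀ < z.2 → HasLineDerivAt ℝ b (vb z) z (1, 1))
    (hva : ∀ z ∈ closedCone t₀ z₁, t₀ < z.2 → |va z| ≤ L * |a z + b z|)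
    (hvb : ∀ z ∈ closedCone t₀ z₁, t₀ < z.2 → |vb z| ≤ L * |a z + b z|) :
    ∀ z ∈ closedCone t₀ z₁, a z = 0 ∧ b z = 0 := by
  -- Where `a ^ 2` dominates `b ^ 2`, the derivative of `a ^ 2` is at most `4 * L * a ^ 2`.
  set l := 4 * L + 1
  have hexp : ContinuousOn (fun z : ℝ × ℝ => Real.exp (-l * z.2)) (closedCone t₀ z₁) := by fun_prop
  have hsq : ∀ {u : ℝ × ℝ → ℝ} {v c : ℝ} {z : ℝ × ℝ} (ε : ℝ), HasLineDerivAt ℝ u v z (c, 1) →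
      HasLineDerivAt ℝ (fun z => ε - Real.exp (-l * z.2) * (u z) ^ 2)
        (Real.exp (-l * z.2) * (l * (u z) ^ 2 - 2 * u z * v)) z (c, 1) := by
    intro u v c z ε h
    have h1 : HasLineDerivAt ℝ (fun z => (u z) ^ 2) (2 * u z * v) z (c, 1) := by
      have h2 : HasDerivAt (fun r : ℝ => u (z + r • ((c, 1) : ℝ × ℝ))) v 0 := h
      have h3 := h2.pow 2
      exact h3.congr_deriv (by simp)
    have h2 : HasDerivAt _ _ _ := hasLineDerivAt_exp_mul l h1
    refine ((h2.const_sub ε).congr_deriv ?_ : HasDerivAt _ _ _)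
    ring
  have key : ∀ x y v : ℝ, x ≠ 0 → y ^ 2 ≤ x ^ 2 → |v| ≤ L * |x + y| →
      0 < l * x ^ 2 - 2 * x * v := by
    intro x y v hx hxy hv
    have h1 : |y| ≤ |x| := sq_le_sq.1 hxy
    have h2 : |x + y| ≤ 2 * |x| := (abs_add_le x y).trans (by linarith)
    have h3 : x * v ≤ |x| * |v| := by rw [← abs_mul]; exact le_abs_self _
    have h4 : |v| ≤ L * (2 * |x|) := hv.trans (mul_le_mul_of_nonneg_left h2 hL)
    have h5 : |x| * |v| ≤ |x| * (L * (2 * |x|)) := mul_le_mul_of_nonneg_left h4 (abs_nonneg x)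
    have h6 : |x| * (L * (2 * |x|)) = 2 * L * x ^ 2 := by rw [← sq_abs x]; ring
    have h7 : 0 < x ^ 2 := by positivity
    simp only [l]
    nlinarith
  -- Squares replace absolute values in order to stay differentiable. The margin `ε` guarantees that
  -- the component under consideration is nonzero where the minimum principle is tested.
  have main : ∀ ε > 0, ∀ z ∈ closedCone t₀ z₁,
      0 ≤ ε - Real.exp (-l * z.2) * (a z) ^ 2 ∧ 0 ≤ ε - Real.exp (-l * z.2) * (b z) ^ 2 := by
    intro ε hε
    refine nonneg_of_lineDeriv_pos (continuousOn_const.sub (hexp.mul (ha.pow 2)))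
      (continuousOn_const.sub (hexp.mul (hb.pow 2))) ?_ ?_ ?_ ?_
    · intro z hz h
      simp [ha0 z hz h, hε.le]
    · intro z hz h
      simp [hb0 z hz h, hε.le]
    · intro z hz hzt h1 h2
      have hx : a z ≠ 0 := by
        intro h
        rw [h] at h1
        simp at h1
        linarith
      have h2' : (b z) ^ 2 ≤ (a z) ^ 2 :=
        le_of_mul_le_mul_left (by linarith) (Real.exp_pos (-l * z.2))
      exact ⟨_, mul_pos (Real.exp_pos _) (key _ _ _ hx h2' (hva z hz hzt)), hsq ε (hda z hz hzt)⟩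
    · intro z hz hzt h1 h2
      have hx : b z ≠ 0 := by
        intro h
        rw [h] at h1
        simp at h1
        linarith
      have h2' : (a z) ^ 2 ≤ (b z) ^ 2 :=
        le_of_mul_le_mul_left (by linarith) (Real.exp_pos (-l * z.2))
      have h3 := hvb z hz hzt
      rw [add_comm] at h3
      exact ⟨_, mul_pos (Real.exp_pos _) (key _ _ _ hx h2' h3), hsq ε (hdb z hz hzt)⟩
  intro z hz
  have h1 : Real.exp (-l * z.2) * (a z) ^ 2 ≤ 0 :=
    le_of_forall_pos_le_add fun ε hε => by linarith [(main ε hε z hz).1]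
  have h2 : Real.exp (-l * z.2) * (b z) ^ 2 ≤ 0 :=
    le_of_forall_pos_le_add fun ε hε => by linarith [(main ε hε z hz).2]
  have h3 : ∀ x : ℝ, Real.exp (-l * z.2) * x ^ 2 ≤ 0 → x = 0 := by
    intro x hx
    by_contra h
    have : 0 < x ^ 2 := by positivity
    exact absurd (mul_pos (Real.exp_pos (-l * z.2)) this) (not_lt.2 hx)
  exact ⟨h3 _ h1, h3 _ h2⟩

end DampedWave

/-! ### Integration along characteristics and global mild solutions -/

noncomputable section

namespace DampedWave

/-- The integral of `k` from the line `t = 0` to `z` along the line of slope `-c`. -/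
def charIntegral (c : ℝ) (k : ℝ × ℝ → ℝ) (z : ℝ × ℝ) : ℝ :=
  ∫ s in (0:ℝ)..z.2, k (z.1 + c * (z.2 - s), s)

theorem charIntegral_zero (c : ℝ) (k : ℝ × ℝ → ℝ) (x : ℝ) : charIntegral c k (x, 0) = 0 := by
  simp [charIntegral]

theorem continuous_charIntegral {c : ℝ} {k : ℝ × ℝ → ℝ} (hk : Continuous k) :
    Continuous (charIntegral c k) := by
  unfold charIntegral
  refine intervalIntegral.continuous_parametric_intervalIntegral_of_continuous
    (f := fun (z : ℝ × ℝ) s => k (z.1 + c * (z.2 - s), s)) ?_ continuous_snd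
  simp only [Function.uncurry_def]
  fun_prop

theorem charIntegral_sub {c : ℝ} {k k' : ℝ × ℝ → ℝ} (hk : Continuous k) (hk' : Continuous k')
    (z : ℝ × ℝ) :
    charIntegral c (fun y => k y - k' y) z = charIntegral c k z - charIntegral c k' z := by
  unfold charIntegral
  rw [intervalIntegral.integral_sub]
  · exact (Continuous.intervalIntegrable (by fun_prop) _ _)
  · exact (Continuous.intervalIntegrable (by fun_prop) _ _)

theorem charIntegral_const_mul (c r : ℝ) (k : ℝ × ℝ → ℝ) (z : ℝ × ℝ) :
    charIntegral c (fun y => r * k y) z = r * charIntegral c k z := by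
  unfold charIntegral
  rw [intervalIntegral.integral_const_mul]

theorem charIntegral_shift (c h : ℝ) (k : ℝ × ℝ → ℝ) (x t : ℝ) :
    charIntegral c k (x + h, t) = charIntegral c (fun y => k (y.1 + h, y.2)) (x, t) := by
  unfold charIntegral
  congr 1
  ext s
  congr 2
  ring

/-- The factor `1 / l` is the point: in the norm weighted by `exp (-l |t|)` integration from the
initial line is small for large `l`, uniformly on the whole plane. Negative times follow by
reflection. -/
theorem abs_integral_le_exp {l c t : ℝ} (hl : 0 < l) (hc : 0 ≤ c) {k : ℝ → ℝ}
    (hk : ∀ s, |s| ≤ |t| → |k s| ≤ c * Real.exp (l * |s|)) :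
    |∫ s in (0:ℝ)..t, k s| ≤ c * Real.exp (l * |t|) / l := by
  have key : ∀ t : ℝ, 0 ≤ t → ∀ k : ℝ → ℝ,
      (∀ s, 0 ≤ s → s ≤ t → |k s| ≤ c * Real.exp (l * s)) →
      |∫ s in (0:ℝ)..t, k s| ≤ c * Real.exp (l * t) / l := by
    intro t ht k hk
    have h1 : ‖∫ s in (0:ℝ)..t, k s‖ ≤ ∫ s in (0:ℝ)..t, c * Real.exp (l * s) := by
      refine intervalIntegral.norm_integral_le_of_norm_le ht ?_ ?_
      · exact Filter.Eventually.of_forall fun s hs => hk s hs.1.le hs.2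
      · exact Continuous.intervalIntegrable (by fun_prop) _ _
    have h2 : ∫ s in (0:ℝ)..t, c * Real.exp (l * s) =
        c * Real.exp (l * t) / l - c * Real.exp (l * 0) / l := by
      refine intervalIntegral.integral_eq_sub_of_hasDerivAt (f := fun s => c * Real.exp (l * s) / l)
        (fun s _ => ?_) (Continuous.intervalIntegrable (by fun_prop) _ _)
      have h3 : HasDerivAt (fun s : ℝ => l * s) l s := by
        simpa using (hasDerivAt_id s).const_mul l
      refine ((h3.exp.const_mul c).div_const l).congr_deriv ?_
      field_simp
    have h3 : 0 ≤ c * Real.exp (l * 0) / l := by positivity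
    rw [h2] at h1
    exact h1.trans (by linarith)
  rcases le_total 0 t with ht | ht
  · rw [abs_of_nonneg ht] at hk ⊢
    exact key t ht k fun s hs hs' => by
      have := hk s (by rwa [abs_of_nonneg hs])
      rwa [abs_of_nonneg hs] at this
  · rw [abs_of_nonpos ht] at hk ⊢
    have h1 := key (-t) (by linarith) (fun s => k (-s)) fun s hs hs' => by
      have := hk (-s) (by rwa [abs_neg, abs_of_nonneg hs])
      rwa [abs_neg, abs_of_nonneg hs] at this
    rw [intervalIntegral.integral_comp_neg, neg_neg, neg_zero, intervalIntegral.integral_symm,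
      abs_neg] at h1
    exact h1

theorem abs_charIntegral_le {l c C : ℝ} (hl : 0 < l) (hC : 0 ≤ C) {k : ℝ × ℝ → ℝ} {z : ℝ × ℝ}
    (hk : ∀ y : ℝ × ℝ, |y.2| ≤ |z.2| → |k y| ≤ C * Real.exp (l * |y.2|)) :
    |charIntegral c k z| ≤ C * Real.exp (l * |z.2|) / l :=
  abs_integral_le_exp hl hC fun s hs => hk (z.1 + c * (z.2 - s), s) hs

/-- Moving `z` in the direction `(-c, 1)` keeps its line of integration and changes only the upper
limit, so the fundamental theorem of calculus suffices and `k` need not be differentiable. -/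
theorem hasLineDerivAt_charIntegral {c : ℝ} {k : ℝ × ℝ → ℝ} (hk : Continuous k) (z : ℝ × ℝ) :
    HasLineDerivAt ℝ (charIntegral c k) (k z) z (-c, 1) := by
  have h1 : HasDerivAt (fun u => ∫ s in (0:ℝ)..u, k (z.1 + c * (z.2 - s), s))
      (k (z.1 + c * (z.2 - z.2), z.2)) z.2 := by
    have hc : Continuous fun s => k (z.1 + c * (z.2 - s), s) := by fun_prop
    exact intervalIntegral.integral_hasDerivAt_right (hc.intervalIntegrable _ _)
      (hc.stronglyMeasurableAtFilter _ _) hc.continuousAt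
  have h2 : HasDerivAt (fun r : ℝ => z.2 + r) 1 0 := by
    simpa using (hasDerivAt_id (0:ℝ)).const_add z.2
  have h3 := HasDerivAt.comp (0:ℝ) (h₂ := fun u => ∫ s in (0:ℝ)..u, k (z.1 + c * (z.2 - s), s))
    (by simpa using h1) h2
  have h4 : HasDerivAt (fun r : ℝ => charIntegral c k (z + r • ((-c, 1) : ℝ × ℝ))) (k z) 0 := by
    refine (h3.congr_deriv (by simp)).congr_of_eventuallyEq (Filter.Eventually.of_forall ?_)
    intro r
    simp only [charIntegral, Function.comp, Prod.fst_add, Prod.snd_add, Prod.smul_fst,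
      Prod.smul_snd, smul_eq_mul, mul_one]
    congr 1
    ext s
    congr 2
    ring
  exact h4

/-- `(φ, ψ)` is a mild solution of `D₋φ = D₊ψ = G(z, φ + ψ)` on the whole plane, with data
`(f, g)` on the line `t = 0`. -/
structure IsMild (f g : ℝ → ℝ) (G : ℝ × ℝ → ℝ → ℝ) (φ ψ : ℝ × ℝ → ℝ) : Prop where
  continuous_left : Continuous φ
  continuous_right : Continuous ψ
  bound : ∃ K l, 0 ≤ K ∧ 0 < l ∧ ∀ z, |φ z| ≤ K * Real.exp (l * |z.2|) ∧
    |ψ z| ≤ K * Real.exp (l * |z.2|)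
  left : ∀ z, φ z = f (z.1 + z.2) + charIntegral 1 (fun y => G y (φ y + ψ y)) z
  right : ∀ z, ψ z = g (z.1 - z.2) + charIntegral (-1) (fun y => G y (φ y + ψ y)) z

/-- Banach's fixed point theorem for the pair multiplied by `exp (-l |t|)`, in the bounded
continuous functions on the plane. The coupling has Lipschitz constant `2 * L` there, and `l = 4 * L
+ 1` brings the contraction factor below `1 / 2`. Negative times are included so that the initial
line is not a boundary. -/
theorem exists_isMild {f g : ℝ → ℝ} {G : ℝ × ℝ → ℝ → ℝ} {B C L : ℝ} (hL : 0 ≤ L)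
    (hf : Continuous f) (hg : Continuous g) (hfB : ∀ x, |f x| ≤ B) (hgB : ∀ x, |g x| ≤ B)
    (hG : Continuous fun q : (ℝ × ℝ) × ℝ => G q.1 q.2)
    (hGL : ∀ z w w', |G z w - G z w'| ≤ L * |w - w'|) (hG0 : ∀ z, |G z 0| ≤ C) :
    ∃ φ ψ, IsMild f g G φ ψ := by
  have hB : 0 ≤ B := (abs_nonneg _).trans (hfB 0)
  have hC : 0 ≤ C := (abs_nonneg _).trans (hG0 0)
  set l : ℝ := 4 * L + 1 with hl_def
  have hl : 0 < l := by positivity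
  have hl1 : 1 ≤ l := by linarith
  let X := BoundedContinuousFunction (ℝ × ℝ) (ℝ × ℝ)
  let u : X → ℝ × ℝ → ℝ := fun y z => Real.exp (l * |z.2|) * ((y z).1 + (y z).2)
  have hu : ∀ y, Continuous (u y) := fun y => by
    have := y.continuous
    simp only [u]
    fun_prop
  have hGu : ∀ y, Continuous fun z => G z (u y z) := fun y => by
    have := hu y
    exact hG.comp (by fun_prop : Continuous fun z => (z, u y z))
  have hsum : ∀ y y' : X, ∀ z, |u y z - u y' z| ≤ 2 * dist y y' * Real.exp (l * |z.2|) := by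
    intro y y' z
    have h1 : dist (y z) (y' z) ≤ dist y y' := BoundedContinuousFunction.dist_coe_le_dist z
    have h2 : |(y z).1 - (y' z).1| ≤ dist y y' := le_trans (by
      rw [← Real.dist_eq]; exact le_max_left _ _) h1
    have h3 : |(y z).2 - (y' z).2| ≤ dist y y' := le_trans (by
      rw [← Real.dist_eq]; exact le_max_right _ _) h1
    have h4 : u y z - u y' z =
        Real.exp (l * |z.2|) * (((y z).1 - (y' z).1) + ((y z).2 - (y' z).2)) := by
      simp only [u]; ring
    rw [h4, abs_mul, abs_of_pos (Real.exp_pos _), mul_comm]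
    gcongr
    exact (abs_add_le _ _).trans (by linarith)
  let E : ℝ × ℝ → ℝ := fun z => Real.exp (-(l * |z.2|))
  have hE : Continuous E := by simp only [E]; fun_prop
  have hE0 : ∀ z, 0 < E z := fun z => Real.exp_pos _
  have hE1 : ∀ z, E z ≤ 1 := fun z => by
    simp only [E]
    rw [Real.exp_le_one_iff]
    have := abs_nonneg z.2
    nlinarith
  have hEm : ∀ z : ℝ × ℝ, E z * Real.exp (l * |z.2|) = 1 := fun z => by
    simp only [E]
    rw [← Real.exp_add]; simp
  let Fφ : X → ℝ × ℝ → ℝ := fun y z =>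
    E z * (f (z.1 + z.2) + charIntegral 1 (fun z => G z (u y z)) z)
  let Fψ : X → ℝ × ℝ → ℝ := fun y z =>
    E z * (g (z.1 - z.2) + charIntegral (-1) (fun z => G z (u y z)) z)
  have hFφ : ∀ y, Continuous (Fφ y) := fun y => by
    have := continuous_charIntegral (c := 1) (hGu y)
    simp only [Fφ]
    fun_prop
  have hFψ : ∀ y, Continuous (Fψ y) := fun y => by
    have := continuous_charIntegral (c := -1) (hGu y)
    simp only [Fψ]
    fun_prop
  have hGb : ∀ y : X, ∀ z : ℝ × ℝ, |G z (u y z)| ≤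
      (C + L * (2 * dist y 0)) * Real.exp (l * |z.2|) := by
    intro y z
    have h1 := hGL z (u y z) 0
    have h2 := hsum y 0 z
    have h0 : (0 : X) z = 0 := rfl
    have h3 : u 0 z = 0 := by simp [u, h0]
    rw [h3] at h2
    have h4 : (1:ℝ) ≤ Real.exp (l * |z.2|) := by
      rw [Real.one_le_exp_iff]; positivity
    have h5 : |G z (u y z)| ≤ |G z (u y z) - G z 0| + |G z 0| := by
      have := abs_add_le (G z (u y z) - G z 0) (G z 0)
      simpa using this
    have h6 := mul_le_mul_of_nonneg_left h2 hL
    have h7 : C * 1 ≤ C * Real.exp (l * |z.2|) := mul_le_mul_of_nonneg_left h4 hC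
    have := hG0 z
    linarith
  have hbound : ∀ y : X, ∀ c z, |E z * charIntegral c (fun z => G z (u y z)) z| ≤
      (C + L * (2 * dist y 0)) / l := by
    intro y c z
    have h1 := abs_charIntegral_le (c := c) (z := z) hl (by positivity) fun q _ => hGb y q
    rw [abs_mul, abs_of_pos (hE0 z)]
    refine (mul_le_mul_of_nonneg_left h1 (hE0 z).le).trans (le_of_eq ?_)
    rw [mul_div_assoc', mul_left_comm, hEm, mul_one]
  have hdata : ∀ (h : ℝ → ℝ), (∀ x, |h x| ≤ B) → ∀ z x, |E z * h x| ≤ B := by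
    intro h hh z x
    rw [abs_mul, abs_of_pos (hE0 z)]
    calc E z * |h x| ≤ 1 * B := mul_le_mul (hE1 z) (hh x) (abs_nonneg _) zero_le_one
      _ = B := one_mul B
  let Φ : X → X := fun y => BoundedContinuousFunction.ofNormedAddCommGroup
    (fun z => (Fφ y z, Fψ y z)) ((hFφ y).prodMk (hFψ y)) (B + (C + L * (2 * dist y 0)) / l) (by
      intro z
      refine max_le ?_ ?_
      · simp only [Fφ, Real.norm_eq_abs, mul_add]
        exact (abs_add_le _ _).trans (add_le_add (hdata f hfB z _) (hbound y 1 z))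
      · simp only [Fψ, Real.norm_eq_abs, mul_add]
        exact (abs_add_le _ _).trans (add_le_add (hdata g hgB z _) (hbound y (-1) z)))
  have hdiff : ∀ (y y' : X) (c : ℝ) (z : ℝ × ℝ),
      |E z * (charIntegral c (fun z => G z (u y z)) z - charIntegral c (fun z => G z (u y' z)) z)|
        ≤ (1 / 2) * dist y y' := by
    intro y y' c z
    rw [← charIntegral_sub (hGu y) (hGu y')]
    have h1 := abs_charIntegral_le (c := c) (z := z) (C := L * (2 * dist y y')) hl (by positivity)
      (k := fun q => G q (u y q) - G q (u y' q)) fun q _ => by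
        refine (hGL q _ _).trans ?_
        rw [mul_assoc]
        exact mul_le_mul_of_nonneg_left (hsum y y' q) hL
    rw [abs_mul, abs_of_pos (hE0 z)]
    refine (mul_le_mul_of_nonneg_left h1 (hE0 z).le).trans ?_
    rw [mul_div_assoc', mul_left_comm, hEm, mul_one, div_le_iff₀ hl]
    have : (0:ℝ) ≤ dist y y' := dist_nonneg
    rw [hl_def]
    nlinarith
  have hcontr : ContractingWith (1 / 2) Φ := by
    refine ⟨by
      rw [← NNReal.coe_lt_coe]
      norm_num, LipschitzWith.of_dist_le_mul fun y y' => ?_⟩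
    have hk : (((1 / 2 : NNReal)) : ℝ) = 1 / 2 := by norm_num
    rw [hk]
    refine (BoundedContinuousFunction.dist_le (by positivity)).2 fun z => ?_
    refine max_le ?_ ?_
    · have := hdiff y y' 1 z
      rw [Real.dist_eq]
      refine le_trans (le_of_eq ?_) this
      change |Fφ y z - Fφ y' z| = _
      simp only [Fφ]
      congr 1
      ring
    · have := hdiff y y' (-1) z
      rw [Real.dist_eq]
      refine le_trans (le_of_eq ?_) this
      change |Fψ y z - Fψ y' z| = _
      simp only [Fψ]
      congr 1
      ring
  obtain ⟨y, hy⟩ : ∃ y, Φ y = y := ⟨_, hcontr.fixedPoint_isFixedPt⟩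
  have hy1 : ∀ z, (y z).1 = Fφ y z := fun z => by
    conv_lhs => rw [← hy]
    rfl
  have hy2 : ∀ z, (y z).2 = Fψ y z := fun z => by
    conv_lhs => rw [← hy]
    rfl
  have hyc := y.continuous
  have hEm' : ∀ z : ℝ × ℝ, ∀ x : ℝ, Real.exp (l * |z.2|) * (E z * x) = x := fun z x => by
    rw [← mul_assoc, mul_comm (Real.exp _), hEm, one_mul]
  have hsumeq : (fun q : ℝ × ℝ => G q (Real.exp (l * |q.2|) * (y q).1 +
      Real.exp (l * |q.2|) * (y q).2)) = fun q => G q (u y q) := by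
    ext q
    simp only [u, mul_add]
  refine ⟨fun z => Real.exp (l * |z.2|) * (y z).1, fun z => Real.exp (l * |z.2|) * (y z).2,
    by fun_prop, by fun_prop, ⟨‖y‖, l, norm_nonneg _, hl, fun z => ?_⟩, fun z => ?_, fun z => ?_⟩
  · have h1 := y.norm_coe_le_norm z
    have h2 : |(y z).1| ≤ ‖y‖ := (norm_fst_le (y z)).trans h1
    have h3 : |(y z).2| ≤ ‖y‖ := (norm_snd_le (y z)).trans h1
    rw [abs_mul, abs_mul, abs_of_pos (Real.exp_pos _), mul_comm _ |(y z).1|, mul_comm _ |(y z).2|]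
    exact ⟨by gcongr, by gcongr⟩
  · rw [hsumeq, hy1]
    exact hEm' z _
  · rw [hsumeq, hy2]
    exact hEm' z _

end DampedWave
end

/-! ### Gronwall's inequality and continuous differentiability of mild solutions -/

noncomputable section

namespace DampedWave

/-- The map `m ↦ η + m / 2` has the fixed point `2 * η`, and iterating it from any a priori bound
converges there. The size of `m₀` is therefore lost in the conclusion. -/
theorem bound_of_halving {a b : ℝ × ℝ → ℝ} {τ l m₀ η : ℝ} (hm₀ : 0 ≤ m₀) (hη : 0 ≤ η)
    (h₀ : ∀ z : ℝ × ℝ, |z.2| ≤ τ →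
      |a z| ≤ m₀ * Real.exp (l * |z.2|) ∧ |b z| ≤ m₀ * Real.exp (l * |z.2|))
    (hstep : ∀ m, 0 ≤ m → (∀ z : ℝ × ℝ, |z.2| ≤ τ →
      |a z| ≤ m * Real.exp (l * |z.2|) ∧ |b z| ≤ m * Real.exp (l * |z.2|)) →
      ∀ z : ℝ × ℝ, |z.2| ≤ τ → |a z| ≤ (η + m / 2) * Real.exp (l * |z.2|) ∧
        |b z| ≤ (η + m / 2) * Real.exp (l * |z.2|))
    (z : ℝ × ℝ) (hz : |z.2| ≤ τ) :
    |a z| ≤ 2 * η * Real.exp (l * |z.2|) ∧ |b z| ≤ 2 * η * Real.exp (l * |z.2|) := by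
  have key : ∀ n : ℕ, ∀ z : ℝ × ℝ, |z.2| ≤ τ →
      |a z| ≤ (2 * η + m₀ * (1 / 2) ^ n) * Real.exp (l * |z.2|) ∧
      |b z| ≤ (2 * η + m₀ * (1 / 2) ^ n) * Real.exp (l * |z.2|) := by
    intro n
    induction n with
    | zero =>
      intro z hz
      have h1 := h₀ z hz
      have h2 : m₀ * Real.exp (l * |z.2|) ≤ (2 * η + m₀ * (1 / 2) ^ 0) * Real.exp (l * |z.2|) := by
        gcongr
        simp
        exact hη
      exact ⟨h1.1.trans h2, h1.2.trans h2⟩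
    | succ n ih =>
      have := hstep _ (by positivity) ih
      have e : η + (2 * η + m₀ * (1 / 2) ^ n) / 2 = 2 * η + m₀ * (1 / 2) ^ (n + 1) := by
        rw [pow_succ]; ring
      rwa [e] at this
  have hlim : Tendsto (fun n : ℕ => (2 * η + m₀ * (1 / 2) ^ n) * Real.exp (l * |z.2|)) atTop
      (𝓝 (2 * η * Real.exp (l * |z.2|))) := by
    have h1 : Tendsto (fun n : ℕ => ((1:ℝ) / 2) ^ n) atTop (𝓝 0) :=
      tendsto_pow_atTop_nhds_zero_of_lt_one (by norm_num) (by norm_num)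
    simpa using ((h1.const_mul m₀).const_add (2 * η)).mul_const (Real.exp (l * |z.2|))
  exact ⟨ge_of_tendsto' hlim fun n => (key n z hz).1, ge_of_tendsto' hlim fun n => (key n z hz).2⟩

/-- Gronwall's inequality for mild solutions. -/
theorem mild_gronwall {a b a₀ b₀ ka kb : ℝ × ℝ → ℝ} {τ L η m₀ : ℝ} (hL : 0 ≤ L) (hη : 0 ≤ η)
    (ha : ∀ z, a z = a₀ z + charIntegral 1 ka z) (hb : ∀ z, b z = b₀ z + charIntegral (-1) kb z)
    (ha₀ : ∀ z, |a₀ z| ≤ η) (hb₀ : ∀ z, |b₀ z| ≤ η)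
    (hka : ∀ z : ℝ × ℝ, |z.2| ≤ τ → |ka z| ≤ L * (|a z| + |b z|) + η)
    (hkb : ∀ z : ℝ × ℝ, |z.2| ≤ τ → |kb z| ≤ L * (|a z| + |b z|) + η)
    (hm₀ : ∀ z : ℝ × ℝ, |z.2| ≤ τ → |a z| ≤ m₀ ∧ |b z| ≤ m₀)
    (z : ℝ × ℝ) (hz : |z.2| ≤ τ) :
    |a z| ≤ 4 * η * Real.exp ((4 * L + 1) * |z.2|) ∧
      |b z| ≤ 4 * η * Real.exp ((4 * L + 1) * |z.2|) := by
  set l := 4 * L + 1 with hl_def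
  have hl : 0 < l := by positivity
  have h1 : ∀ z : ℝ × ℝ, 1 ≤ Real.exp (l * |z.2|) := fun z => by
    rw [Real.one_le_exp_iff]; positivity
  have hm : 0 ≤ m₀ := (abs_nonneg _).trans (hm₀ z hz).1
  have := bound_of_halving (a := a) (b := b) (τ := τ) (l := l) (η := 2 * η) hm (by positivity)
    (fun z hz => ⟨(hm₀ z hz).1.trans (le_mul_of_one_le_right hm (h1 z)),
      (hm₀ z hz).2.trans (le_mul_of_one_le_right hm (h1 z))⟩) ?_ z hz
  · rwa [show 2 * (2 * η) = 4 * η by ring] at this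
  · intro m hm hab z hz
    have hk : ∀ k : ℝ × ℝ → ℝ, (∀ z : ℝ × ℝ, |z.2| ≤ τ → |k z| ≤ L * (|a z| + |b z|) + η) →
        ∀ c, |charIntegral c k z| ≤ (η + m / 2) * Real.exp (l * |z.2|) := by
      intro k hk c
      have h2 := abs_charIntegral_le (c := c) (z := z) (C := L * (2 * m) + η) (k := k) hl
        (by positivity) fun y hy => by
          have h3 := hk y (hy.trans hz)
          have h4 := hab y (hy.trans hz)
          have h5 : L * (|a y| + |b y|) ≤ L * (2 * m * Real.exp (l * |y.2|)) :=
            mul_le_mul_of_nonneg_left (by linarith) hL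
          have h6 : η * 1 ≤ η * Real.exp (l * |y.2|) := mul_le_mul_of_nonneg_left (h1 y) hη
          linarith
      refine h2.trans ?_
      rw [div_le_iff₀ hl]
      have h3 : L * (2 * m) + η ≤ (η + m / 2) * l := by
        rw [hl_def]
        nlinarith [mul_nonneg hL hη]
      have := mul_le_mul_of_nonneg_right h3 (Real.exp_pos (l * |z.2|)).le
      linarith
    have h7 : ∀ c : ℝ, c + (η + m / 2) * Real.exp (l * |z.2|) ≤
        c - η * Real.exp (l * |z.2|) + (2 * η + m / 2) * Real.exp (l * |z.2|) := fun c => by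
      apply le_of_eq; ring
    have h8 : η * 1 ≤ η * Real.exp (l * |z.2|) := mul_le_mul_of_nonneg_left (h1 z) hη
    constructor
    · rw [ha]
      have := (abs_add_le (a₀ z) (charIntegral 1 ka z)).trans (add_le_add (ha₀ z) (hk ka hka 1))
      linarith [h7 η]
    · rw [hb]
      have := (abs_add_le (b₀ z) (charIntegral (-1) kb z)).trans
        (add_le_add (hb₀ z) (hk kb hkb (-1)))
      linarith [h7 η]

theorem hasDerivAt_of_quadratic {u : ℝ → ℝ} {x u' C : ℝ}
    (h : ∀ δ, |u (x + δ) - u x - δ * u'| ≤ C * δ ^ 2) : HasDerivAt u u' x := by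
  rw [hasDerivAt_iff_isLittleO_nhds_zero]
  have h1 : (fun δ : ℝ => u (x + δ) - u x - δ • u') =O[𝓝 0] fun δ : ℝ => δ ^ 2 := by
    refine Asymptotics.IsBigO.of_bound C (Filter.Eventually.of_forall fun δ => ?_)
    rw [Real.norm_eq_abs, Real.norm_eq_abs, abs_of_nonneg (sq_nonneg δ)]
    exact h δ
  refine h1.trans_isLittleO ?_
  have h2 := Asymptotics.isLittleO_pow_pow (𝕜 := ℝ) (m := 1) (n := 2) (by norm_num)
  simpa using h2

theorem abs_sub_sub_le_of_lipschitz_deriv {u u' : ℝ → ℝ} {C : ℝ} (h : ∀ x, HasDerivAt u (u' x) x)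
    (hl : ∀ x y, |u' x - u' y| ≤ C * |x - y|) (x δ : ℝ) :
    |u (x + δ) - u x - δ * u' x| ≤ C * δ ^ 2 := by
  have h1 : ∀ y ∈ uIcc x (x + δ), HasDerivWithinAt (fun y => u y - y * u' x) (u' y - u' x)
      (uIcc x (x + δ)) y := fun y _ => by
    have := ((h y).fun_sub ((hasDerivAt_id y).mul_const (u' x))).hasDerivWithinAt
      (s := uIcc x (x + δ))
    simpa using this
  have hC : 0 ≤ C := by
    have := (abs_nonneg _).trans (hl 1 0)
    simpa using this
  have h2 : ∀ y ∈ uIcc x (x + δ), ‖u' y - u' x‖ ≤ C * |δ| := fun y hy => by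
    refine (hl y x).trans (mul_le_mul_of_nonneg_left ?_ hC)
    have := abs_sub_left_of_mem_uIcc hy
    simpa using this
  have h3 := (convex_uIcc x (x + δ)).norm_image_sub_le_of_norm_hasDerivWithin_le h1 h2
    left_mem_uIcc right_mem_uIcc
  rw [Real.norm_eq_abs, Real.norm_eq_abs] at h3
  have e1 : u (x + δ) - (x + δ) * u' x - (u x - x * u' x) = u (x + δ) - u x - δ * u' x := by ring
  have e2 : C * |δ| * |x + δ - x| = C * δ ^ 2 := by
    rw [← sq_abs δ]; ring_nf
  rwa [e1, e2] at h3

/-- A function with continuous derivatives along `(1, 0)` and `(c, 1)` is `C¹`. -/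
theorem contDiff_one_of_lineDeriv {c : ℝ} {φ q v : ℝ × ℝ → ℝ} (hq : Continuous q)
    (hv : Continuous v) (h1 : ∀ z, HasLineDerivAt ℝ φ (q z) z (1, 0))
    (h2 : ∀ z, HasLineDerivAt ℝ φ (v z) z (c, 1)) : ContDiff ℝ 1 φ := by
  -- In the sheared coordinates `(y + c s, s)` the two directions become the coordinate directions,
  -- and continuity of both partial derivatives gives `C¹`.
  let Φ : ℝ → ℝ → ℝ := fun y s => φ (y + c * s, s)
  let Φ₁ : ℝ → ℝ → ℝ →L[ℝ] ℝ := fun y s => ContinuousLinearMap.toSpanSingleton ℝ (q (y + c * s, s))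
  let Φ₂ : ℝ → ℝ → ℝ →L[ℝ] ℝ := fun y s => ContinuousLinearMap.toSpanSingleton ℝ (v (y + c * s, s))
  have hlin : Continuous (fun p : ℝ =>
      (ContinuousLinearMap.toSpanSingleton ℝ p : ℝ →L[ℝ] ℝ)) :=
    (ContinuousLinearMap.toSpanSingletonCLE (𝕜 := ℝ) (E := ℝ)).continuous
  have hΦ₁ : Continuous fun w : ℝ × ℝ => Φ₁ w.1 w.2 :=
    hlin.comp (by fun_prop : Continuous fun w : ℝ × ℝ => q (w.1 + c * w.2, w.2))
  have hΦ₂ : Continuous fun w : ℝ × ℝ => Φ₂ w.1 w.2 :=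
    hlin.comp (by fun_prop : Continuous fun w : ℝ × ℝ => v (w.1 + c * w.2, w.2))
  have hd₁ : ∀ w : ℝ × ℝ, HasFDerivAt (fun y => Φ y w.2) (Φ₁ w.1 w.2) w.1 := by
    intro w
    have h3 : HasDerivAt (fun r : ℝ => φ ((w.1 + c * w.2, w.2) + r • ((1, 0) : ℝ × ℝ)))
      (q (w.1 + c * w.2, w.2)) 0 := h1 _
    have h4 : HasDerivAt (fun y : ℝ => y - w.1) 1 w.1 := (hasDerivAt_id w.1).sub_const w.1
    have h5 := HasDerivAt.comp w.1
      (h₂ := fun r : ℝ => φ ((w.1 + c * w.2, w.2) + r • ((1, 0) : ℝ × ℝ))) (by simpa using h3) h4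
    have h6 : HasDerivAt (fun y => Φ y w.2) (q (w.1 + c * w.2, w.2)) w.1 := by
      refine (h5.congr_deriv (mul_one _)).congr_of_eventuallyEq (Filter.Eventually.of_forall ?_)
      intro y
      simp only [Φ, Function.comp, Prod.mk_add_mk, Prod.smul_mk, smul_eq_mul, mul_one, mul_zero,
        add_zero]
      congr 2
      ring
    exact h6.hasFDerivAt
  have hd₂ : ∀ w : ℝ × ℝ, HasFDerivAt (fun s => Φ w.1 s) (Φ₂ w.1 w.2) w.2 := by
    intro w
    have h3 : HasDerivAt (fun r : ℝ => φ ((w.1 + c * w.2, w.2) + r • ((c, 1) : ℝ × ℝ)))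
      (v (w.1 + c * w.2, w.2)) 0 := h2 _
    have h4 : HasDerivAt (fun y : ℝ => y - w.2) 1 w.2 := (hasDerivAt_id w.2).sub_const w.2
    have h5 := HasDerivAt.comp w.2
      (h₂ := fun r : ℝ => φ ((w.1 + c * w.2, w.2) + r • ((c, 1) : ℝ × ℝ))) (by simpa using h3) h4
    have h6 : HasDerivAt (fun s => Φ w.1 s) (v (w.1 + c * w.2, w.2)) w.2 := by
      refine (h5.congr_deriv (mul_one _)).congr_of_eventuallyEq (Filter.Eventually.of_forall ?_)
      intro y
      simp only [Φ, Function.comp, Prod.mk_add_mk, Prod.smul_mk, smul_eq_mul, mul_one]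
      congr 2 <;> ring
    exact h6.hasFDerivAt
  have hs : ContDiff ℝ 1 (fun w : ℝ × ℝ => Φ w.1 w.2) := by
    rw [contDiff_one_iff_hasFDerivAt]
    refine ⟨fun w => (Φ₁ w.1 w.2).coprod (Φ₂ w.1 w.2), ?_, fun w => ?_⟩
    · exact (ContinuousLinearMap.coprodEquivL (S := ℝ)).continuous.comp (hΦ₁.prodMk hΦ₂)
    · have := hasStrictFDerivAt_uncurry_coprod (u := w) (f := Φ) (f₁ := Φ₁) (f₂ := Φ₂)
        (Filter.Eventually.of_forall hd₁) (Filter.Eventually.of_forall hd₂)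
        hΦ₁.continuousAt hΦ₂.continuousAt
      exact this.hasFDerivAt
  have e : φ = fun z => Φ (z.1 - c * z.2) z.2 := by
    ext z
    simp [Φ]
  rw [e]
  exact hs.comp (by fun_prop : ContDiff ℝ 1 fun z : ℝ × ℝ => (z.1 - c * z.2, z.2))

/-- `(φ, ψ)` is a global `C¹` solution of `D₋φ = D₊ψ = G(t, φ + ψ)`, its space derivatives are
`q, r`, and they solve the linearized system along characteristics. -/
structure IsC1Solution (f g f' g' : ℝ → ℝ) (G V : ℝ → ℝ → ℝ) (φ ψ q r : ℝ × ℝ → ℝ) : Prop where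
  contDiff_left : ContDiff ℝ 1 φ
  contDiff_right : ContDiff ℝ 1 ψ
  continuous_q : Continuous q
  continuous_r : Continuous r
  init_left : ∀ x, φ (x, 0) = f x
  init_right : ∀ x, ψ (x, 0) = g x
  init_q : ∀ x, q (x, 0) = f' x
  init_r : ∀ x, r (x, 0) = g' x
  left : ∀ z, HasLineDerivAt ℝ φ (G z.2 (φ z + ψ z)) z (-1, 1)
  right : ∀ z, HasLineDerivAt ℝ ψ (G z.2 (φ z + ψ z)) z (1, 1)
  dx_left : ∀ z, HasLineDerivAt ℝ φ (q z) z (1, 0)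
  dx_right : ∀ z, HasLineDerivAt ℝ ψ (r z) z (1, 0)
  q_char : ∀ z, HasLineDerivAt ℝ q (V z.2 (φ z + ψ z) * (q z + r z)) z (-1, 1)
  r_char : ∀ z, HasLineDerivAt ℝ r (V z.2 (φ z + ψ z) * (q z + r z)) z (1, 1)

theorem IsMild.hasLineDerivAt_left {f g : ℝ → ℝ} {G : ℝ × ℝ → ℝ → ℝ} {φ ψ : ℝ × ℝ → ℝ}
    (h : IsMild f g G φ ψ) (hG : Continuous fun q : (ℝ × ℝ) × ℝ => G q.1 q.2) (z : ℝ × ℝ) :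
    HasLineDerivAt ℝ φ (G z (φ z + ψ z)) z (-1, 1) := by
  have hk : Continuous fun y => G y (φ y + ψ y) :=
    hG.comp (continuous_id.prodMk (h.continuous_left.add h.continuous_right))
  have h1 : HasDerivAt _ _ _ := hasLineDerivAt_charIntegral (c := 1) hk z
  have h2 := h1.const_add (f (z.1 + z.2))
  refine (h2.congr_of_eventuallyEq (Filter.Eventually.of_forall fun s => ?_) : HasDerivAt _ _ _)
  simp only
  rw [h.left]
  congr 2
  simp only [Prod.fst_add, Prod.snd_add, Prod.smul_fst, Prod.smul_snd, smul_eq_mul]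
  ring

theorem IsMild.hasLineDerivAt_right {f g : ℝ → ℝ} {G : ℝ × ℝ → ℝ → ℝ} {φ ψ : ℝ × ℝ → ℝ}
    (h : IsMild f g G φ ψ) (hG : Continuous fun q : (ℝ × ℝ) × ℝ => G q.1 q.2) (z : ℝ × ℝ) :
    HasLineDerivAt ℝ ψ (G z (φ z + ψ z)) z (1, 1) := by
  have hk : Continuous fun y => G y (φ y + ψ y) :=
    hG.comp (continuous_id.prodMk (h.continuous_left.add h.continuous_right))
  have h0 := hasLineDerivAt_charIntegral (c := -1) hk z
  rw [neg_neg] at h0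
  have h1 : HasDerivAt _ _ _ := h0
  have h2 := h1.const_add (g (z.1 - z.2))
  refine (h2.congr_of_eventuallyEq (Filter.Eventually.of_forall fun s => ?_) : HasDerivAt _ _ _)
  simp only
  rw [h.right]
  congr 2
  simp

/-- The pair `q, r` is obtained separately, as the mild solution of the linearized system.
Gronwall's inequality is used twice: increments in `x` are `O(h)`, hence the Taylor remainder of `G`
is `O(h ^ 2)`, and hence the increments differ from `h q` and `h r` by `O(h ^ 2)`. Only a Lipschitz
condition on `V` in `w` is needed, which the truncated power satisfies although it is not `C²`. -/
theorem exists_isC1Solution {f g f' g' : ℝ → ℝ} {G V : ℝ → ℝ → ℝ} {B C L : ℝ} (hL : 0 ≤ L)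
    (hf : ∀ x, HasDerivAt f (f' x) x) (hg : ∀ x, HasDerivAt g (g' x) x)
    (hfB : ∀ x, |f x| ≤ B) (hgB : ∀ x, |g x| ≤ B)
    (hf'B : ∀ x, |f' x| ≤ B) (hg'B : ∀ x, |g' x| ≤ B)
    (hf'L : ∀ x y, |f' x - f' y| ≤ C * |x - y|) (hg'L : ∀ x y, |g' x - g' y| ≤ C * |x - y|)
    (hG : Continuous fun q : ℝ × ℝ => G q.1 q.2) (hV : Continuous fun q : ℝ × ℝ => V q.1 q.2)
    (hVG : ∀ t w, HasDerivAt (G t) (V t w) w) (hVL : ∀ t w, |V t w| ≤ L)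
    (hV2 : ∀ t w w', |V t w - V t w'| ≤ C * |w - w'|) (hG0 : ∀ t, |G t 0| ≤ C) :
    ∃ φ ψ q r, IsC1Solution f g f' g' G V φ ψ q r := by
  have hC : 0 ≤ C := (abs_nonneg _).trans (hG0 0)
  have hB : 0 ≤ B := (abs_nonneg _).trans (hfB 0)
  have hGL : ∀ t w w', |G t w - G t w'| ≤ L * |w - w'| := fun t w w' =>
    convex_univ.norm_image_sub_le_of_norm_hasDerivWithin_le
      (fun y _ => (hVG t y).hasDerivWithinAt) (fun y _ => hVL t y) (mem_univ _) (mem_univ _)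
  have hlip : ∀ (u u' : ℝ → ℝ), (∀ x, HasDerivAt u (u' x) x) → (∀ x, |u' x| ≤ B) →
      ∀ x y, |u x - u y| ≤ B * |x - y| := fun u u' hu hu' x y =>
    convex_univ.norm_image_sub_le_of_norm_hasDerivWithin_le
      (fun y _ => (hu y).hasDerivWithinAt) (fun y _ => hu' y) (mem_univ _) (mem_univ _)
  have hfc : Continuous f := continuous_iff_continuousAt.2 fun x => (hf x).continuousAt
  have hgc : Continuous g := continuous_iff_continuousAt.2 fun x => (hg x).continuousAt
  have hlc : ∀ u : ℝ → ℝ, (∀ x y, |u x - u y| ≤ C * |x - y|) → Continuous u := fun u hu =>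
    (LipschitzWith.of_dist_le_mul (K := ⟨C, hC⟩) fun x y => hu x y).continuous
  have hGc : Continuous fun q : (ℝ × ℝ) × ℝ => G q.1.2 q.2 :=
    hG.comp (by fun_prop : Continuous fun q : (ℝ × ℝ) × ℝ => (q.1.2, q.2))
  obtain ⟨φ, ψ, hm⟩ := exists_isMild (G := fun z => G z.2) hL hfc hgc hfB hgB hGc
    (fun z => hGL z.2) (fun z => hG0 z.2)
  have hφc := hm.continuous_left
  have hψc := hm.continuous_right
  have hVc : Continuous fun z : ℝ × ℝ => V z.2 (φ z + ψ z) :=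
    hV.comp (by fun_prop : Continuous fun z : ℝ × ℝ => (z.2, φ z + ψ z))
  have hVc' : Continuous fun q : (ℝ × ℝ) × ℝ => V q.1.2 (φ q.1 + ψ q.1) * q.2 := by fun_prop
  obtain ⟨q, r, hn⟩ := exists_isMild (G := fun z s => V z.2 (φ z + ψ z) * s) (C := 0) hL
    (hlc f' hf'L) (hlc g' hg'L) hf'B hg'B hVc' (fun z w w' => by
      rw [← mul_sub, abs_mul]
      exact mul_le_mul_of_nonneg_right (hVL _ _) (abs_nonneg _)) (by simp)
  have hqc := hn.continuous_left
  have hrc := hn.continuous_right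
  have hstrip : ∀ {f g : ℝ → ℝ} {G : ℝ × ℝ → ℝ → ℝ} {φ ψ : ℝ × ℝ → ℝ}, IsMild f g G φ ψ →
      ∀ τ : ℝ, ∃ K, 0 ≤ K ∧ ∀ z : ℝ × ℝ, |z.2| ≤ τ → |φ z| ≤ K ∧ |ψ z| ≤ K := by
    intro f g G φ ψ h τ
    obtain ⟨K, l, hK, hl, hb⟩ := h.bound
    refine ⟨K * Real.exp (l * τ), by positivity, fun z hz => ?_⟩
    have h1 : K * Real.exp (l * |z.2|) ≤ K * Real.exp (l * τ) := by gcongr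
    exact ⟨(hb z).1.trans h1, (hb z).2.trans h1⟩
  have hGw : Continuous fun y : ℝ × ℝ => G y.2 (φ y + ψ y) :=
    hG.comp (by fun_prop : Continuous fun z : ℝ × ℝ => (z.2, φ z + ψ z))
  have hGw' : ∀ h : ℝ, Continuous fun y : ℝ × ℝ =>
      G y.2 (φ (y.1 + h, y.2) + ψ (y.1 + h, y.2)) := fun h =>
    hGw.comp (by fun_prop : Continuous fun y : ℝ × ℝ => (y.1 + h, y.2))
  have hGd : ∀ h : ℝ, Continuous fun y : ℝ × ℝ =>
      G y.2 (φ (y.1 + h, y.2) + ψ (y.1 + h, y.2)) - G y.2 (φ y + ψ y) := fun h =>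
    (hGw' h).sub hGw
  -- Since `G` does not depend on `x`, a translate in `x` solves the same system with translated
  -- data.
  have hstep1 : ∀ τ, ∃ K, 0 ≤ K ∧ ∀ (h : ℝ) (z : ℝ × ℝ), |z.2| ≤ τ →
      |φ (z.1 + h, z.2) - φ z| ≤ K * |h| ∧ |ψ (z.1 + h, z.2) - ψ z| ≤ K * |h| := by
    intro τ
    obtain ⟨K, hK, hb⟩ := hstrip hm τ
    refine ⟨4 * B * Real.exp ((4 * L + 1) * τ), by positivity, fun h z hz => ?_⟩
    have hk : ∀ y : ℝ × ℝ, |y.2| ≤ τ → |G y.2 (φ (y.1 + h, y.2) + ψ (y.1 + h, y.2)) -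
        G y.2 (φ y + ψ y)| ≤ L * (|φ (y.1 + h, y.2) - φ y| + |ψ (y.1 + h, y.2) - ψ y|) +
          B * |h| := by
      intro y _
      have h1 := hGL y.2 (φ (y.1 + h, y.2) + ψ (y.1 + h, y.2)) (φ y + ψ y)
      have h2 : |φ (y.1 + h, y.2) + ψ (y.1 + h, y.2) - (φ y + ψ y)| ≤
          |φ (y.1 + h, y.2) - φ y| + |ψ (y.1 + h, y.2) - ψ y| := by
        rw [add_sub_add_comm]; exact abs_add_le _ _
      have h3 := mul_le_mul_of_nonneg_left h2 hL
      have h4 : 0 ≤ B * |h| := by positivity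
      linarith
    have hg := mild_gronwall (a := fun z => φ (z.1 + h, z.2) - φ z)
      (b := fun z => ψ (z.1 + h, z.2) - ψ z) (τ := τ) (η := B * |h|) (m₀ := 2 * K) hL
      (by positivity)
      (a₀ := fun z => f (z.1 + h + z.2) - f (z.1 + z.2))
      (b₀ := fun z => g (z.1 + h - z.2) - g (z.1 - z.2))
      (ka := fun y => G y.2 (φ (y.1 + h, y.2) + ψ (y.1 + h, y.2)) - G y.2 (φ y + ψ y))
      (kb := fun y => G y.2 (φ (y.1 + h, y.2) + ψ (y.1 + h, y.2)) - G y.2 (φ y + ψ y))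
      (fun z => by
        rw [charIntegral_sub (hGw' h) hGw, hm.left, hm.left z, charIntegral_shift]
        ring)
      (fun z => by
        rw [charIntegral_sub (hGw' h) hGw, hm.right, hm.right z, charIntegral_shift]
        ring)
      (fun z => by
        have := hlip f f' hf hf'B (z.1 + h + z.2) (z.1 + z.2)
        rwa [show z.1 + h + z.2 - (z.1 + z.2) = h by ring] at this)
      (fun z => by
        have := hlip g g' hg hg'B (z.1 + h - z.2) (z.1 - z.2)
        rwa [show z.1 + h - z.2 - (z.1 - z.2) = h by ring] at this)
      hk hk
      (fun z hz => by
        have h1 := hb z hz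
        have h2 := hb (z.1 + h, z.2) hz
        exact ⟨(abs_sub _ _).trans (by linarith), (abs_sub _ _).trans (by linarith)⟩) z hz
    have h5 : 4 * (B * |h|) * Real.exp ((4 * L + 1) * |z.2|) ≤
        4 * B * Real.exp ((4 * L + 1) * τ) * |h| := by
      have : Real.exp ((4 * L + 1) * |z.2|) ≤ Real.exp ((4 * L + 1) * τ) := by gcongr
      have h6 := mul_le_mul_of_nonneg_left this (by positivity : 0 ≤ 4 * (B * |h|))
      linarith
    exact ⟨hg.1.trans h5, hg.2.trans h5⟩
  have hGT : ∀ t w w', |G t w' - G t w - V t w * (w' - w)| ≤ C * (w' - w) ^ 2 := by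
    intro t w w'
    have := abs_sub_sub_le_of_lipschitz_deriv (hVG t) (hV2 t) w (w' - w)
    rwa [add_sub_cancel, mul_comm (w' - w)] at this
  have hVq : Continuous fun y : ℝ × ℝ => V y.2 (φ y + ψ y) * (q y + r y) := by fun_prop
  have hstep2 : ∀ τ, ∃ K, ∀ (h : ℝ) (z : ℝ × ℝ), |z.2| ≤ τ →
      |φ (z.1 + h, z.2) - φ z - h * q z| ≤ K * h ^ 2 ∧
      |ψ (z.1 + h, z.2) - ψ z - h * r z| ≤ K * h ^ 2 := by
    intro τ
    obtain ⟨K, hK, hb⟩ := hstep1 τ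
    obtain ⟨K', hK', hb'⟩ := hstrip hn τ
    set η := C * (1 + 4 * K ^ 2)
    have hη : 0 ≤ η := by positivity
    refine ⟨4 * η * Real.exp ((4 * L + 1) * τ), fun h z hz => ?_⟩
    have hk : ∀ y : ℝ × ℝ, |y.2| ≤ τ → |G y.2 (φ (y.1 + h, y.2) + ψ (y.1 + h, y.2)) -
        G y.2 (φ y + ψ y) - h * (V y.2 (φ y + ψ y) * (q y + r y))| ≤
        L * (|φ (y.1 + h, y.2) - φ y - h * q y| + |ψ (y.1 + h, y.2) - ψ y - h * r y|) +
          η * h ^ 2 := by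
      intro y hy
      have h1 := hGT y.2 (φ y + ψ y) (φ (y.1 + h, y.2) + ψ (y.1 + h, y.2))
      set a := φ (y.1 + h, y.2) - φ y with ha
      set b := ψ (y.1 + h, y.2) - ψ y with hb_def
      have e : φ (y.1 + h, y.2) + ψ (y.1 + h, y.2) - (φ y + ψ y) = a + b := by
        rw [ha, hb_def]; ring
      rw [e] at h1
      have h2 : |a + b| ≤ 2 * K * |h| :=
        (abs_add_le a b).trans (by linarith [(hb h y hy).1, (hb h y hy).2])
      have h3 : (a + b) ^ 2 ≤ 4 * K ^ 2 * h ^ 2 := by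
        rw [← sq_abs (a + b), ← sq_abs h]
        nlinarith [abs_nonneg (a + b)]
      have h4 : C * (a + b) ^ 2 ≤ η * h ^ 2 := by
        have := mul_le_mul_of_nonneg_left h3 hC
        have : 0 ≤ C * h ^ 2 := by positivity
        simp only [η]
        linarith
      have h5 : |V y.2 (φ y + ψ y) * ((a - h * q y) + (b - h * r y))| ≤
          L * (|a - h * q y| + |b - h * r y|) := by
        rw [abs_mul]
        exact mul_le_mul (hVL _ _) (abs_add_le _ _) (abs_nonneg _) hL
      have e2 : G y.2 (φ (y.1 + h, y.2) + ψ (y.1 + h, y.2)) - G y.2 (φ y + ψ y) -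
          h * (V y.2 (φ y + ψ y) * (q y + r y)) =
          (G y.2 (φ (y.1 + h, y.2) + ψ (y.1 + h, y.2)) - G y.2 (φ y + ψ y) -
            V y.2 (φ y + ψ y) * (a + b)) +
          V y.2 (φ y + ψ y) * ((a - h * q y) + (b - h * r y)) := by ring
      rw [e2]
      exact (abs_add_le _ _).trans (by linarith)
    have hCη : C ≤ η := by
      simp only [η]
      nlinarith [mul_nonneg hC (sq_nonneg K)]
    have hg := mild_gronwall (a := fun z => φ (z.1 + h, z.2) - φ z - h * q z)
      (b := fun z => ψ (z.1 + h, z.2) - ψ z - h * r z) (τ := τ) (η := η * h ^ 2)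
      (m₀ := K * |h| + |h| * K') hL (by positivity)
      (a₀ := fun z => f (z.1 + z.2 + h) - f (z.1 + z.2) - h * f' (z.1 + z.2))
      (b₀ := fun z => g (z.1 - z.2 + h) - g (z.1 - z.2) - h * g' (z.1 - z.2))
      (ka := fun y => G y.2 (φ (y.1 + h, y.2) + ψ (y.1 + h, y.2)) - G y.2 (φ y + ψ y) -
        h * (V y.2 (φ y + ψ y) * (q y + r y)))
      (kb := fun y => G y.2 (φ (y.1 + h, y.2) + ψ (y.1 + h, y.2)) - G y.2 (φ y + ψ y) -
        h * (V y.2 (φ y + ψ y) * (q y + r y)))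
      (fun z => by
        rw [charIntegral_sub (hGd h) (hVq.const_mul h), charIntegral_sub (hGw' h) hGw,
          charIntegral_const_mul, hm.left, hm.left z, charIntegral_shift, hn.left z]
        ring_nf)
      (fun z => by
        rw [charIntegral_sub (hGd h) (hVq.const_mul h), charIntegral_sub (hGw' h) hGw,
          charIntegral_const_mul, hm.right, hm.right z, charIntegral_shift, hn.right z]
        ring_nf)
      (fun z => (abs_sub_sub_le_of_lipschitz_deriv hf hf'L (z.1 + z.2) h).trans
        (mul_le_mul_of_nonneg_right hCη (sq_nonneg h)))
      (fun z => (abs_sub_sub_le_of_lipschitz_deriv hg hg'L (z.1 - z.2) h).trans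
        (mul_le_mul_of_nonneg_right hCη (sq_nonneg h)))
      hk hk
      (fun z hz => by
        have h1 := hb h z hz
        have h2 := hb' z hz
        have h3 := mul_le_mul_of_nonneg_left h2.1 (abs_nonneg h)
        have h4 := mul_le_mul_of_nonneg_left h2.2 (abs_nonneg h)
        rw [← abs_mul] at h3 h4
        exact ⟨(abs_sub _ _).trans (by linarith), (abs_sub _ _).trans (by linarith)⟩) z hz
    have h5 : 4 * (η * h ^ 2) * Real.exp ((4 * L + 1) * |z.2|) ≤
        4 * η * Real.exp ((4 * L + 1) * τ) * h ^ 2 := by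
      have : Real.exp ((4 * L + 1) * |z.2|) ≤ Real.exp ((4 * L + 1) * τ) := by gcongr
      have h6 := mul_le_mul_of_nonneg_left this (by positivity : 0 ≤ 4 * (η * h ^ 2))
      linarith
    exact ⟨hg.1.trans h5, hg.2.trans h5⟩
  have hdx : ∀ z, HasLineDerivAt ℝ φ (q z) z (1, 0) ∧ HasLineDerivAt ℝ ψ (r z) z (1, 0) := by
    intro z
    obtain ⟨K, hK⟩ := hstep2 |z.2|
    have e : ∀ δ : ℝ, z + δ • ((1, 0) : ℝ × ℝ) = (z.1 + δ, z.2) := fun δ => by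
      ext <;> simp
    constructor
    · refine (hasDerivAt_of_quadratic (C := K) fun δ => ?_ : HasDerivAt _ _ _)
      simp only [zero_add, e]
      have := (hK δ z le_rfl).1
      simpa using this
    · refine (hasDerivAt_of_quadratic (C := K) fun δ => ?_ : HasDerivAt _ _ _)
      simp only [zero_add, e]
      have := (hK δ z le_rfl).2
      simpa using this
  have hleft := hm.hasLineDerivAt_left hGc
  have hright := hm.hasLineDerivAt_right hGc
  refine ⟨φ, ψ, q, r, ?_⟩
  exact
    { contDiff_left := contDiff_one_of_lineDeriv hqc hGw (fun z => (hdx z).1) hleft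
      contDiff_right := contDiff_one_of_lineDeriv hrc hGw (fun z => (hdx z).2) hright
      continuous_q := hqc
      continuous_r := hrc
      init_left := fun x => by rw [hm.left, charIntegral_zero]; simp
      init_right := fun x => by rw [hm.right, charIntegral_zero]; simp
      init_q := fun x => by rw [hn.left, charIntegral_zero]; simp
      init_r := fun x => by rw [hn.right, charIntegral_zero]; simp
      left := hleft
      right := hright
      dx_left := fun z => (hdx z).1
      dx_right := fun z => (hdx z).2
      q_char := hn.hasLineDerivAt_left hVc'
      r_char := hn.hasLineDerivAt_right hVc' }

end DampedWave
end

/-! ### The truncated source term and admissible global data -/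

noncomputable section

namespace DampedWave

/-- A bounded extension of the damping coefficient `μ / (1 + t)` to negative times. -/
def damp (μ t : ℝ) : ℝ := μ * (1 - t / (1 + |t|))

theorem damp_of_nonneg (μ : ℝ) {t : ℝ} (ht : 0 ≤ t) : damp μ t = μ / (1 + t) := by
  unfold damp
  rw [abs_of_nonneg ht]
  have : 1 + t ≠ 0 := by positivity
  field_simp
  ring

theorem continuous_damp (μ : ℝ) : Continuous (damp μ) := by
  unfold damp
  have : ∀ t : ℝ, 1 + |t| ≠ 0 := fun t => by positivity
  fun_prop (disch := simp [this])

theorem abs_damp_le {μ : ℝ} (hμ : 0 ≤ μ) (t : ℝ) : |damp μ t| ≤ 2 * μ := by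
  unfold damp
  have h1 : |t / (1 + |t|)| ≤ 1 := by
    rw [abs_div, abs_of_pos (by positivity : 0 < 1 + |t|), div_le_one (by positivity)]
    linarith
  have h2 := abs_le.1 h1
  rw [abs_mul, abs_of_nonneg hμ, mul_comm]
  refine mul_le_mul_of_nonneg_right ?_ hμ
  rw [abs_le]
  constructor <;> linarith

theorem damp_le {μ t : ℝ} (hμ : 0 ≤ μ) (ht : 0 ≤ t) : damp μ t ≤ μ := by
  rw [damp_of_nonneg μ ht]
  exact div_le_self hμ (by linarith)

theorem hasDerivAt_damp (μ : ℝ) {t : ℝ} (ht : 0 < t) :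
    HasDerivAt (damp μ) (-(μ / (1 + t) ^ 2)) t := by
  have h0 : (1 + t) ≠ 0 := by positivity
  have h1 : HasDerivAt (fun s : ℝ => μ / (1 + s)) (-(μ / (1 + t) ^ 2)) t := by
    have h2 := ((hasDerivAt_id t).const_add 1).inv h0
    have h3 := h2.const_mul μ
    refine (h3.congr_deriv ?_).congr_of_eventuallyEq ?_
    · simp only [id]; ring
    · exact Filter.Eventually.of_forall fun s => by simp [div_eq_mul_inv]
  refine h1.congr_of_eventuallyEq ?_
  filter_upwards [lt_mem_nhds ht] with s hs
  exact damp_of_nonneg μ hs.le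

/-- The derivative of the truncated power nonlinearity. -/
def powSlope (p γ n s : ℝ) : ℝ := p * (2:ℝ) ^ (-p) * (max γ (min s n)) ^ (p - 1)

/-- The power nonlinearity `2⁻ᵖ wᵖ`, continued linearly outside of `[γ, n]`. -/
def powTrunc (p γ n w : ℝ) : ℝ := (2:ℝ) ^ (-p) * γ ^ p + ∫ s in γ..w, powSlope p γ n s

section powTrunc

variable {p γ n : ℝ}

theorem continuous_powSlope (hp : 1 < p) : Continuous (powSlope p γ n) := by
  unfold powSlope
  exact continuous_const.mul
    ((by fun_prop : Continuous fun s => max γ (min s n)).rpow_const fun _ => Or.inr (by linarith))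

theorem hasDerivAt_powTrunc (hp : 1 < p) (w : ℝ) :
    HasDerivAt (powTrunc p γ n) (powSlope p γ n w) w := by
  have hc := continuous_powSlope (p := p) (γ := γ) (n := n) hp
  exact (intervalIntegral.integral_hasDerivAt_right (hc.intervalIntegrable _ _)
    (hc.stronglyMeasurableAtFilter _ _) hc.continuousAt).const_add _

theorem powSlope_eq {w : ℝ} (h1 : γ ≤ w) (h2 : w ≤ n) :
    powSlope p γ n w = p * (2:ℝ) ^ (-p) * w ^ (p - 1) := by
  unfold powSlope
  rw [min_eq_left h2, max_eq_right h1]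

theorem hasDerivAt_pow (hp : 1 < p) (w : ℝ) :
    HasDerivAt (fun w : ℝ => (2:ℝ) ^ (-p) * w ^ p) (p * (2:ℝ) ^ (-p) * w ^ (p - 1)) w := by
  refine ((Real.hasDerivAt_rpow_const (Or.inr hp.le)).const_mul _).congr_deriv ?_
  ring

theorem powTrunc_eq (hp : 1 < p) {w : ℝ} (h1 : γ ≤ w) (h2 : w ≤ n) :
    powTrunc p γ n w = (2:ℝ) ^ (-p) * w ^ p := by
  unfold powTrunc
  have h3 : ∫ s in γ..w, powSlope p γ n s = ∫ s in γ..w, p * (2:ℝ) ^ (-p) * s ^ (p - 1) := by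
    refine intervalIntegral.integral_congr fun s hs => ?_
    rw [uIcc_of_le h1] at hs
    exact powSlope_eq hs.1 (hs.2.trans h2)
  rw [h3, intervalIntegral.integral_eq_sub_of_hasDerivAt (fun s _ => hasDerivAt_pow hp s)]
  · ring
  · exact (continuous_const.mul
      (continuous_id.rpow_const fun _ => Or.inr (by linarith))).intervalIntegrable _ _

theorem powSlope_ge (hp : 1 < p) (hγ : 0 < γ) (w : ℝ) :
    p * (2:ℝ) ^ (-p) * γ ^ (p - 1) ≤ powSlope p γ n w := by
  unfold powSlope
  have : γ ≤ max γ (min w n) := le_max_left _ _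
  gcongr

theorem powSlope_le (hp : 1 < p) (hγ : 0 < γ) (hn : γ ≤ n) (w : ℝ) :
    powSlope p γ n w ≤ p * (2:ℝ) ^ (-p) * n ^ (p - 1) := by
  unfold powSlope
  have h1 : max γ (min w n) ≤ n := max_le hn (min_le_right _ _)
  have h2 : 0 ≤ max γ (min w n) := hγ.le.trans (le_max_left _ _)
  gcongr

/-- On `[γ, n]` the power is smooth because `γ > 0`, for every exponent, and clamping to this
interval is 1-Lipschitz. -/
theorem exists_powSlope_lipschitz (hp : 1 < p) (hγ : 0 < γ) (hn : γ ≤ n) :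
    ∃ C, 0 ≤ C ∧ ∀ w w', |powSlope p γ n w - powSlope p γ n w'| ≤ C * |w - w'| := by
  set b := p * (2:ℝ) ^ (-p) with hb
  have hb0 : 0 < b := by positivity
  have hcd : ContDiffOn ℝ 1 (fun s : ℝ => s ^ (p - 1)) (Icc γ n) := fun s hs =>
    (Real.contDiffAt_rpow_const_of_ne (by linarith [hs.1])).contDiffWithinAt
  obtain ⟨K, hK⟩ := hcd.exists_lipschitzOnWith (by norm_num) (convex_Icc γ n) isCompact_Icc
  refine ⟨b * K, by positivity, fun w w' => ?_⟩
  have hmem : ∀ w, max γ (min w n) ∈ Icc γ n := fun w =>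
    ⟨le_max_left _ _, max_le hn (min_le_right _ _)⟩
  have h1 := hK.dist_le_mul _ (hmem w) _ (hmem w')
  rw [Real.dist_eq, Real.dist_eq] at h1
  have h2 : |max γ (min w n) - max γ (min w' n)| ≤ |w - w'| := by
    refine (abs_max_sub_max_le_max _ _ _ _).trans ?_
    refine max_le (by simp) ((abs_min_sub_min_le_max _ _ _ _).trans ?_)
    exact max_le le_rfl (by simp)
  unfold powSlope
  rw [← hb, ← mul_sub, abs_mul, abs_of_pos hb0, mul_assoc b]
  exact mul_le_mul_of_nonneg_left (h1.trans (mul_le_mul_of_nonneg_left h2 K.2)) hb0.le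

end powTrunc

/-- The truncated source term. -/
def truncSource (p μ γ n t w : ℝ) : ℝ := powTrunc p γ n w - damp μ t * (w / 2)

/-- The derivative of the truncated source term in `w`. -/
def truncSlope (p μ γ n t w : ℝ) : ℝ := powSlope p γ n w - damp μ t / 2

theorem truncSource_eq {p μ γ n t w : ℝ} (hp : 1 < p) (hγ : 0 < γ) (ht : 0 ≤ t) (h1 : γ ≤ w)
    (h2 : w ≤ n) : truncSource p μ γ n t w = source μ p t w := by
  rw [truncSource, source, powTrunc_eq hp h1 h2, damp_of_nonneg μ ht,
    abs_of_nonneg (hγ.le.trans h1)]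

/-- Global data that fulfil the hypotheses of the blow-up theorem; `k` is the reciprocal of the
maximal slope of the blow-up curve. -/
structure AdmissibleData (p μ γ₁ γ₂ k B C : ℝ) (f g f' g' : ℝ → ℝ) : Prop where
  hμ : 0 < μ
  hp : 1 < p
  hk : 1 < k
  hγ₁ : 0 < γ₁
  hγ₂ : 0 < γ₂
  hγ : μ * p ≤ (2:ℝ) ^ (-p) * (γ₁ + γ₂) ^ (p - 1)
  hf : ∀ x, HasDerivAt f (f' x) x
  hg : ∀ x, HasDerivAt g (g' x) x
  hfB : ∀ x, |f x| ≤ B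
  hgB : ∀ x, |g x| ≤ B
  hf'B : ∀ x, |f' x| ≤ B
  hg'B : ∀ x, |g' x| ≤ B
  hf'L : ∀ x y, |f' x - f' y| ≤ C * |x - y|
  hg'L : ∀ x y, |g' x - g' y| ≤ C * |x - y|
  hfγ : ∀ x, γ₁ ≤ f x
  hgγ : ∀ x, γ₂ ≤ g x
  slope : ∀ x, (1 + k) * (|f' x| + |g' x|) ≤
    (2:ℝ) ^ (-p) * (γ₁ + γ₂) ^ p - μ / 2 * (γ₁ + γ₂)

variable {p μ γ₁ γ₂ k B C : ℝ} {f g f' g' : ℝ → ℝ}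

namespace AdmissibleData

theorem γ_pos (H : AdmissibleData p μ γ₁ γ₂ k B C f g f' g') :
    0 < γ₁ + γ₂ := add_pos H.hγ₁ H.hγ₂

theorem pow_ge (H : AdmissibleData p μ γ₁ γ₂ k B C f g f' g')
    {w : ℝ} (hw : γ₁ + γ₂ ≤ w) : μ * p ≤ (2:ℝ) ^ (-p) * w ^ (p - 1) := by
  refine H.hγ.trans ?_
  have := H.γ_pos
  have := H.hp
  gcongr

/-- The condition `hγ` makes the slope of the power at least `μ`, whereas the damping contributes at
most `μ / 2`. The system is therefore cooperative, on which all comparison arguments rest. -/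
theorem truncSlope_pos (H : AdmissibleData p μ γ₁ γ₂ k B C f g f' g')
    {n t : ℝ} (ht : 0 ≤ t) (w : ℝ) : 0 ≤ truncSlope p μ (γ₁ + γ₂) n t w := by
  have h1 := powSlope_ge (n := n) H.hp H.γ_pos w
  have h2 := damp_le H.hμ.le ht
  have h3 := H.hγ
  have hp := H.hp
  have hμ := H.hμ
  unfold truncSlope
  have h4 : μ ≤ μ * p := by nlinarith
  have h5 : μ * p ≤ p * ((2:ℝ) ^ (-p) * (γ₁ + γ₂) ^ (p - 1)) :=
    h3.trans (le_mul_of_one_le_left (by nlinarith) hp.le)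
  rw [← mul_assoc] at h5
  linarith

theorem abs_truncSlope_le (H : AdmissibleData p μ γ₁ γ₂ k B C f g f' g')
    {n : ℝ} (hn : γ₁ + γ₂ ≤ n) (t w : ℝ) :
    |truncSlope p μ (γ₁ + γ₂) n t w| ≤ p * (2:ℝ) ^ (-p) * n ^ (p - 1) + μ := by
  have h1 := powSlope_le H.hp H.γ_pos hn w
  have h2 := abs_damp_le H.hμ.le t
  have h3 : 0 ≤ powSlope p (γ₁ + γ₂) n w :=
    le_trans (by have := H.γ_pos; have := H.hp; positivity) (powSlope_ge H.hp H.γ_pos w)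
  unfold truncSlope
  refine (abs_sub _ _).trans ?_
  rw [abs_of_nonneg h3, abs_div, abs_of_pos (by norm_num : (0:ℝ) < 2)]
  linarith

theorem hasDerivAt_truncSource (H : AdmissibleData p μ γ₁ γ₂ k B C f g f' g')
    {n : ℝ} (t w : ℝ) :
    HasDerivAt (truncSource p μ (γ₁ + γ₂) n t) (truncSlope p μ (γ₁ + γ₂) n t w) w := by
  refine ((hasDerivAt_powTrunc H.hp w).sub
    (((hasDerivAt_id w).div_const 2).const_mul (damp μ t))).congr_deriv ?_
  unfold truncSlope
  ring

theorem monotone_truncSource (H : AdmissibleData p μ γ₁ γ₂ k B C f g f' g')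
    {n t : ℝ} (ht : 0 ≤ t) :
    Monotone (truncSource p μ (γ₁ + γ₂) n t) := by
  refine monotone_of_deriv_nonneg (fun w => (H.hasDerivAt_truncSource t w).differentiableAt) ?_
  intro w
  rw [(H.hasDerivAt_truncSource t w).deriv]
  exact H.truncSlope_pos ht w

/-- The damping coefficient is largest at `t = 0`, where it equals `μ`, and the source is monotone
in the sum; so the smallest value is the one at `t = 0`, `w = γ₁ + γ₂`. -/
theorem initial_le_truncSource (H : AdmissibleData p μ γ₁ γ₂ k B C f g f' g')
    {n t w : ℝ} (ht : 0 ≤ t) (hn : γ₁ + γ₂ ≤ n) (hw : γ₁ + γ₂ ≤ w) :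
    (2:ℝ) ^ (-p) * (γ₁ + γ₂) ^ p - μ / 2 * (γ₁ + γ₂) ≤ truncSource p μ (γ₁ + γ₂) n t w := by
  refine le_trans ?_ (H.monotone_truncSource ht hw)
  unfold truncSource
  rw [powTrunc_eq H.hp le_rfl hn]
  have := mul_le_mul_of_nonneg_right (damp_le H.hμ.le ht) H.γ_pos.le
  linarith

theorem initial_pos (H : AdmissibleData p μ γ₁ γ₂ k B C f g f' g') :
    0 < (2:ℝ) ^ (-p) * (γ₁ + γ₂) ^ p - μ / 2 * (γ₁ + γ₂) := by
  have h1 := H.hγ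
  have hγ := H.γ_pos
  have hp := H.hp
  have hμ := H.hμ
  have h2 : (γ₁ + γ₂) ^ p = (γ₁ + γ₂) ^ (p - 1) * (γ₁ + γ₂) := by
    rw [← Real.rpow_add_one hγ.ne']; simp
  rw [h2, ← mul_assoc, ← sub_mul]
  refine mul_pos ?_ hγ
  nlinarith

theorem abs_truncSource_sub_le (H : AdmissibleData p μ γ₁ γ₂ k B C f g f' g')
    {n : ℝ} (hn : γ₁ + γ₂ ≤ n) (t w w' : ℝ) :
    |truncSource p μ (γ₁ + γ₂) n t w - truncSource p μ (γ₁ + γ₂) n t w'| ≤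
      (p * (2:ℝ) ^ (-p) * n ^ (p - 1) + μ) * |w - w'| :=
  convex_univ.norm_image_sub_le_of_norm_hasDerivWithin_le
    (fun y _ => (H.hasDerivAt_truncSource t y).hasDerivWithinAt)
    (fun y _ => H.abs_truncSlope_le hn t y) (mem_univ _) (mem_univ _)

theorem exists_truncated_solution (H : AdmissibleData p μ γ₁ γ₂ k B C f g f' g')
    {n : ℝ} (hn : γ₁ + γ₂ ≤ n) :
    ∃ φ ψ q r, IsC1Solution f g f' g' (truncSource p μ (γ₁ + γ₂) n)
      (truncSlope p μ (γ₁ + γ₂) n) φ ψ q r := by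
  obtain ⟨K, hK, hK'⟩ := exists_powSlope_lipschitz H.hp H.γ_pos hn
  have hC : 0 ≤ C := by
    have := (abs_nonneg _).trans (H.hf'L 1 0)
    simpa using this
  have hμ := H.hμ
  have hp := H.hp
  have hn0 := H.γ_pos.le.trans hn
  have hcP : Continuous (powTrunc p (γ₁ + γ₂) n) :=
    continuous_iff_continuousAt.2 fun w => (hasDerivAt_powTrunc H.hp w).continuousAt
  have hcd := continuous_damp μ
  have hcs := continuous_powSlope (p := p) (γ := γ₁ + γ₂) (n := n) H.hp
  have hlip : ∀ u u' : ℝ, ∀ D, 0 ≤ D → u ≤ C * |u'| → u ≤ (C + D) * |u'| := fun u u' D hD h =>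
    h.trans (mul_le_mul_of_nonneg_right (by linarith) (abs_nonneg _))
  set D := K + |powTrunc p (γ₁ + γ₂) n 0| with hD
  have hD0 : 0 ≤ D := by positivity
  refine exists_isC1Solution (C := C + D) (L := p * (2:ℝ) ^ (-p) * n ^ (p - 1) + μ) (by positivity)
    H.hf H.hg H.hfB H.hgB H.hf'B H.hg'B (fun x y => hlip _ _ D hD0 (H.hf'L x y))
    (fun x y => hlip _ _ D hD0 (H.hg'L x y)) ?_ ?_ H.hasDerivAt_truncSource
    (H.abs_truncSlope_le hn) ?_ ?_
  · unfold truncSource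
    fun_prop
  · unfold truncSlope
    fun_prop
  · intro t w w'
    unfold truncSlope
    rw [sub_sub_sub_cancel_right]
    refine (hK' w w').trans (mul_le_mul_of_nonneg_right ?_ (abs_nonneg _))
    have := abs_nonneg (powTrunc p (γ₁ + γ₂) n 0)
    linarith
  · intro t
    unfold truncSource
    simp only [zero_div, mul_zero, sub_zero]
    linarith

end AdmissibleData

end DampedWave
end

/-! ### Lower bounds and slope bounds for the truncated solutions -/

noncomputable section

namespace DampedWave

theorem fderiv_apply_eq (F : ℝ × ℝ → ℝ) (z : ℝ × ℝ) (a b : ℝ) :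
    fderiv ℝ F z (a, b) = a * dx F z + b * dt F z := by
  have : ((a, b) : ℝ × ℝ) = a • ((1, 0) : ℝ × ℝ) + b • ((0, 1) : ℝ × ℝ) := by ext <;> simp
  rw [this, map_add, map_smul, map_smul]
  rfl

theorem hasLineDerivAt_of_differentiableAt {F : ℝ × ℝ → ℝ} {z : ℝ × ℝ}
    (h : DifferentiableAt ℝ F z) (a b : ℝ) :
    HasLineDerivAt ℝ F (a * dx F z + b * dt F z) z (a, b) := by
  rw [← fderiv_apply_eq]
  exact h.hasFDerivAt.hasLineDerivAt _

theorem dx_eq_of_hasLineDerivAt {F : ℝ × ℝ → ℝ} {z : ℝ × ℝ} {v : ℝ}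
    (hd : DifferentiableAt ℝ F z) (h : HasLineDerivAt ℝ F v z (1, 0)) : dx F z = v := by
  have := (hasLineDerivAt_of_differentiableAt hd 1 0).unique h
  simpa using this

theorem hasLineDerivAt_add {F F' : ℝ × ℝ → ℝ} {v v' : ℝ} {z e : ℝ × ℝ}
    (h : HasLineDerivAt ℝ F v z e) (h' : HasLineDerivAt ℝ F' v' z e) :
    HasLineDerivAt ℝ (fun z => F z + F' z) (v + v') z e := HasDerivAt.fun_add h h'

theorem hasLineDerivAt_sub_const {F : ℝ × ℝ → ℝ} {v : ℝ} {z e : ℝ × ℝ}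
    (h : HasLineDerivAt ℝ F v z e) (c : ℝ) :
    HasLineDerivAt ℝ (fun z => F z - c) v z e := HasDerivAt.sub_const c h

theorem hasLineDerivAt_const_mul {F : ℝ × ℝ → ℝ} {v : ℝ} {z e : ℝ × ℝ}
    (c : ℝ) (h : HasLineDerivAt ℝ F v z e) :
    HasLineDerivAt ℝ (fun z => c * F z) (c * v) z e := HasDerivAt.const_mul c h

namespace IsC1Solution

variable {f g f' g' : ℝ → ℝ} {G V : ℝ → ℝ → ℝ} {φ ψ q r : ℝ × ℝ → ℝ}

theorem differentiable_left (S : IsC1Solution f g f' g' G V φ ψ q r) : Differentiable ℝ φ :=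
  S.contDiff_left.differentiable (by norm_num)

theorem differentiable_right (S : IsC1Solution f g f' g' G V φ ψ q r) : Differentiable ℝ ψ :=
  S.contDiff_right.differentiable (by norm_num)

theorem dx_left_eq (S : IsC1Solution f g f' g' G V φ ψ q r) : dx φ = q :=
  funext fun z => dx_eq_of_hasLineDerivAt (S.differentiable_left z) (S.dx_left z)

theorem dx_right_eq (S : IsC1Solution f g f' g' G V φ ψ q r) : dx ψ = r :=
  funext fun z => dx_eq_of_hasLineDerivAt (S.differentiable_right z) (S.dx_right z)

theorem dt_left_eq (S : IsC1Solution f g f' g' G V φ ψ q r) :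
    dt φ = fun z => q z + G z.2 (φ z + ψ z) := by
  ext z
  have := (hasLineDerivAt_of_differentiableAt (S.differentiable_left z) (-1) 1).unique (S.left z)
  rw [S.dx_left_eq] at this
  linarith

theorem dt_right_eq (S : IsC1Solution f g f' g' G V φ ψ q r) :
    dt ψ = fun z => G z.2 (φ z + ψ z) - r z := by
  ext z
  have := (hasLineDerivAt_of_differentiableAt (S.differentiable_right z) 1 1).unique (S.right z)
  rw [S.dx_right_eq] at this
  linarith

theorem hasLineDerivAt_left (S : IsC1Solution f g f' g' G V φ ψ q r) (z : ℝ × ℝ) (a b : ℝ) :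
    HasLineDerivAt ℝ φ (a * q z + b * (q z + G z.2 (φ z + ψ z))) z (a, b) := by
  have := hasLineDerivAt_of_differentiableAt (S.differentiable_left z) a b
  rwa [S.dx_left_eq, S.dt_left_eq] at this

theorem hasLineDerivAt_right (S : IsC1Solution f g f' g' G V φ ψ q r) (z : ℝ × ℝ) (a b : ℝ) :
    HasLineDerivAt ℝ ψ (a * r z + b * (G z.2 (φ z + ψ z) - r z)) z (a, b) := by
  have := hasLineDerivAt_of_differentiableAt (S.differentiable_right z) a b
  rwa [S.dx_right_eq, S.dt_right_eq] at this

theorem continuous_sum (S : IsC1Solution f g f' g' G V φ ψ q r) :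
    Continuous fun z => φ z + ψ z :=
  S.contDiff_left.continuous.add S.contDiff_right.continuous

end IsC1Solution

namespace AdmissibleData

variable {p μ γ₁ γ₂ k B C n : ℝ} {f g f' g' : ℝ → ℝ} {φ ψ q r : ℝ × ℝ → ℝ}

/-- The one-sided form required by the comparison principle: upward increments have the right sign
by monotonicity, and downward ones are controlled by the Lipschitz constant. -/
theorem min_le_truncSource_sub (H : AdmissibleData p μ γ₁ γ₂ k B C f g f' g') (hn : γ₁ + γ₂ ≤ n)
    {t : ℝ} (ht : 0 ≤ t) (w w' : ℝ) :
    (p * (2:ℝ) ^ (-p) * n ^ (p - 1) + μ) * min (w - w') 0 ≤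
      truncSource p μ (γ₁ + γ₂) n t w - truncSource p μ (γ₁ + γ₂) n t w' := by
  rcases le_total w' w with h | h
  · rw [min_eq_right (by linarith), mul_zero]
    linarith [H.monotone_truncSource (n := n) ht h]
  · rw [min_eq_left (by linarith)]
    have h1 := H.abs_truncSource_sub_le hn t w w'
    rw [abs_of_nonpos (by linarith : w - w' ≤ 0)] at h1
    linarith [(abs_le.1 h1).1]

/-- The constants `γ₁, γ₂` form a subsolution, because the source is nonnegative at their sum. -/
theorem lower_bound (H : AdmissibleData p μ γ₁ γ₂ k B C f g f' g') (hn : γ₁ + γ₂ ≤ n)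
    (S : IsC1Solution f g f' g' (truncSource p μ (γ₁ + γ₂) n) (truncSlope p μ (γ₁ + γ₂) n) φ ψ q r)
    {z : ℝ × ℝ} (hz : 0 ≤ z.2) : γ₁ ≤ φ z ∧ γ₂ ≤ ψ z := by
  have hL : 0 ≤ p * (2:ℝ) ^ (-p) * n ^ (p - 1) + μ :=
    (abs_nonneg _).trans (H.abs_truncSlope_le hn 0 0)
  have hsrc : ∀ y : ℝ × ℝ, 0 < y.2 →
      (p * (2:ℝ) ^ (-p) * n ^ (p - 1) + μ) * min (φ y - γ₁ + (ψ y - γ₂)) 0 ≤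
        truncSource p μ (γ₁ + γ₂) n y.2 (φ y + ψ y) := by
    intro y hy
    have h0 : 0 ≤ truncSource p μ (γ₁ + γ₂) n y.2 (γ₁ + γ₂) :=
      H.initial_pos.le.trans (H.initial_le_truncSource hy.le hn le_rfl)
    have h1 := H.min_le_truncSource_sub hn hy.le (φ y + ψ y) (γ₁ + γ₂)
    rw [sub_add_sub_comm]
    linarith
  have := nonneg_of_lineDeriv_ge (t₀ := 0) (z₁ := z) (a := fun z => φ z - γ₁)
    (b := fun z => ψ z - γ₂) hL
    (S.contDiff_left.continuous.sub continuous_const).continuousOn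
    (S.contDiff_right.continuous.sub continuous_const).continuousOn
    (fun y _ hy => by
      have e : y = (y.1, 0) := by rw [← hy]
      rw [e, S.init_left]
      linarith [H.hfγ y.1])
    (fun y _ hy => by
      have e : y = (y.1, 0) := by rw [← hy]
      rw [e, S.init_right]
      linarith [H.hgγ y.1])
    (fun y _ _ => hasLineDerivAt_sub_const (S.left y) _)
    (fun y _ _ => hasLineDerivAt_sub_const (S.right y) _)
    (fun y _ hy => hsrc y hy) (fun y _ hy => hsrc y hy) z (apex_mem_closedCone hz)
  constructor <;> linarith [this.1, this.2]

theorem hasLineDerivAt_truncSource (H : AdmissibleData p μ γ₁ γ₂ k B C f g f' g')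
    {w : ℝ × ℝ → ℝ} {w' c : ℝ} {z : ℝ × ℝ} (hz : 0 < z.2)
    (hw : HasLineDerivAt ℝ w w' z (c, 1)) :
    HasLineDerivAt ℝ (fun z => truncSource p μ (γ₁ + γ₂) n z.2 (w z))
      (μ / (1 + z.2) ^ 2 * (w z / 2) + truncSlope p μ (γ₁ + γ₂) n z.2 (w z) * w') z (c, 1) := by
  have hw' : HasDerivAt (fun s : ℝ => w (z + s • ((c, 1) : ℝ × ℝ))) w' 0 := hw
  have h1 := HasDerivAt.comp (0:ℝ) (h₂ := powTrunc p (γ₁ + γ₂) n)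
    (hasDerivAt_powTrunc H.hp _) hw'
  have h2 : HasDerivAt (fun s : ℝ => (z + s • ((c, 1) : ℝ × ℝ)).2) 1 0 := by
    simpa using (hasDerivAt_id (0:ℝ)).const_add z.2
  have h3 := HasDerivAt.comp (0:ℝ) (h₂ := damp μ) (hasDerivAt_damp μ (by simpa using hz)) h2
  have h4 := h1.sub (h3.mul (hw'.div_const 2))
  refine (h4.congr_deriv ?_ : HasDerivAt _ _ _)
  simp [truncSlope]
  ring

/-- The two functions are `∂ₜφ + c ∂ₓφ` and `∂ₜψ + c ∂ₓψ`, with the time derivatives eliminated by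
the equations. A derivative of the solution in a fixed direction solves the linearized system; the
extra forcing comes from the decay in time of the damping coefficient and has the sign of `φ + ψ`.
-/
theorem char_combination (H : AdmissibleData p μ γ₁ γ₂ k B C f g f' g')
    (S : IsC1Solution f g f' g' (truncSource p μ (γ₁ + γ₂) n) (truncSlope p μ (γ₁ + γ₂) n) φ ψ q r)
    {z : ℝ × ℝ} (hz : 0 < z.2) (c : ℝ) :
    HasLineDerivAt ℝ (fun z => truncSource p μ (γ₁ + γ₂) n z.2 (φ z + ψ z) + (1 + c) * q z)
      (μ / (1 + z.2) ^ 2 * ((φ z + ψ z) / 2) + truncSlope p μ (γ₁ + γ₂) n z.2 (φ z + ψ z) *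
        ((truncSource p μ (γ₁ + γ₂) n z.2 (φ z + ψ z) + (1 + c) * q z) +
          (truncSource p μ (γ₁ + γ₂) n z.2 (φ z + ψ z) + (c - 1) * r z))) z (-1, 1) ∧
    HasLineDerivAt ℝ (fun z => truncSource p μ (γ₁ + γ₂) n z.2 (φ z + ψ z) + (c - 1) * r z)
      (μ / (1 + z.2) ^ 2 * ((φ z + ψ z) / 2) + truncSlope p μ (γ₁ + γ₂) n z.2 (φ z + ψ z) *
        ((truncSource p μ (γ₁ + γ₂) n z.2 (φ z + ψ z) + (1 + c) * q z) +
          (truncSource p μ (γ₁ + γ₂) n z.2 (φ z + ψ z) + (c - 1) * r z))) z (1, 1) := by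
  constructor
  · have h1 := H.hasLineDerivAt_truncSource (n := n) hz
      (hasLineDerivAt_add (S.left z) (S.hasLineDerivAt_right z (-1) 1))
    have h2 := hasLineDerivAt_add h1 (hasLineDerivAt_const_mul (1 + c) (S.q_char z))
    convert h2 using 1
    ring
  · have h1 := H.hasLineDerivAt_truncSource (n := n) hz
      (hasLineDerivAt_add (S.hasLineDerivAt_left z 1 1) (S.right z))
    have h2 := hasLineDerivAt_add h1 (hasLineDerivAt_const_mul (c - 1) (S.r_char z))
    convert h2 using 1
    ring

/-- Monotonicity in every direction of slope at most `k`. -/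
theorem slope_bound_aux (H : AdmissibleData p μ γ₁ γ₂ k B C f g f' g') (hn : γ₁ + γ₂ ≤ n)
    (S : IsC1Solution f g f' g' (truncSource p μ (γ₁ + γ₂) n) (truncSlope p μ (γ₁ + γ₂) n) φ ψ q r)
    {c : ℝ} (hc : |c| ≤ k) {z : ℝ × ℝ} (hz : 0 ≤ z.2) :
    0 ≤ truncSource p μ (γ₁ + γ₂) n z.2 (φ z + ψ z) + (1 + c) * q z ∧
      0 ≤ truncSource p μ (γ₁ + γ₂) n z.2 (φ z + ψ z) + (c - 1) * r z := by
  have hL : 0 ≤ p * (2:ℝ) ^ (-p) * n ^ (p - 1) + μ :=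
    (abs_nonneg _).trans (H.abs_truncSlope_le hn 0 0)
  have hcont : Continuous fun z : ℝ × ℝ => truncSource p μ (γ₁ + γ₂) n z.2 (φ z + ψ z) := by
    have h1 : Continuous (powTrunc p (γ₁ + γ₂) n) :=
      continuous_iff_continuousAt.2 fun w => (hasDerivAt_powTrunc H.hp w).continuousAt
    have h2 := continuous_damp μ
    have h3 := S.continuous_sum
    unfold truncSource
    fun_prop
  have hq := S.continuous_q
  have hr := S.continuous_r
  have hlow : ∀ y : ℝ × ℝ, 0 ≤ y.2 → γ₁ + γ₂ ≤ φ y + ψ y := fun y hy => by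
    have := H.lower_bound hn S hy
    linarith
  -- The assumption on the initial slopes enters here; its factor `1 + k` is the largest value of
  -- `|1 + c|` and `|c - 1|` for `|c| ≤ k`.
  have hinit : ∀ (y : ℝ × ℝ) (d s : ℝ), 0 ≤ y.2 → |d| ≤ 1 + k →
      (1 + k) * |s| ≤ (2:ℝ) ^ (-p) * (γ₁ + γ₂) ^ p - μ / 2 * (γ₁ + γ₂) →
      0 ≤ truncSource p μ (γ₁ + γ₂) n y.2 (φ y + ψ y) + d * s := by
    intro y d s hy hd hs
    have h1 := H.initial_le_truncSource hy hn (hlow y hy)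
    have h2 : |d * s| ≤ (1 + k) * |s| := by
      rw [abs_mul]; exact mul_le_mul_of_nonneg_right hd (abs_nonneg _)
    have h3 := (abs_le.1 h2).1
    linarith
  have hk := H.hk
  have hc' := abs_le.1 hc
  have hmin : ∀ y : ℝ × ℝ, 0 < y.2 → ∀ s : ℝ,
      (p * (2:ℝ) ^ (-p) * n ^ (p - 1) + μ) * min s 0 ≤
      μ / (1 + y.2) ^ 2 * ((φ y + ψ y) / 2) +
        truncSlope p μ (γ₁ + γ₂) n y.2 (φ y + ψ y) * s := by
    intro y hy s
    have h1 := H.truncSlope_pos (n := n) hy.le (φ y + ψ y)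
    have h2 := (le_abs_self _).trans (H.abs_truncSlope_le hn y.2 (φ y + ψ y))
    have h3 : 0 ≤ μ / (1 + y.2) ^ 2 * ((φ y + ψ y) / 2) := by
      have h4 := H.γ_pos.le.trans (hlow y hy.le)
      have h5 := H.hμ
      positivity
    rcases le_total 0 s with hs | hs
    · rw [min_eq_right hs, mul_zero]
      positivity
    · rw [min_eq_left hs]
      have := mul_le_mul_of_nonpos_right h2 hs
      linarith
  refine nonneg_of_lineDeriv_ge (t₀ := 0) (z₁ := z) hL
    (a := fun z => truncSource p μ (γ₁ + γ₂) n z.2 (φ z + ψ z) + (1 + c) * q z)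
    (b := fun z => truncSource p μ (γ₁ + γ₂) n z.2 (φ z + ψ z) + (c - 1) * r z)
    (by fun_prop) (by fun_prop) ?_ ?_
    (fun y _ hy => (H.char_combination S hy c).1) (fun y _ hy => (H.char_combination S hy c).2)
    (fun y _ hy => hmin y hy _) (fun y _ hy => hmin y hy _) z (apex_mem_closedCone hz)
  · intro y _ hy
    refine hinit y _ _ hy.ge (abs_le.2 ⟨by linarith, by linarith⟩) ?_
    have e : y = (y.1, 0) := by rw [← hy]
    rw [e, S.init_q]
    refine le_trans ?_ (H.slope y.1)
    exact mul_le_mul_of_nonneg_left (by linarith [abs_nonneg (g' y.1)]) (by linarith)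
  · intro y _ hy
    refine hinit y _ _ hy.ge (abs_le.2 ⟨by linarith, by linarith⟩) ?_
    have e : y = (y.1, 0) := by rw [← hy]
    rw [e, S.init_r]
    refine le_trans ?_ (H.slope y.1)
    exact mul_le_mul_of_nonneg_left (by linarith [abs_nonneg (f' y.1)]) (by linarith)

theorem slope_bound (H : AdmissibleData p μ γ₁ γ₂ k B C f g f' g') (hn : γ₁ + γ₂ ≤ n)
    (S : IsC1Solution f g f' g' (truncSource p μ (γ₁ + γ₂) n) (truncSlope p μ (γ₁ + γ₂) n) φ ψ q r)
    {z : ℝ × ℝ} (hz : 0 ≤ z.2) :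
    k * |dx φ z| ≤ dt φ z ∧ k * |dx ψ z| ≤ dt ψ z := by
  have hk : 0 < k := by linarith [H.hk]
  have h1 := H.slope_bound_aux hn S (c := k) (by rw [abs_of_pos hk]) hz
  have h2 := H.slope_bound_aux hn S (c := -k) (by rw [abs_neg, abs_of_pos hk]) hz
  rw [S.dx_left_eq, S.dx_right_eq, S.dt_left_eq, S.dt_right_eq]
  have key : ∀ x y : ℝ, -y ≤ k * x → k * x ≤ y → k * |x| ≤ y := fun x y h h' => by
    have e : k * |x| = |k * x| := by rw [abs_mul, abs_of_pos hk]
    rw [e]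
    exact abs_le.2 ⟨h, h'⟩
  constructor
  · exact key _ _ (by linarith [h1.1]) (by linarith [h2.1])
  · exact key _ _ (by linarith [h1.2]) (by linarith [h2.2])

/-- As `k > 1`, the admissible directions form a cone strictly wider than the light cone. In
particular the value at an apex dominates the sum in its whole backward light cone, so a truncation
that is inactive at a point is inactive in its domain of dependence. -/
theorem sum_le_of_timelike (H : AdmissibleData p μ γ₁ γ₂ k B C f g f' g') (hn : γ₁ + γ₂ ≤ n)
    (S : IsC1Solution f g f' g' (truncSource p μ (γ₁ + γ₂) n) (truncSlope p μ (γ₁ + γ₂) n) φ ψ q r)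
    {z z' : ℝ × ℝ} (hz : 0 ≤ z.2) (h : |z'.1 - z.1| ≤ k * (z'.2 - z.2)) :
    φ z + ψ z ≤ φ z' + ψ z' := by
  have hk : 0 < k := by linarith [H.hk]
  have hτ : 0 ≤ z'.2 - z.2 := nonneg_of_mul_nonneg_right ((abs_nonneg _).trans h) hk
  set e : ℝ × ℝ := z' - z with he
  have hd : Differentiable ℝ fun z => φ z + ψ z := S.differentiable_left.add S.differentiable_right
  have hder : ∀ s : ℝ, HasDerivAt (fun s : ℝ => φ (z + s • e) + ψ (z + s • e))
      (e.1 * (dx φ (z + s • e) + dx ψ (z + s • e)) +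
        e.2 * (dt φ (z + s • e) + dt ψ (z + s • e))) s := by
    intro s
    have h1 := hasLineDerivAt_add
      (hasLineDerivAt_of_differentiableAt (S.differentiable_left (z + s • e)) e.1 e.2)
      (hasLineDerivAt_of_differentiableAt (S.differentiable_right (z + s • e)) e.1 e.2)
    have h2 : HasDerivAt _ _ _ := h1
    have h3 : HasDerivAt (fun u : ℝ => u - s) 1 s := (hasDerivAt_id s).sub_const s
    have h4 := HasDerivAt.comp s (h₂ := fun t : ℝ => φ (z + s • e + t • (e.1, e.2)) +
      ψ (z + s • e + t • (e.1, e.2))) (by simpa using h2) h3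
    refine (h4.congr_deriv (by ring)).congr_of_eventuallyEq (Filter.Eventually.of_forall ?_)
    intro u
    have : z + s • e + (u - s) • (e.1, e.2) = z + u • e := by
      rw [Prod.mk.eta, sub_smul]; abel
    simp only [Function.comp, this]
  have hmono : MonotoneOn (fun s : ℝ => φ (z + s • e) + ψ (z + s • e)) (Icc 0 1) := by
    refine monotoneOn_of_deriv_nonneg (convex_Icc 0 1)
      (fun s _ => (hder s).continuousAt.continuousWithinAt)
      (fun s _ => (hder s).differentiableAt.differentiableWithinAt) fun s hs => ?_
    rw [interior_Icc] at hs
    rw [(hder s).deriv]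
    have hs2 : 0 ≤ (z + s • e).2 := by
      have : 0 ≤ s * e.2 := mul_nonneg hs.1.le hτ
      simp only [Prod.snd_add, Prod.smul_snd, smul_eq_mul]
      linarith
    obtain ⟨h1, h2⟩ := H.slope_bound hn S hs2
    have h3 : |e.1 * (dx φ (z + s • e) + dx ψ (z + s • e))| ≤
        k * e.2 * (|dx φ (z + s • e)| + |dx ψ (z + s • e)|) := by
      rw [abs_mul]
      exact mul_le_mul h (abs_add_le _ _) (abs_nonneg _) (mul_nonneg hk.le hτ)
    have h4 := (abs_le.1 h3).1
    have h5 := mul_le_mul_of_nonneg_left (add_le_add h1 h2) hτ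
    have h6 : e.2 = z'.2 - z.2 := rfl
    rw [h6] at h4 ⊢
    linarith
  have := hmono (left_mem_Icc.2 zero_le_one) (right_mem_Icc.2 zero_le_one) zero_le_one
  simpa [he] using this

end AdmissibleData

end DampedWave
end

/-! ### Construction of the blow-up curve from the truncated problems -/

noncomputable section

namespace DampedWave

/-- The solution of the system below its blow-up curve `T`, as it is obtained from the truncated
problems; `τ n` parametrizes the curve on which `φ + ψ` takes the value `2 * B + 1 + n`. -/
structure IsBlowUpProfile (p μ γ₁ γ₂ k B T₁ : ℝ) (f g f' g' T : ℝ → ℝ) (τ : ℕ → ℝ → ℝ)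
    (φ ψ : ℝ × ℝ → ℝ) : Prop where
  pos : ∀ x, 0 < T x
  le : ∀ x, T x ≤ T₁
  lipschitz : ∀ x y, k * |T x - T y| ≤ |x - y|
  level_pos : ∀ n x, 0 < τ n x
  level_lt : ∀ n x, τ n x < T x
  level_eq : ∀ n x, φ (x, τ n x) + ψ (x, τ n x) = 2 * B + 1 + n
  level_lipschitz : ∀ n x y, k * |τ n x - τ n y| ≤ |x - y|
  level_le : ∀ n x t, τ n x ≤ t → t < T x → 2 * B + 1 + n ≤ φ (x, t) + ψ (x, t)
  -- Points on the line `t = 0` are included, so that the initial values are encoded as well; near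
  -- them the agreement is claimed on `t ≥ 0` only.
  local_eq : ∀ z : ℝ × ℝ, 0 ≤ z.2 → z.2 < T z.1 → ∃ n φ' ψ' q r, γ₁ + γ₂ ≤ n ∧
    IsC1Solution f g f' g' (truncSource p μ (γ₁ + γ₂) n) (truncSlope p μ (γ₁ + γ₂) n) φ' ψ' q r ∧
    φ' z + ψ' z < n ∧ ∀ᶠ y in 𝓝 z, 0 ≤ y.2 → φ y = φ' y ∧ ψ y = ψ' y

namespace AdmissibleData

variable {p μ γ₁ γ₂ k B C n : ℝ} {f g f' g' : ℝ → ℝ} {φ ψ q r : ℝ × ℝ → ℝ}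

/-- Solutions of two truncated problems agree as long as they are below both truncation levels. -/
theorem truncated_eq (H : AdmissibleData p μ γ₁ γ₂ k B C f g f' g') {m : ℝ}
    {φ' ψ' q' r' : ℝ × ℝ → ℝ} (hn : γ₁ + γ₂ ≤ n) (hm : γ₁ + γ₂ ≤ m)
    (S : IsC1Solution f g f' g' (truncSource p μ (γ₁ + γ₂) n) (truncSlope p μ (γ₁ + γ₂) n) φ ψ q r)
    (S' : IsC1Solution f g f' g' (truncSource p μ (γ₁ + γ₂) m) (truncSlope p μ (γ₁ + γ₂) m)
      φ' ψ' q' r') {z : ℝ × ℝ} (hz : 0 ≤ z.2) (h : φ z + ψ z ≤ n) (h' : φ z + ψ z ≤ m) :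
    φ z = φ' z ∧ ψ z = ψ' z := by
  have hL : 0 ≤ p * (2:ℝ) ^ (-p) * m ^ (p - 1) + μ :=
    (abs_nonneg _).trans (H.abs_truncSlope_le hm 0 0)
  -- Only the first solution is known to stay below both levels. Along it the two truncated sources
  -- coincide, and the global Lipschitz bound of the second source controls the difference.
  have hcone : ∀ y ∈ closedCone 0 z, φ y + ψ y ≤ φ z + ψ z := fun y hy => by
    refine H.sum_le_of_timelike hn S hy.1 ?_
    have h1 := hy.2
    rw [abs_sub_comm] at h1
    have h2 := (abs_nonneg _).trans h1
    nlinarith [H.hk]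
  have hsrc : ∀ y ∈ closedCone 0 z, 0 < y.2 →
      |truncSource p μ (γ₁ + γ₂) n y.2 (φ y + ψ y) - truncSource p μ (γ₁ + γ₂) m y.2 (φ' y + ψ' y)| ≤
      (p * (2:ℝ) ^ (-p) * m ^ (p - 1) + μ) * |φ y - φ' y + (ψ y - ψ' y)| := by
    intro y hy hy0
    have h1 := H.lower_bound hn S hy0.le
    have h2 := hcone y hy
    rw [truncSource_eq H.hp H.γ_pos hy0.le (by linarith) (h2.trans h),
      ← truncSource_eq H.hp H.γ_pos hy0.le (by linarith) (h2.trans h')]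
    refine (H.abs_truncSource_sub_le hm _ _ _).trans (le_of_eq ?_)
    rw [add_sub_add_comm]
  have := eq_zero_of_abs_lineDeriv_le (t₀ := 0) (z₁ := z) hL (a := fun z => φ z - φ' z)
    (b := fun z => ψ z - ψ' z)
    (S.contDiff_left.continuous.sub S'.contDiff_left.continuous).continuousOn
    (S.contDiff_right.continuous.sub S'.contDiff_right.continuous).continuousOn
    (fun y _ hy => by
      have e : y = (y.1, 0) := by rw [← hy]
      rw [e, S.init_left, S'.init_left, sub_self])
    (fun y _ hy => by
      have e : y = (y.1, 0) := by rw [← hy]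
      rw [e, S.init_right, S'.init_right, sub_self])
    (fun y _ _ => HasDerivAt.fun_sub (S.left y) (S'.left y))
    (fun y _ _ => HasDerivAt.fun_sub (S.right y) (S'.right y))
    hsrc hsrc z (apex_mem_closedCone hz)
  exact ⟨sub_eq_zero.1 this.1, sub_eq_zero.1 this.2⟩

/-- The comparison functions stay above their initial sum. -/
theorem ode_lower_bound (H : AdmissibleData p μ γ₁ γ₂ k B C f g f' g') {T₁ : ℝ} {W : ℝ → ℝ}
    (hc : ContinuousOn W (Ico 0 T₁)) (h0 : W 0 = γ₁ + γ₂)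
    (hd : ∀ t ∈ Ioo 0 T₁, HasDerivAt W
      (2 * ((2:ℝ) ^ (-p) * |W t| ^ p - μ / 2 * W t)) t) :
    ∀ t ∈ Ico 0 T₁, γ₁ + γ₂ ≤ W t := by
  intro t ht
  set F : ℝ → ℝ := fun w => 2 * ((2:ℝ) ^ (-p) * |w| ^ p - μ / 2 * w) with hF
  have hp := H.hp
  have hFc : Continuous F := by
    have : Continuous fun w : ℝ => |w| ^ p := continuous_abs.rpow_const fun _ => Or.inr (by linarith)
    simp only [hF]
    fun_prop
  -- The ODE is assumed at positive times only; the right derivative at `0` is recovered as the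
  -- limit of the derivatives.
  have hder : ∀ s ∈ Ico 0 t, HasDerivWithinAt W (F (W s)) (Ici s) s := by
    intro s hs
    rcases hs.1.eq_or_lt with h | h
    · rw [← h]
      have hT : 0 < T₁ := lt_of_le_of_lt ht.1 ht.2
      have hmem : Ioo 0 T₁ ∈ 𝓝[>] (0:ℝ) := Ioo_mem_nhdsGT hT
      have hW0 : Tendsto W (𝓝[>] 0) (𝓝 (W 0)) :=
        ((hc 0 ⟨le_rfl, hT⟩).mono_of_mem_nhdsWithin
          (mem_of_superset hmem Ioo_subset_Ico_self)).tendsto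
      refine hasDerivWithinAt_Ici_of_tendsto_deriv (s := Ioo 0 T₁)
        (fun u hu => (hd u hu).differentiableAt.differentiableWithinAt)
        ((hc 0 ⟨le_rfl, hT⟩).mono Ioo_subset_Ico_self) hmem ?_
      refine ((hFc.tendsto _).comp hW0).congr' ?_
      filter_upwards [hmem] with u hu
      exact ((hd u hu).deriv).symm
    · exact (hd s ⟨h, hs.2.trans ht.2⟩).hasDerivWithinAt
  -- At a contact with the level `γ₁ + γ₂` the derivative of `W` is strictly positive, so `W` cannot
  -- cross it downwards.
  have := image_le_of_deriv_right_lt_deriv_boundary' (f := fun s => -W s) (f' := fun s => -F (W s))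
    (a := 0) (b := t) (B := fun _ => -(γ₁ + γ₂)) (B' := fun _ => 0)
    (hc.mono fun s hs => ⟨hs.1, hs.2.trans_lt ht.2⟩).neg
    (fun s hs => (hder s hs).neg) (by rw [h0]) continuousOn_const
    (fun s _ => hasDerivWithinAt_const _ _ _) (fun s hs h => ?_) ⟨ht.1, le_rfl⟩
  · simpa using this
  · have h1 : W s = γ₁ + γ₂ := neg_injective h
    rw [h1, hF]
    simp only
    rw [abs_of_pos H.γ_pos]
    linarith [H.initial_pos]

/-- The pair `a, b` is a subsolution: its data are smaller and its damping coefficient is the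
maximal one `μ`. When `a + b` reaches `n`, so has the truncated solution at every `x`. -/
theorem exists_level_time_le (H : AdmissibleData p μ γ₁ γ₂ k B C f g f' g') {T₁ : ℝ}
    (hT : IsODEBlowUpTime μ p γ₁ γ₂ T₁) (hn : γ₁ + γ₂ ≤ n)
    (S : IsC1Solution f g f' g' (truncSource p μ (γ₁ + γ₂) n) (truncSlope p μ (γ₁ + γ₂) n) φ ψ q r) :
    ∃ t ∈ Ico 0 T₁, ∀ x, n ≤ φ (x, t) + ψ (x, t) := by
  obtain ⟨hT0, a, b, ha, hb, ha0, hb0, hd, hlim⟩ := hT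
  have hL : 0 ≤ p * (2:ℝ) ^ (-p) * n ^ (p - 1) + μ :=
    (abs_nonneg _).trans (H.abs_truncSlope_le hn 0 0)
  set W : ℝ → ℝ := fun t => a t + b t with hW
  have hWc : ContinuousOn W (Ico 0 T₁) := ha.add hb
  have hWγ := H.ode_lower_bound hWc (by simp [hW, ha0, hb0]) fun t ht =>
    (((hd t ht).1.fun_add (hd t ht).2).congr_deriv (by simp only [hW]; ring))
  obtain ⟨t₁, ht₁, ht₁'⟩ : ∃ t, n ≤ W t ∧ t ∈ Ioo 0 T₁ :=
    ((hlim.eventually_ge_atTop n).and (Ioo_mem_nhdsLT hT0)).exists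
  have hsub : Icc 0 t₁ ⊆ Ico 0 T₁ := fun s hs => ⟨hs.1, hs.2.trans_lt ht₁'.2⟩
  have hcomp : IsCompact (Icc 0 t₁ ∩ W ⁻¹' Ici n) :=
    isCompact_Icc.of_isClosed_subset
      ((hWc.mono hsub).preimage_isClosed_of_isClosed isClosed_Icc isClosed_Ici) inter_subset_left
  -- At the first time at which `W` reaches `n` all earlier values are at most `n`, so the
  -- truncation does not affect `W`.
  obtain ⟨t, ⟨ht, htn⟩, hleast⟩ := hcomp.exists_isLeast ⟨t₁, ⟨ht₁'.1.le, le_rfl⟩, ht₁⟩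
  have htn' : n ≤ W t := htn
  have hWn : ∀ s ∈ Icc 0 t, W s ≤ n := by
    intro s hs
    by_contra hlt
    push Not at hlt
    have hss : Icc 0 s ⊆ Ico 0 T₁ := (Icc_subset_Icc_right (hs.2.trans ht.2)).trans hsub
    have hW0 : W 0 ≤ n := by simpa [hW, ha0, hb0] using hn
    obtain ⟨u, hu, hun⟩ := intermediate_value_Icc hs.1 (hWc.mono hss) ⟨hW0, hlt.le⟩
    have h1 : t ≤ u := hleast ⟨⟨hu.1, hu.2.trans (hs.2.trans ht.2)⟩, hun.ge⟩
    have h2 : u = s := le_antisymm hu.2 (hs.2.trans h1)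
    rw [← h2] at hlt
    linarith
  refine ⟨t, hsub ht, fun x => ?_⟩
  have hconeT : ∀ y ∈ closedCone 0 (x, t), y.2 ∈ Icc 0 t := fun y hy =>
    ⟨hy.1, by have := (abs_nonneg _).trans hy.2; simpa using this⟩
  have hcl : ∀ u : ℝ → ℝ, ContinuousOn u (Ico 0 T₁) →
      ContinuousOn (fun y : ℝ × ℝ => u y.2) (closedCone 0 (x, t)) := fun u hu =>
    hu.comp continuousOn_snd fun y hy =>
      hsub ⟨(hconeT y hy).1, (hconeT y hy).2.trans ht.2⟩
  have hsrc : ∀ y ∈ closedCone 0 (x, t), 0 < y.2 →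
      (p * (2:ℝ) ^ (-p) * n ^ (p - 1) + μ) * min (φ y - a y.2 + (ψ y - b y.2)) 0 ≤
      truncSource p μ (γ₁ + γ₂) n y.2 (φ y + ψ y) -
        ((2:ℝ) ^ (-p) * |W y.2| ^ p - μ / 2 * W y.2) := by
    intro y hy hy0
    have h1 := H.min_le_truncSource_sub hn hy0.le (φ y + ψ y) (W y.2)
    have hWy := hWγ y.2 (hsub ⟨(hconeT y hy).1, (hconeT y hy).2.trans ht.2⟩)
    have h2 : (2:ℝ) ^ (-p) * |W y.2| ^ p - μ / 2 * W y.2 ≤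
        truncSource p μ (γ₁ + γ₂) n y.2 (W y.2) := by
      unfold truncSource
      have hW0 := H.γ_pos.le.trans hWy
      rw [powTrunc_eq H.hp hWy (hWn _ (hconeT y hy)), abs_of_nonneg hW0]
      have := mul_le_mul_of_nonneg_right (damp_le H.hμ.le hy0.le) hW0
      linarith
    have e : φ y - a y.2 + (ψ y - b y.2) = φ y + ψ y - W y.2 := by simp only [hW]; ring
    rw [e]
    linarith
  have hline : ∀ (u : ℝ → ℝ) (u' c : ℝ) (y : ℝ × ℝ), HasDerivAt u u' y.2 →
      HasLineDerivAt ℝ (fun y : ℝ × ℝ => u y.2) u' y (c, 1) := by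
    intro u u' c y hu
    have h2 : HasDerivAt (fun s : ℝ => (y + s • ((c, 1) : ℝ × ℝ)).2) 1 0 := by
      simpa using (hasDerivAt_id (0:ℝ)).const_add y.2
    have h3 := HasDerivAt.comp (0:ℝ) (h₂ := u) (by simpa using hu) h2
    exact (h3.congr_deriv (mul_one _) : HasDerivAt _ _ _)
  have hmem : ∀ y ∈ closedCone 0 (x, t), 0 < y.2 → y.2 ∈ Ioo 0 T₁ := fun y hy hy0 =>
    ⟨hy0, ((hconeT y hy).2.trans ht.2).trans_lt ht₁'.2⟩
  have := nonneg_of_lineDeriv_ge (t₀ := 0) (z₁ := (x, t)) hL (a := fun y => φ y - a y.2)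
    (b := fun y => ψ y - b y.2)
    (S.contDiff_left.continuous.continuousOn.sub (hcl a ha))
    (S.contDiff_right.continuous.continuousOn.sub (hcl b hb))
    (fun y _ hy => by
      have e : y = (y.1, 0) := by rw [← hy]
      rw [e, S.init_left, ha0]
      linarith [H.hfγ y.1])
    (fun y _ hy => by
      have e : y = (y.1, 0) := by rw [← hy]
      rw [e, S.init_right, hb0]
      linarith [H.hgγ y.1])
    (fun y hy hy0 => HasDerivAt.fun_sub (S.left y) (hline a _ _ y (hd _ (hmem y hy hy0)).1))
    (fun y hy hy0 => HasDerivAt.fun_sub (S.right y) (hline b _ _ y (hd _ (hmem y hy hy0)).2))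
    hsrc hsrc (x, t) (apex_mem_closedCone ht.1)
  have h3 := this.1
  have h4 := this.2
  simp only [hW] at htn'
  linarith

/-- By `slope_bound` a vanishing time derivative of `φ` would force its space derivative to vanish
too, against the positivity of the source `∂ₜφ - ∂ₓφ`. -/
theorem strictMonoOn_time (H : AdmissibleData p μ γ₁ γ₂ k B C f g f' g') (hn : γ₁ + γ₂ ≤ n)
    (S : IsC1Solution f g f' g' (truncSource p μ (γ₁ + γ₂) n) (truncSlope p μ (γ₁ + γ₂) n) φ ψ q r)
    (x : ℝ) : StrictMonoOn (fun t => φ (x, t) + ψ (x, t)) (Ici 0) := by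
  have hder : ∀ t : ℝ, HasDerivAt (fun t => φ (x, t) + ψ (x, t)) (dt φ (x, t) + dt ψ (x, t)) t := by
    intro t
    have h1 := hasLineDerivAt_add
      (hasLineDerivAt_of_differentiableAt (S.differentiable_left (x, t)) 0 1)
      (hasLineDerivAt_of_differentiableAt (S.differentiable_right (x, t)) 0 1)
    have h2 : HasDerivAt _ _ _ := h1
    have h3 : HasDerivAt (fun u : ℝ => u - t) 1 t := (hasDerivAt_id t).sub_const t
    have h4 := HasDerivAt.comp t (h₂ := fun s : ℝ => φ ((x, t) + s • (0, 1)) +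
      ψ ((x, t) + s • (0, 1))) (by simpa using h2) h3
    refine (h4.congr_deriv (by ring)).congr_of_eventuallyEq (Filter.Eventually.of_forall ?_)
    intro u
    simp
  refine strictMonoOn_of_deriv_pos (convex_Ici 0)
    (fun t _ => (hder t).continuousAt.continuousWithinAt) fun t ht => ?_
  rw [interior_Ici] at ht
  rw [(hder t).deriv]
  have ht0 : (0:ℝ) ≤ t := le_of_lt ht
  obtain ⟨h1, h2⟩ := H.slope_bound hn S (z := (x, t)) ht0
  have h3 := H.lower_bound hn S (z := (x, t)) ht0
  have h4 := H.initial_le_truncSource (t := t) ht0 hn (by linarith : γ₁ + γ₂ ≤ φ (x, t) + ψ (x, t))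
  have h5 := H.initial_pos
  have h6 : dt φ (x, t) - dx φ (x, t) = truncSource p μ (γ₁ + γ₂) n t (φ (x, t) + ψ (x, t)) := by
    rw [S.dt_left_eq, S.dx_left_eq]; ring
  have hk := H.hk
  have h7 := neg_abs_le (dx φ (x, t))
  have h8 := abs_nonneg (dx φ (x, t))
  have h9 := abs_nonneg (dx ψ (x, t))
  nlinarith

/-- The curve is the supremum of the times `τ n x` at which the `n`-th truncated solution reaches
its truncation level. Before that time it coincides with all later ones. Comparison with the ODE
bounds these times by `T₁`. -/
theorem exists_blowUpProfile (H : AdmissibleData p μ γ₁ γ₂ k B C f g f' g') {T₁ : ℝ}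
    (hT : IsODEBlowUpTime μ p γ₁ γ₂ T₁) :
    ∃ T τ φ ψ, IsBlowUpProfile p μ γ₁ γ₂ k B T₁ f g f' g' T τ φ ψ := by
  have hγB : γ₁ + γ₂ ≤ 2 * B := by
    have h1 := (H.hfγ 0).trans ((le_abs_self _).trans (H.hfB 0))
    have h2 := (H.hgγ 0).trans ((le_abs_self _).trans (H.hgB 0))
    linarith
  -- The initial sum is at most `2 * B`, so these levels are attained only at positive times.
  have hlev : ∀ n : ℕ, γ₁ + γ₂ ≤ 2 * B + 1 + n := fun n => by
    have : (0:ℝ) ≤ n := Nat.cast_nonneg n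
    linarith
  choose φ ψ q r S using fun n : ℕ => H.exists_truncated_solution (hlev n)
  have hk : 0 < k := by linarith [H.hk]
  have hτ : ∀ (n : ℕ) (x : ℝ), ∃ t, 0 < t ∧ t < T₁ ∧ φ n (x, t) + ψ n (x, t) = 2 * B + 1 + n := by
    intro n x
    obtain ⟨t, ht, htn⟩ := H.exists_level_time_le hT (hlev n) (S n)
    have hc : Continuous fun t : ℝ => φ n (x, t) + ψ n (x, t) :=
      (S n).continuous_sum.comp (by fun_prop : Continuous fun t : ℝ => (x, t))
    have h0 : φ n (x, 0) + ψ n (x, 0) < 2 * B + 1 + n := by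
      rw [(S n).init_left, (S n).init_right]
      have h1 := (le_abs_self _).trans (H.hfB x)
      have h2 := (le_abs_self _).trans (H.hgB x)
      have : (0:ℝ) ≤ n := Nat.cast_nonneg n
      linarith
    obtain ⟨s, hs, hs'⟩ := intermediate_value_Icc ht.1 hc.continuousOn ⟨h0.le, htn x⟩
    refine ⟨s, lt_of_le_of_ne hs.1 fun h => ?_, hs.2.trans_lt ht.2, hs'⟩
    rw [← h] at hs'
    exact absurd hs' h0.ne
  choose τ hτ0 hτ1 hτn using hτ
  have hlt_iff : ∀ n x t, 0 ≤ t → (φ n (x, t) + ψ n (x, t) < 2 * B + 1 + n ↔ t < τ n x) := by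
    intro n x t ht
    rw [← hτn n x]
    exact (H.strictMonoOn_time (hlev n) (S n) x).lt_iff_lt ht (hτ0 n x).le
  have hcons : ∀ n m : ℕ, n ≤ m → ∀ z : ℝ × ℝ, 0 ≤ z.2 → φ n z + ψ n z ≤ 2 * B + 1 + n →
      φ n z = φ m z ∧ ψ n z = ψ m z := by
    intro n m hnm z hz h
    have : (n:ℝ) ≤ m := Nat.cast_le.2 hnm
    exact H.truncated_eq (hlev n) (hlev m) (S n) (S m) hz h (by linarith)
  have hstrict : ∀ n m : ℕ, n < m → ∀ x, τ n x < τ m x := by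
    intro n m hnm x
    rw [← hlt_iff m x _ (hτ0 n x).le]
    obtain ⟨h1, h2⟩ := hcons n m hnm.le (x, τ n x) (hτ0 n x).le (hτn n x).le
    rw [← h1, ← h2, hτn]
    have : (n:ℝ) < m := Nat.cast_lt.2 hnm
    linarith
  -- Along the segment of slope `1 / k` from `(y, τ n y)` the sum does not decrease, so above `x`
  -- the level is reached no later than at its endpoint.
  have hlip : ∀ n x y, τ n x ≤ τ n y + |x - y| / k := by
    intro n x y
    by_contra h
    push Not at h
    have h0 : 0 ≤ τ n y + |x - y| / k := add_nonneg (hτ0 n y).le (by positivity)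
    have h1 := (hlt_iff n x _ h0).2 h
    have h2 := H.sum_le_of_timelike (hlev n) (S n) (z := (y, τ n y))
      (z' := (x, τ n y + |x - y| / k)) (hτ0 n y).le (by
        simp only [add_sub_cancel_left]
        rw [mul_div_cancel₀ _ hk.ne'])
    rw [hτn] at h2
    linarith
  have habs : ∀ u : ℝ → ℝ, (∀ x y, u x ≤ u y + |x - y| / k) →
      ∀ x y, k * |u x - u y| ≤ |x - y| := by
    intro u hu x y
    have h1 := hu x y
    have h2 := hu y x
    rw [abs_sub_comm] at h2
    rw [mul_comm, ← le_div_iff₀ hk, abs_le]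
    constructor <;> linarith
  set T : ℝ → ℝ := fun x => ⨆ n, τ n x with hTdef
  have hbdd : ∀ x, BddAbove (range fun n => τ n x) := fun x =>
    ⟨T₁, by rintro _ ⟨n, rfl⟩; exact (hτ1 n x).le⟩
  have hτT : ∀ n x, τ n x < T x := fun n x =>
    (hstrict n (n + 1) (Nat.lt_succ_self n) x).trans_le (le_ciSup (hbdd x) (n + 1))
  have hTlip : ∀ x y, T x ≤ T y + |x - y| / k := fun x y =>
    ciSup_le fun n => (hlip n x y).trans (by linarith [hτT n y])
  -- At points with `0 ≤ t < T x` the sequence is eventually constant, and the limit is its final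
  -- value; elsewhere the value plays no role.
  set φ₀ : ℝ × ℝ → ℝ := fun z => limUnder atTop fun n => φ n z
  set ψ₀ : ℝ × ℝ → ℝ := fun z => limUnder atTop fun n => ψ n z
  have heq : ∀ n (z : ℝ × ℝ), 0 ≤ z.2 → φ n z + ψ n z ≤ 2 * B + 1 + n →
      φ₀ z = φ n z ∧ ψ₀ z = ψ n z := by
    intro n z hz h
    constructor
    · refine Tendsto.limUnder_eq (tendsto_const_nhds.congr' ?_)
      filter_upwards [eventually_ge_atTop n] with m hm
      exact (hcons n m hm z hz h).1
    · refine Tendsto.limUnder_eq (tendsto_const_nhds.congr' ?_)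
      filter_upwards [eventually_ge_atTop n] with m hm
      exact (hcons n m hm z hz h).2
  have hex : ∀ x t, t < T x → ∃ n, t < τ n x := fun x t ht => exists_lt_of_lt_ciSup ht
  refine ⟨T, τ, φ₀, ψ₀, ?_⟩
  exact
    { pos := fun x => (hτ0 0 x).trans (hτT 0 x)
      le := fun x => ciSup_le fun n => (hτ1 n x).le
      lipschitz := habs T hTlip
      level_pos := hτ0
      level_lt := hτT
      level_eq := fun n x => by
        obtain ⟨h1, h2⟩ := heq n (x, τ n x) (hτ0 n x).le (hτn n x).le
        rw [h1, h2, hτn]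
      level_lipschitz := fun n => habs (τ n) (hlip n)
      level_le := fun n x t ht ht' => by
        obtain ⟨m, hm⟩ := hex x t ht'
        have ht0 : 0 ≤ t := (hτ0 n x).le.trans ht
        have hnm : n ≤ m := by
          by_contra h
          push Not at h
          linarith [hstrict m n h x]
        obtain ⟨h1, h2⟩ := heq m (x, t) ht0 ((hlt_iff m x t ht0).2 hm).le
        obtain ⟨h3, h4⟩ := hcons n m hnm (x, τ n x) (hτ0 n x).le (hτn n x).le
        rw [h1, h2, ← hτn n x, h3, h4]
        exact (H.strictMonoOn_time (hlev m) (S m) x).monotoneOn (hτ0 n x).le ht0 ht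
      local_eq := fun z hz hzT => by
        obtain ⟨n, hn⟩ := hex z.1 z.2 hzT
        have h1 := (hlt_iff n z.1 z.2 hz).2 hn
        refine ⟨2 * B + 1 + n, φ n, ψ n, q n, r n, hlev n, S n, h1, ?_⟩
        have h2 : ∀ᶠ y in 𝓝 z, φ n y + ψ n y < 2 * B + 1 + n :=
          (S n).continuous_sum.continuousAt.eventually_lt continuousAt_const h1
        filter_upwards [h2] with y hy hy0
        exact heq n y hy0 hy.le }

end AdmissibleData

end DampedWave
end

/-! ### Pointwise estimates below the curve and the blow-up rate -/

noncomputable section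

namespace DampedWave

/-- The derivative of the source term in `w`, for positive `w`. -/
def sourceSlope (p μ t w : ℝ) : ℝ := p * (2:ℝ) ^ (-p) * w ^ (p - 1) - μ / (1 + t) / 2

theorem truncSlope_eq {p μ γ n t w : ℝ} (ht : 0 ≤ t) (h1 : γ ≤ w) (h2 : w ≤ n) :
    truncSlope p μ γ n t w = sourceSlope p μ t w := by
  rw [truncSlope, sourceSlope, powSlope_eq h1 h2, damp_of_nonneg μ ht]

theorem dx_congr {F F' : ℝ × ℝ → ℝ} {z : ℝ × ℝ} (h : F =ᶠ[𝓝 z] F') : dx F z = dx F' z := by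
  unfold dx
  rw [h.fderiv_eq]

theorem dt_congr {F F' : ℝ × ℝ → ℝ} {z : ℝ × ℝ} (h : F =ᶠ[𝓝 z] F') : dt F z = dt F' z := by
  unfold dt
  rw [h.fderiv_eq]

theorem dx_eventuallyEq {F F' : ℝ × ℝ → ℝ} {z : ℝ × ℝ} (h : F =ᶠ[𝓝 z] F') :
    dx F =ᶠ[𝓝 z] dx F' := by
  filter_upwards [h.eventuallyEq_nhds] with y hy
  exact dx_congr hy

theorem dt_eventuallyEq {F F' : ℝ × ℝ → ℝ} {z : ℝ × ℝ} (h : F =ᶠ[𝓝 z] F') :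
    dt F =ᶠ[𝓝 z] dt F' := by
  filter_upwards [h.eventuallyEq_nhds] with y hy
  exact dt_congr hy

/-- The pointwise properties of the solution below the blow-up curve. -/
structure IsRegularPoint (p μ γ₁ γ₂ k : ℝ) (φ ψ : ℝ × ℝ → ℝ) (z : ℝ × ℝ) : Prop where
  contDiffAt_left : ContDiffAt ℝ 1 φ z
  contDiffAt_right : ContDiffAt ℝ 1 ψ z
  lower_left : γ₁ ≤ φ z
  lower_right : γ₂ ≤ ψ z
  eq_left : dt φ z - dx φ z = source μ p z.2 (φ z + ψ z)
  eq_right : dt ψ z + dx ψ z = source μ p z.2 (φ z + ψ z)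
  slope_left : k * |dx φ z| ≤ dt φ z
  slope_right : k * |dx ψ z| ≤ dt ψ z
  continuousAt_dx_left : ContinuousAt (dx φ) z
  continuousAt_dx_right : ContinuousAt (dx ψ) z
  continuousAt_dt_left : ContinuousAt (dt φ) z
  continuousAt_dt_right : ContinuousAt (dt ψ) z
  dx_left : HasLineDerivAt ℝ (dx φ) (sourceSlope p μ z.2 (φ z + ψ z) * (dx φ z + dx ψ z)) z (-1, 1)
  dx_right : HasLineDerivAt ℝ (dx ψ) (sourceSlope p μ z.2 (φ z + ψ z) * (dx φ z + dx ψ z)) z (1, 1)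
  dt_left : HasLineDerivAt ℝ (dt φ) (μ / (1 + z.2) ^ 2 * ((φ z + ψ z) / 2) +
    sourceSlope p μ z.2 (φ z + ψ z) * (dt φ z + dt ψ z)) z (-1, 1)
  dt_right : HasLineDerivAt ℝ (dt ψ) (μ / (1 + z.2) ^ 2 * ((φ z + ψ z) / 2) +
    sourceSlope p μ z.2 (φ z + ψ z) * (dt φ z + dt ψ z)) z (1, 1)

variable {p μ γ₁ γ₂ k B C T₁ : ℝ} {f g f' g' T : ℝ → ℝ} {τ : ℕ → ℝ → ℝ} {φ ψ : ℝ × ℝ → ℝ}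

theorem continuous_dx {F : ℝ × ℝ → ℝ} (h : ContDiff ℝ 1 F) : Continuous (dx F) :=
  (h.continuous_fderiv (by norm_num)).clm_apply continuous_const

theorem continuous_dt {F : ℝ × ℝ → ℝ} (h : ContDiff ℝ 1 F) : Continuous (dt F) :=
  (h.continuous_fderiv (by norm_num)).clm_apply continuous_const

namespace IsBlowUpProfile

/-- Near `z` the solution coincides with a truncated one whose sum is below the truncation level at
`z`, so the truncated source and slope take their original values there. -/
theorem isRegularPoint (P : IsBlowUpProfile p μ γ₁ γ₂ k B T₁ f g f' g' T τ φ ψ)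
    (H : AdmissibleData p μ γ₁ γ₂ k B C f g f' g') {z : ℝ × ℝ} (hz : 0 < z.2)
    (hzT : z.2 < T z.1) : IsRegularPoint p μ γ₁ γ₂ k φ ψ z := by
  obtain ⟨n, φ', ψ', q, r, hn, S, hlt, hev⟩ := P.local_eq z hz.le hzT
  have hpos : ∀ᶠ y : ℝ × ℝ in 𝓝 z, 0 < y.2 := continuousAt_snd.eventually_const_lt hz
  have e1 : φ =ᶠ[𝓝 z] φ' := by
    filter_upwards [hev, hpos] with y hy hy0 using (hy hy0.le).1
  have e2 : ψ =ᶠ[𝓝 z] ψ' := by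
    filter_upwards [hev, hpos] with y hy hy0 using (hy hy0.le).2
  have x1 := dx_eventuallyEq e1
  have x2 := dx_eventuallyEq e2
  have t1 := dt_eventuallyEq e1
  have t2 := dt_eventuallyEq e2
  have hlow := H.lower_bound hn S hz.le
  have hw : γ₁ + γ₂ ≤ φ' z + ψ' z := by linarith
  have hsrc := truncSource_eq (μ := μ) H.hp H.γ_pos hz.le hw hlt.le
  have hslope := truncSlope_eq (p := p) (μ := μ) hz.le hw hlt.le
  have hb := H.slope_bound hn S hz.le
  have hcomb := H.char_combination S hz 0
  have hqx := S.dx_left_eq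
  have hrx := S.dx_right_eq
  have hqt := S.dt_left_eq
  have hrt := S.dt_right_eq
  have hqc := S.q_char z
  have hrc := S.r_char z
  rw [hslope] at hqc hrc hcomb
  refine ⟨S.contDiff_left.contDiffAt.congr_of_eventuallyEq e1,
    S.contDiff_right.contDiffAt.congr_of_eventuallyEq e2, ?_, ?_, ?_, ?_, ?_, ?_,
    (continuous_dx S.contDiff_left).continuousAt.congr x1.symm,
    (continuous_dx S.contDiff_right).continuousAt.congr x2.symm,
    (continuous_dt S.contDiff_left).continuousAt.congr t1.symm,
    (continuous_dt S.contDiff_right).continuousAt.congr t2.symm, ?_, ?_, ?_, ?_⟩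
  · rw [e1.self_of_nhds]; exact hlow.1
  · rw [e2.self_of_nhds]; exact hlow.2
  · rw [x1.self_of_nhds, t1.self_of_nhds, e1.self_of_nhds, e2.self_of_nhds, hqx, hqt, ← hsrc]
    ring
  · rw [x2.self_of_nhds, t2.self_of_nhds, e1.self_of_nhds, e2.self_of_nhds, hrx, hrt, ← hsrc]
    ring
  · rw [x1.self_of_nhds, t1.self_of_nhds]; exact hb.1
  · rw [x2.self_of_nhds, t2.self_of_nhds]; exact hb.2
  · rw [x1.self_of_nhds, x2.self_of_nhds, e1.self_of_nhds, e2.self_of_nhds, hqx, hrx]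
    rw [hqx] at x1
    exact hqc.congr_of_eventuallyEq x1
  · rw [x1.self_of_nhds, x2.self_of_nhds, e1.self_of_nhds, e2.self_of_nhds, hqx, hrx]
    rw [hrx] at x2
    exact hrc.congr_of_eventuallyEq x2
  · rw [t1.self_of_nhds, t2.self_of_nhds, e1.self_of_nhds, e2.self_of_nhds, hqt, hrt]
    rw [hqt] at t1
    have h1 := hcomb.1.congr_of_eventuallyEq (t1.trans (Filter.Eventually.of_forall fun y => by
      simp only; ring))
    refine (h1.congr_deriv ?_ : HasDerivAt _ _ _)
    ring
  · rw [t1.self_of_nhds, t2.self_of_nhds, e1.self_of_nhds, e2.self_of_nhds, hqt, hrt]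
    rw [hrt] at t2
    have h1 := hcomb.2.congr_of_eventuallyEq (t2.trans (Filter.Eventually.of_forall fun y => by
      simp only; ring))
    refine (h1.congr_deriv ?_ : HasDerivAt _ _ _)
    ring

end IsBlowUpProfile

namespace IsRegularPoint

variable {z : ℝ × ℝ}

/-- Since `μ ≤ 2⁻ᵖ w ^ (p - 1)` for all attained sums `w`, the damping consumes at most half of the
power term, and likewise for the derivatives. -/
theorem source_bounds (Q : IsRegularPoint p μ γ₁ γ₂ k φ ψ z)
    (H : AdmissibleData p μ γ₁ γ₂ k B C f g f' g') (hz : 0 < z.2) :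
    (2:ℝ) ^ (-p) * (φ z + ψ z) ^ p / 2 ≤ source μ p z.2 (φ z + ψ z) ∧
    source μ p z.2 (φ z + ψ z) ≤ (2:ℝ) ^ (-p) * (φ z + ψ z) ^ p ∧
    p * ((2:ℝ) ^ (-p) * (φ z + ψ z) ^ (p - 1)) / 2 ≤ sourceSlope p μ z.2 (φ z + ψ z) ∧
    sourceSlope p μ z.2 (φ z + ψ z) ≤ p * ((2:ℝ) ^ (-p) * (φ z + ψ z) ^ (p - 1)) := by
  have hw : γ₁ + γ₂ ≤ φ z + ψ z := add_le_add Q.lower_left Q.lower_right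
  have hw0 : 0 < φ z + ψ z := H.γ_pos.trans_le hw
  have hY := H.pow_ge hw
  set w := φ z + ψ z
  have hp := H.hp
  have hμ := H.hμ
  have hX : (2:ℝ) ^ (-p) * w ^ p = (2:ℝ) ^ (-p) * w ^ (p - 1) * w := by
    rw [mul_assoc, ← Real.rpow_add_one hw0.ne']; simp
  have hm1 : μ / (1 + z.2) ≤ μ := div_le_self hμ.le (by linarith)
  have hm0 : 0 < μ / (1 + z.2) := by positivity
  unfold source sourceSlope
  rw [abs_of_pos hw0, hX]
  set Y := (2:ℝ) ^ (-p) * w ^ (p - 1)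
  set m := μ / (1 + z.2)
  have hmY : m ≤ Y := by nlinarith
  have h1 : m * w ≤ Y * w := mul_le_mul_of_nonneg_right hmY hw0.le
  have h2 : 0 < m * w := mul_pos hm0 hw0
  have e : p * (2:ℝ) ^ (-p) * w ^ (p - 1) = p * Y := by simp only [Y]; ring
  rw [e]
  refine ⟨by linarith, by linarith, ?_, by linarith⟩
  nlinarith

/-- From `∂ₜφ - ∂ₓφ = F` and `|∂ₓφ| ≤ ∂ₜφ / k` with `k > 1`, the time derivative lies between `F /
2` and `F / (1 - 1 / k)`; similarly for `ψ`. -/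
theorem time_bounds (Q : IsRegularPoint p μ γ₁ γ₂ k φ ψ z)
    (H : AdmissibleData p μ γ₁ γ₂ k B C f g f' g') :
    source μ p z.2 (φ z + ψ z) / 2 ≤ dt φ z ∧ source μ p z.2 (φ z + ψ z) / 2 ≤ dt ψ z ∧
    dt φ z ≤ k / (k - 1) * source μ p z.2 (φ z + ψ z) ∧
    dt ψ z ≤ k / (k - 1) * source μ p z.2 (φ z + ψ z) := by
  have hk := H.hk
  have h1 := Q.eq_left
  have h2 := Q.eq_right
  have h3 := Q.slope_left
  have h4 := Q.slope_right
  have h5 := neg_abs_le (dx φ z)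
  have h6 := le_abs_self (dx φ z)
  have h7 := neg_abs_le (dx ψ z)
  have h8 := le_abs_self (dx ψ z)
  have h9 := abs_nonneg (dx φ z)
  have h10 := abs_nonneg (dx ψ z)
  refine ⟨by nlinarith, by nlinarith, ?_, ?_⟩
  · rw [div_mul_eq_mul_div, le_div_iff₀ (by linarith)]
    nlinarith
  · rw [div_mul_eq_mul_div, le_div_iff₀ (by linarith)]
    nlinarith

theorem source_pos (Q : IsRegularPoint p μ γ₁ γ₂ k φ ψ z)
    (H : AdmissibleData p μ γ₁ γ₂ k B C f g f' g') (hz : 0 < z.2) :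
    0 < source μ p z.2 (φ z + ψ z) := by
  refine lt_of_lt_of_le ?_ (Q.source_bounds H hz).1
  have : 0 < φ z + ψ z := by linarith [Q.lower_left, Q.lower_right, H.γ_pos]
  positivity

theorem hasDerivAt_time (Q : IsRegularPoint p μ γ₁ γ₂ k φ ψ z) :
    HasDerivAt (fun t => φ (z.1, t) + ψ (z.1, t)) (dt φ z + dt ψ z) z.2 := by
  have h1 := hasLineDerivAt_add
    (hasLineDerivAt_of_differentiableAt (Q.contDiffAt_left.differentiableAt (by norm_num)) 0 1)
    (hasLineDerivAt_of_differentiableAt (Q.contDiffAt_right.differentiableAt (by norm_num)) 0 1)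
  have h2 : HasDerivAt _ _ _ := h1
  have h3 : HasDerivAt (fun u : ℝ => u - z.2) 1 z.2 := (hasDerivAt_id z.2).sub_const z.2
  have h4 := HasDerivAt.comp z.2 (h₂ := fun s : ℝ => φ (z + s • (0, 1)) +
    ψ (z + s • (0, 1))) (by simpa using h2) h3
  refine (h4.congr_deriv (by ring)).congr_of_eventuallyEq (Filter.Eventually.of_forall ?_)
  intro u
  have : z + (u - z.2) • ((0, 1) : ℝ × ℝ) = (z.1, u) := by ext <;> simp
  simp only [Function.comp, this]

/-- The quotients of space and time derivatives are transported along the characteristics, with an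
exchange term. -/
theorem ratio_char (Q : IsRegularPoint p μ γ₁ γ₂ k φ ψ z)
    (H : AdmissibleData p μ γ₁ γ₂ k B C f g f' g') (hz : 0 < z.2) :
    HasLineDerivAt ℝ (fun z => dx φ z / dt φ z)
      (sourceSlope p μ z.2 (φ z + ψ z) * (dt ψ z / dt φ z) * (dx ψ z / dt ψ z - dx φ z / dt φ z) -
        μ / (1 + z.2) ^ 2 * ((φ z + ψ z) / 2) / dt φ z * (dx φ z / dt φ z)) z (-1, 1) ∧
    HasLineDerivAt ℝ (fun z => dx ψ z / dt ψ z)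
      (sourceSlope p μ z.2 (φ z + ψ z) * (dt φ z / dt ψ z) * (dx φ z / dt φ z - dx ψ z / dt ψ z) -
        μ / (1 + z.2) ^ 2 * ((φ z + ψ z) / 2) / dt ψ z * (dx ψ z / dt ψ z)) z (1, 1) := by
  have h0 := Q.source_pos H hz
  obtain ⟨h1, h2, -, -⟩ := Q.time_bounds H
  have hP1 : dt φ z ≠ 0 := by linarith
  have hP2 : dt ψ z ≠ 0 := by linarith
  constructor
  · have hx : HasDerivAt _ _ _ := Q.dx_left
    have ht : HasDerivAt _ _ _ := Q.dt_left
    have := hx.fun_div ht (by simpa using hP1)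
    refine (this.congr_deriv ?_ : HasDerivAt _ _ _)
    simp only [zero_smul, add_zero]
    field_simp
    ring
  · have hx : HasDerivAt _ _ _ := Q.dx_right
    have ht : HasDerivAt _ _ _ := Q.dt_right
    have := hx.fun_div ht (by simpa using hP2)
    refine (this.congr_deriv ?_ : HasDerivAt _ _ _)
    simp only [zero_smul, add_zero]
    field_simp
    ring

end IsRegularPoint

namespace IsBlowUpProfile

/-- The blow-up rate of `φ + ψ`. -/
theorem rate (P : IsBlowUpProfile p μ γ₁ γ₂ k B T₁ f g f' g' T τ φ ψ)
    (H : AdmissibleData p μ γ₁ γ₂ k B C f g f' g') {x t : ℝ} (ht : 0 < t) (htT : t < T x) :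
    (p - 1) * (2:ℝ) ^ (-p) / 2 * (T x - t) ≤ (φ (x, t) + ψ (x, t)) ^ (1 - p) ∧
    (φ (x, t) + ψ (x, t)) ^ (1 - p) ≤ 2 * (k / (k - 1)) * ((p - 1) * (2:ℝ) ^ (-p)) * (T x - t) := by
  -- As `∂ₜw` is comparable with `w ^ p` for `w = φ + ψ`, the derivative of `w ^ (1 - p)` lies
  -- between two negative constants. Integration up to the curve, where this function vanishes,
  -- gives the rate.
  set y : ℝ → ℝ := fun s => (φ (x, s) + ψ (x, s)) ^ (1 - p) with hy
  have hp := H.hp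
  have hk := H.hk
  set b := (p - 1) * (2:ℝ) ^ (-p) with hb
  have hb0 : 0 < b := mul_pos (by linarith) (by positivity)
  have hQ : ∀ s ∈ Ioo 0 (T x), IsRegularPoint p μ γ₁ γ₂ k φ ψ (x, s) := fun s hs =>
    P.isRegularPoint H hs.1 hs.2
  have hpos : ∀ s ∈ Ioo 0 (T x), 0 < φ (x, s) + ψ (x, s) := fun s hs => by
    linarith [(hQ s hs).lower_left, (hQ s hs).lower_right, H.γ_pos]
  have hder : ∀ s ∈ Ioo 0 (T x), ∃ d, HasDerivAt y d s ∧ -(2 * (k / (k - 1)) * b) ≤ d ∧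
      d ≤ -(b / 2) := by
    intro s hs
    have h1 := (hQ s hs).hasDerivAt_time
    have hw := hpos s hs
    have h2 := h1.rpow_const (p := 1 - p) (Or.inl hw.ne')
    refine ⟨_, h2, ?_⟩
    obtain ⟨s1, s2, -, -⟩ := (hQ s hs).source_bounds H hs.1
    obtain ⟨d1, d2, d3, d4⟩ := (hQ s hs).time_bounds H
    simp only at s1 s2 d1 d2 d3 d4 ⊢
    set w := φ (x, s) + ψ (x, s)
    set W := dt φ (x, s) + dt ψ (x, s)
    have e1 : w ^ (1 - p - 1) = (w ^ p)⁻¹ := by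
      rw [← Real.rpow_neg hw.le]; congr 1; ring
    have hwp : 0 < w ^ p := Real.rpow_pos_of_pos hw p
    have e2 : W * (1 - p) * w ^ (1 - p - 1) = -((p - 1) * (W / w ^ p)) := by
      rw [e1, div_eq_mul_inv]; ring
    have h3 : (2:ℝ) ^ (-p) / 2 ≤ W / w ^ p := by
      rw [le_div_iff₀ hwp]; simp only [W]; linarith
    have hκ : 0 ≤ k / (k - 1) := div_nonneg (by linarith) (by linarith)
    have h4 : W / w ^ p ≤ 2 * (k / (k - 1)) * (2:ℝ) ^ (-p) := by
      rw [div_le_iff₀ hwp]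
      have := mul_le_mul_of_nonneg_left s2 hκ
      simp only [W]; linarith
    have hp1 : 0 ≤ p - 1 := by linarith
    have h5 := mul_le_mul_of_nonneg_left h3 hp1
    have h6 := mul_le_mul_of_nonneg_left h4 hp1
    rw [e2, hb]
    constructor <;> linarith
  -- The limit at the curve is taken along the level times, where the value is known exactly.
  have hyn : ∀ n : ℕ, y (τ n x) = (2 * B + 1 + n) ^ (1 - p) := fun n => by
    simp only [hy, P.level_eq]
  have hlim : Tendsto (fun n : ℕ => y (τ n x)) atTop (𝓝 0) := by
    have h1 : Tendsto (fun n : ℕ => 2 * B + 1 + (n:ℝ)) atTop atTop :=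
      tendsto_atTop_add_const_left _ _ tendsto_natCast_atTop_atTop
    have h2 := (tendsto_rpow_neg_atTop (by linarith : 0 < p - 1)).comp h1
    refine h2.congr fun n => ?_
    rw [hyn]
    simp only [Function.comp]
    congr 1
    ring
  have hder' : ∀ s ∈ Ioo 0 (T x), DifferentiableAt ℝ y s := fun s hs => by
    obtain ⟨d, hd, -⟩ := hder s hs
    exact hd.differentiableAt
  have hevlt : ∀ᶠ n : ℕ in atTop, t ≤ τ n x := by
    obtain ⟨n, hn⟩ := exists_nat_gt (φ (x, t) + ψ (x, t) - 2 * B - 1)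
    filter_upwards [eventually_ge_atTop n] with m hm
    by_contra h
    push Not at h
    have h1 := P.level_le m x t h.le htT
    have : (n:ℝ) ≤ m := Nat.cast_le.2 hm
    linarith
  have hτ : Tendsto (fun n => τ n x) atTop (𝓝 (T x)) := by
    refine tendsto_order.2 ⟨fun s hs => ?_, fun s hs =>
      Filter.Eventually.of_forall fun n => (P.level_lt n x).trans hs⟩
    set s' := max s (T x / 2)
    have hs' : s' ∈ Ioo 0 (T x) := by
      have := P.pos x
      exact ⟨lt_max_of_lt_right (by linarith), max_lt hs (by linarith)⟩
    obtain ⟨n, hn⟩ := exists_nat_gt (φ (x, s') + ψ (x, s') - 2 * B - 1)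
    filter_upwards [eventually_ge_atTop n] with m hm
    refine (le_max_left s (T x / 2)).trans_lt ?_
    by_contra h
    push Not at h
    have h1 := P.level_le m x s' h hs'.2
    have : (n:ℝ) ≤ m := Nat.cast_le.2 hm
    linarith
  have hmem : ∀ n, t ≤ τ n x → Icc t (τ n x) ⊆ Ioo 0 (T x) := fun n _ s hs =>
    ⟨ht.trans_le hs.1, hs.2.trans_lt (P.level_lt n x)⟩
  constructor
  · have hkey : ∀ᶠ n : ℕ in atTop, y (τ n x) + b / 2 * (τ n x - t) ≤ y t := by
      filter_upwards [hevlt] with n hn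
      have hanti : AntitoneOn (fun s => y s + b / 2 * s) (Icc t (τ n x)) := by
        refine antitoneOn_of_deriv_nonpos (convex_Icc _ _) (fun s hs => ?_) (fun s hs => ?_)
          fun s hs => ?_
        · exact ((hder' s (hmem n hn hs)).add (by fun_prop)).continuousAt.continuousWithinAt
        · exact ((hder' s (hmem n hn (interior_subset hs))).add
            (by fun_prop)).differentiableWithinAt
        · obtain ⟨d, hd, -, hd2⟩ := hder s (hmem n hn (interior_subset hs))
          have := hd.fun_add ((hasDerivAt_id s).const_mul (b / 2))
          simp only [id] at this
          rw [this.deriv]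
          linarith
      have := hanti (left_mem_Icc.2 hn) (right_mem_Icc.2 hn) hn
      simp only at this
      linarith
    have hlim2 := hlim.add ((hτ.sub_const t).const_mul (b / 2))
    rw [zero_add] at hlim2
    exact le_of_tendsto hlim2 hkey
  · have hkey : ∀ᶠ n : ℕ in atTop,
        y t ≤ y (τ n x) + 2 * (k / (k - 1)) * b * (τ n x - t) := by
      filter_upwards [hevlt] with n hn
      have hmono : MonotoneOn (fun s => y s + 2 * (k / (k - 1)) * b * s) (Icc t (τ n x)) := by
        refine monotoneOn_of_deriv_nonneg (convex_Icc _ _) (fun s hs => ?_) (fun s hs => ?_)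
          fun s hs => ?_
        · exact ((hder' s (hmem n hn hs)).add (by fun_prop)).continuousAt.continuousWithinAt
        · exact ((hder' s (hmem n hn (interior_subset hs))).add
            (by fun_prop)).differentiableWithinAt
        · obtain ⟨d, hd, hd1, -⟩ := hder s (hmem n hn (interior_subset hs))
          have := hd.fun_add ((hasDerivAt_id s).const_mul (2 * (k / (k - 1)) * b))
          simp only [id] at this
          rw [this.deriv]
          linarith
      have := hmono (left_mem_Icc.2 hn) (right_mem_Icc.2 hn) hn
      simp only at this
      linarith
    have hlim2 := hlim.add ((hτ.sub_const t).const_mul (2 * (k / (k - 1)) * b))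
    rw [zero_add] at hlim2
    exact ge_of_tendsto hlim2 hkey

end IsBlowUpProfile

end DampedWave
end

/-! ### A lower bound of Harnack type for the exchange system -/

noncomputable section

namespace DampedWave

/-- The open backward cone with apex `(x₀, T₀)`, truncated at the time `t₀`. -/
def openCone (x₀ T₀ t₀ : ℝ) : Set (ℝ × ℝ) := {z | t₀ ≤ z.2 ∧ |z.1 - x₀| < T₀ - z.2}

theorem closedCone_subset_openCone {x₀ T₀ t₀ s : ℝ} (hs : t₀ ≤ s) {z : ℝ × ℝ}
    (hz : z ∈ openCone x₀ T₀ t₀) : closedCone s z ⊆ openCone x₀ T₀ t₀ := by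
  rintro y ⟨h1, h2⟩
  have := abs_sub_le y.1 z.1 x₀
  exact ⟨hs.trans h1, by linarith [hz.2]⟩

/-- At `z`, the pair `(ρ, σ)` is a supersolution of the exchange system
`D₋ρ = A (σ - ρ)`, `D₊σ = A' (ρ - σ)` with rates comparable to `1 / (T₀ - t)`. -/
structure IsExchangeSuperAt (a Λ T₀ : ℝ) (ρ σ : ℝ × ℝ → ℝ) (z : ℝ × ℝ) : Prop where
  continuousAt_left : ContinuousAt ρ z
  continuousAt_right : ContinuousAt σ z
  left : ∃ A v, a / (T₀ - z.2) ≤ A ∧ A ≤ Λ / (T₀ - z.2) ∧ A * (σ z - ρ z) ≤ v ∧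
    HasLineDerivAt ℝ ρ v z (-1, 1)
  right : ∃ A v, a / (T₀ - z.2) ≤ A ∧ A ≤ Λ / (T₀ - z.2) ∧ A * (ρ z - σ z) ≤ v ∧
    HasLineDerivAt ℝ σ v z (1, 1)

theorem hasLineDerivAt_add_time {u : ℝ × ℝ → ℝ} {v c : ℝ} {z : ℝ × ℝ}
    (h : HasLineDerivAt ℝ u v z (c, 1)) (m ε t₀ : ℝ) :
    HasLineDerivAt ℝ (fun z => u z - m + ε * (z.2 - t₀)) (v + ε) z (c, 1) := by
  have h1 : HasDerivAt (fun s : ℝ => (z + s • ((c, 1) : ℝ × ℝ)).2) 1 0 := by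
    simpa using (hasDerivAt_id (0:ℝ)).const_add z.2
  have h2 : HasDerivAt _ _ _ := hasLineDerivAt_sub_const h m
  have h3 := h2.fun_add ((h1.sub_const t₀).const_mul ε)
  rw [mul_one] at h3
  exact h3

/-- Exchange pushes the smaller component towards the larger one, so a common lower bound persists.
Only the sign of the rates matters, not their growth at the apex; the term `ε (t - s)` makes the
inequality strict. -/
theorem exchange_min_principle {a Λ x₀ T₀ t₀ s m : ℝ} {ρ σ : ℝ × ℝ → ℝ} (ha : 0 < a) (hs : t₀ ≤ s)
    (h : ∀ z ∈ openCone x₀ T₀ t₀, IsExchangeSuperAt a Λ T₀ ρ σ z)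
    (h₀ : ∀ z ∈ openCone x₀ T₀ t₀, z.2 = s → m ≤ ρ z ∧ m ≤ σ z) :
    ∀ z ∈ openCone x₀ T₀ t₀, s ≤ z.2 → m ≤ ρ z ∧ m ≤ σ z := by
  intro z hz hzs
  have hsub := closedCone_subset_openCone hs hz
  have hpos : ∀ y ∈ openCone x₀ T₀ t₀, ∀ A, a / (T₀ - y.2) ≤ A → 0 < A := fun y hy A hA =>
    lt_of_lt_of_le (div_pos ha ((abs_nonneg _).trans_lt hy.2)) hA
  have key : ∀ ε > 0, 0 ≤ ρ z - m + ε * (z.2 - s) ∧ 0 ≤ σ z - m + ε * (z.2 - s) := by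
    intro ε hε
    refine nonneg_of_lineDeriv_pos (t₀ := s) (z₁ := z) (a := fun z => ρ z - m + ε * (z.2 - s))
      (b := fun z => σ z - m + ε * (z.2 - s)) ?_ ?_ ?_ ?_ ?_ ?_ z (apex_mem_closedCone hzs)
    · intro y hy
      have := (h y (hsub hy)).continuousAt_left
      exact ContinuousAt.continuousWithinAt (by fun_prop)
    · intro y hy
      have := (h y (hsub hy)).continuousAt_right
      exact ContinuousAt.continuousWithinAt (by fun_prop)
    · intro y hy hys
      have := (h₀ y (hsub hy) hys).1
      simp only [hys, sub_self, mul_zero]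
      linarith
    · intro y hy hys
      have := (h₀ y (hsub hy) hys).2
      simp only [hys, sub_self, mul_zero]
      linarith
    · intro y hy hys _ hle
      obtain ⟨A, v, hA, -, hv, hd⟩ := (h y (hsub hy)).left
      refine ⟨v + ε, ?_, hasLineDerivAt_add_time hd m ε s⟩
      have h1 : 0 ≤ A * (σ y - ρ y) := mul_nonneg (hpos y (hsub hy) A hA).le (by linarith)
      linarith
    · intro y hy hys _ hle
      obtain ⟨A, v, hA, -, hv, hd⟩ := (h y (hsub hy)).right
      refine ⟨v + ε, ?_, hasLineDerivAt_add_time hd m ε s⟩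
      have h1 : 0 ≤ A * (ρ y - σ y) := mul_nonneg (hpos y (hsub hy) A hA).le (by linarith)
      linarith
  have hlim : ∀ c d : ℝ, (∀ ε > 0, 0 ≤ c + ε * d) → 0 ≤ c := by
    intro c d hcd
    have h1 : Tendsto (fun ε : ℝ => c + ε * d) (𝓝[>] 0) (𝓝 (c + 0 * d)) :=
      (by fun_prop : Continuous fun ε : ℝ => c + ε * d).continuousWithinAt
    rw [zero_mul, add_zero] at h1
    exact ge_of_tendsto h1 (by filter_upwards [self_mem_nhdsWithin] with ε hε using hcd ε hε)
  have h1 := hlim _ _ fun ε hε => (key ε hε).1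
  have h2 := hlim _ _ fun ε hε => (key ε hε).2
  constructor <;> linarith

/-- The integrating factor `exp (L (s - s₀))` shows that whatever is received from the partner at
rate `α` survives up to the factor `exp (-L (s₁ - s₀))`. -/
theorem gain_along_char {u u' γ : ℝ → ℝ} {α L s₀ s₁ : ℝ} (hs : s₀ ≤ s₁) (hL : 0 ≤ L) (hα : 0 ≤ α)
    (hγ : ContinuousOn γ (Icc s₀ s₁)) (hγ0 : ∀ s ∈ Icc s₀ s₁, 0 ≤ γ s)
    (hu : ∀ s ∈ Icc s₀ s₁, HasDerivAt u (u' s) s)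
    (h : ∀ s ∈ Icc s₀ s₁, α * γ s - L * u s ≤ u' s) :
    Real.exp (-(L * (s₁ - s₀))) * (u s₀ + α * ∫ s in s₀..s₁, γ s) ≤ u s₁ := by
  have hexp : ∀ s : ℝ, HasDerivAt (fun s => Real.exp (L * (s - s₀)))
      (Real.exp (L * (s - s₀)) * L) s := fun s => by
    have := (((hasDerivAt_id s).sub_const s₀).const_mul L).exp
    simpa using this
  have h1 := intervalIntegral.integral_le_sub_of_hasDeriv_right_of_le (a := s₀) (b := s₁)
    (g := fun s => Real.exp (L * (s - s₀)) * u s)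
    (g' := fun s => Real.exp (L * (s - s₀)) * L * u s + Real.exp (L * (s - s₀)) * u' s)
    (φ := fun s => α * γ s) hs
    (fun s hs => ((hexp s).mul (hu s hs)).continuousAt.continuousWithinAt)
    (fun s hs => ((hexp s).mul (hu s (Ioo_subset_Icc_self hs))).hasDerivWithinAt)
    ((continuousOn_const.mul hγ).integrableOn_Icc)
    (fun s hs => by
      have h2 := h s (Ioo_subset_Icc_self hs)
      have h3 := mul_nonneg hα (hγ0 s (Ioo_subset_Icc_self hs))
      have h4 : 1 ≤ Real.exp (L * (s - s₀)) :=
        Real.one_le_exp (mul_nonneg hL (by linarith [hs.1]))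
      have h5 : Real.exp (L * (s - s₀)) * (α * γ s) ≤
          Real.exp (L * (s - s₀)) * (L * u s + u' s) :=
        mul_le_mul_of_nonneg_left (by linarith) (by linarith)
      have h6 := le_mul_of_one_le_left h3 h4
      linarith)
  rw [intervalIntegral.integral_const_mul] at h1
  simp only [sub_self, mul_zero, Real.exp_zero, one_mul] at h1
  have h2 : u s₀ + α * ∫ s in s₀..s₁, γ s ≤ Real.exp (L * (s₁ - s₀)) * u s₁ := by linarith
  have h3 := mul_le_mul_of_nonneg_left h2 (Real.exp_pos (-(L * (s₁ - s₀)))).le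
  rwa [← mul_assoc, ← Real.exp_add, neg_add_cancel, Real.exp_zero, one_mul] at h3

theorem hasDerivAt_along_char {u : ℝ × ℝ → ℝ} {v c x t s : ℝ}
    (h : HasLineDerivAt ℝ u v (x + c * (s - t), s) (c, 1)) :
    HasDerivAt (fun s => u (x + c * (s - t), s)) v s := by
  have h1 : HasDerivAt (fun r : ℝ => u ((x + c * (s - t), s) + r • ((c, 1) : ℝ × ℝ))) v 0 := h
  have h2 : HasDerivAt (fun r : ℝ => r - s) 1 s := (hasDerivAt_id s).sub_const s
  have h3 := HasDerivAt.comp s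
    (h₂ := fun r : ℝ => u ((x + c * (s - t), s) + r • ((c, 1) : ℝ × ℝ))) (by simpa using h1) h2
  refine (h3.congr_deriv (mul_one v)).congr_of_eventuallyEq (Filter.Eventually.of_forall ?_)
  intro r
  simp only [Function.comp, Prod.mk_add_mk, Prod.smul_mk, smul_eq_mul, mul_one]
  congr 2 <;> ring

/-- The constant in the lower bound for supersolutions of the exchange system. -/
def exchangeConst (a Λ : ℝ) : ℝ :=
  min (1 / 2) (a * Real.exp (-(8 * Λ)) ^ 2 / 2 * min 1 (a * Real.exp (-(8 * Λ)) / 8))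

theorem exchangeConst_pos {a Λ : ℝ} (ha : 0 < a) : 0 < exchangeConst a Λ := by
  unfold exchangeConst
  positivity

/-- A nonnegative supersolution of the exchange system is bounded below by its average over the
base of the cone. -/
theorem exchange_lower_bound {a Λ x₀ T₀ t₀ : ℝ} {ρ σ : ℝ × ℝ → ℝ} (ha : 0 < a) (hΛ : 0 < Λ)
    (ht₀ : t₀ < T₀) (h : ∀ z ∈ openCone x₀ T₀ t₀, IsExchangeSuperAt a Λ T₀ ρ σ z)
    (h₀ : ∀ z ∈ openCone x₀ T₀ t₀, z.2 = t₀ → 0 ≤ ρ z ∧ 0 ≤ σ z) :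
    ∀ z ∈ openCone x₀ T₀ t₀, T₀ - (T₀ - t₀) / 8 ≤ z.2 →
      exchangeConst a Λ / (T₀ - t₀) *
        (∫ y in (x₀ - (T₀ - t₀) / 2)..(x₀ + (T₀ - t₀) / 2), σ (y, t₀)) ≤ min (ρ z) (σ z) := by
  set d := T₀ - t₀ with hd
  have hd0 : 0 < d := by linarith
  set E := Real.exp (-(8 * Λ)) with hE
  have hE0 : 0 < E := Real.exp_pos _
  have hnn := exchange_min_principle ha le_rfl h h₀
  have hnonneg : ∀ z ∈ openCone x₀ T₀ t₀, 0 ≤ ρ z ∧ 0 ≤ σ z := fun z hz => hnn z hz hz.1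
  set J := ∫ y in (x₀ - d / 2)..(x₀ + d / 2), σ (y, t₀) with hJ
  have hbase : ∀ y, |y - x₀| < d → (y, t₀) ∈ openCone x₀ T₀ t₀ := fun y hy => ⟨le_rfl, hy⟩
  have hσbase : ContinuousOn (fun y => σ (y, t₀)) (Ioo (x₀ - d) (x₀ + d)) := fun y hy => by
    have h1 := (h (y, t₀) (hbase y (abs_lt.2 ⟨by linarith [hy.1], by linarith [hy.2]⟩))).continuousAt_right
    exact (h1.comp (f := fun y : ℝ => (y, t₀)) (by fun_prop)).continuousWithinAt
  have hJ0 : 0 ≤ J := by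
    refine intervalIntegral.integral_nonneg (by linarith) fun y hy => ?_
    exact (hnonneg _ (hbase y (abs_lt.2 ⟨by linarith [hy.1], by linarith [hy.2]⟩))).2
  -- rates up to the time `T₀ - d / 8`
  have hrate : ∀ (z : ℝ × ℝ) (A v x y : ℝ), z ∈ openCone x₀ T₀ t₀ → z.2 ≤ T₀ - d / 8 →
      a / (T₀ - z.2) ≤ A → A ≤ Λ / (T₀ - z.2) → 0 ≤ x → 0 ≤ y → A * (y - x) ≤ v →
      a / d * y - 8 * Λ / d * x ≤ v := by
    intro z A v x y hz hz8 hA hA' hx hy hv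
    have h1 : a / d ≤ a / (T₀ - z.2) :=
      div_le_div_of_nonneg_left ha.le (by linarith) (by linarith [hz.1])
    have h2 : Λ / (T₀ - z.2) ≤ 8 * Λ / d := by
      rw [div_le_div_iff₀ (by linarith) hd0]
      nlinarith
    have h3 := mul_le_mul_of_nonneg_right (h1.trans hA) hy
    have h4 := mul_le_mul_of_nonneg_right (hA'.trans h2) hx
    linarith
  -- Rates of at most `8 Λ / d`, acting during a time of at most `d`, cost a factor `E` that does
  -- not depend on `d`; this is the scale invariance of the estimate.
  have hexpE : ∀ s s' : ℝ, s' - s ≤ d → E ≤ Real.exp (-(8 * Λ / d * (s' - s))) := by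
    intro s s' hss
    rw [hE]
    apply Real.exp_le_exp.2
    have : 8 * Λ / d * (s' - s) ≤ 8 * Λ / d * d := mul_le_mul_of_nonneg_left hss (by positivity)
    rw [div_mul_cancel₀ _ hd0.ne'] at this
    linarith
  have hminus : ∀ z ∈ openCone x₀ T₀ t₀, z.2 ≤ T₀ - d / 8 → ∀ s, t₀ ≤ s → s ≤ z.2 →
      (∀ u ∈ Icc s z.2, (z.1 + -1 * (u - z.2), u) ∈ openCone x₀ T₀ t₀) := by
    intro z hz _ s hs _ u hu
    have h1 := abs_lt.1 hz.2
    exact ⟨hs.trans hu.1, abs_lt.2 ⟨by linarith [hu.2], by linarith [hu.2]⟩⟩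
  have hplus : ∀ z ∈ openCone x₀ T₀ t₀, z.2 ≤ T₀ - d / 8 → ∀ s, t₀ ≤ s → s ≤ z.2 →
      (∀ u ∈ Icc s z.2, (z.1 + 1 * (u - z.2), u) ∈ openCone x₀ T₀ t₀) := by
    intro z hz _ s hs _ u hu
    have h1 := abs_lt.1 hz.2
    exact ⟨hs.trans hu.1, abs_lt.2 ⟨by linarith [hu.2], by linarith [hu.2]⟩⟩
  have hgainρ : ∀ z ∈ openCone x₀ T₀ t₀, z.2 ≤ T₀ - d / 8 → ∀ s, t₀ ≤ s → s ≤ z.2 →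
      E * (a / d * ∫ u in s..z.2, σ (z.1 + -1 * (u - z.2), u)) ≤ ρ z := by
    intro z hz hz8 s hs hsz
    have hm := hminus z hz hz8 s hs hsz
    have hex : ∀ u ∈ Icc s z.2, ∃ v, a / d * σ (z.1 + -1 * (u - z.2), u) -
        8 * Λ / d * ρ (z.1 + -1 * (u - z.2), u) ≤ v ∧
        HasLineDerivAt ℝ ρ v (z.1 + -1 * (u - z.2), u) (-1, 1) := by
      intro u hu
      obtain ⟨A, v, hA, hA', hv, hdv⟩ := (h _ (hm u hu)).left
      exact ⟨v, hrate _ A v _ _ (hm u hu) (hu.2.trans hz8) hA hA' (hnonneg _ (hm u hu)).1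
        (hnonneg _ (hm u hu)).2 hv, hdv⟩
    choose! v hv hdv using hex
    have h1 := gain_along_char (u := fun u => ρ (z.1 + -1 * (u - z.2), u))
      (γ := fun u => σ (z.1 + -1 * (u - z.2), u)) (α := a / d) (L := 8 * Λ / d) hsz
      (by positivity) (by positivity)
      (fun u hu => ((h _ (hm u hu)).continuousAt_right.comp
        (f := fun u : ℝ => (z.1 + -1 * (u - z.2), u)) (by fun_prop)).continuousWithinAt)
      (fun u hu => (hnonneg _ (hm u hu)).2)
      (fun u hu => hasDerivAt_along_char (hdv u hu)) hv
    simp only [sub_self, mul_zero, add_zero, Prod.mk.eta] at h1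
    refine le_trans ?_ h1
    have h2 : 0 ≤ a / d * ∫ u in s..z.2, σ (z.1 + -1 * (u - z.2), u) :=
      mul_nonneg (by positivity) (intervalIntegral.integral_nonneg hsz
        fun u hu => (hnonneg _ (hm u hu)).2)
    refine mul_le_mul (hexpE s z.2 (by linarith)) ?_ h2 (Real.exp_pos _).le
    linarith [(hnonneg _ (hm s ⟨le_rfl, hsz⟩)).1]
  have hgainσ : ∀ z ∈ openCone x₀ T₀ t₀, z.2 ≤ T₀ - d / 8 → ∀ s, t₀ ≤ s → s ≤ z.2 →
      E * (σ (z.1 + 1 * (s - z.2), s) + a / d * ∫ u in s..z.2, ρ (z.1 + 1 * (u - z.2), u)) ≤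
        σ z := by
    intro z hz hz8 s hs hsz
    have hm := hplus z hz hz8 s hs hsz
    have hex : ∀ u ∈ Icc s z.2, ∃ v, a / d * ρ (z.1 + 1 * (u - z.2), u) -
        8 * Λ / d * σ (z.1 + 1 * (u - z.2), u) ≤ v ∧
        HasLineDerivAt ℝ σ v (z.1 + 1 * (u - z.2), u) (1, 1) := by
      intro u hu
      obtain ⟨A, v, hA, hA', hv, hdv⟩ := (h _ (hm u hu)).right
      exact ⟨v, hrate _ A v _ _ (hm u hu) (hu.2.trans hz8) hA hA' (hnonneg _ (hm u hu)).2
        (hnonneg _ (hm u hu)).1 hv, hdv⟩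
    choose! v hv hdv using hex
    have h1 := gain_along_char (u := fun u => σ (z.1 + 1 * (u - z.2), u))
      (γ := fun u => ρ (z.1 + 1 * (u - z.2), u)) (α := a / d) (L := 8 * Λ / d) hsz
      (by positivity) (by positivity)
      (fun u hu => ((h _ (hm u hu)).continuousAt_left.comp
        (f := fun u : ℝ => (z.1 + 1 * (u - z.2), u)) (by fun_prop)).continuousWithinAt)
      (fun u hu => (hnonneg _ (hm u hu)).1)
      (fun u hu => hasDerivAt_along_char (hdv u hu)) hv
    have e : (z.1 + 1 * (z.2 - z.2), z.2) = z := by simp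
    rw [e] at h1
    refine le_trans ?_ h1
    have h2 : 0 ≤ a / d * ∫ u in s..z.2, ρ (z.1 + 1 * (u - z.2), u) :=
      mul_nonneg (by positivity) (intervalIntegral.integral_nonneg hsz
        fun u hu => (hnonneg _ (hm u hu)).1)
    exact mul_le_mul_of_nonneg_right (hexpE s z.2 (by linarith))
      (add_nonneg (hnonneg _ (hm s ⟨le_rfl, hsz⟩)).2 h2)
  -- propagation from the base to `σ`
  have hstep1 : ∀ z ∈ openCone x₀ T₀ t₀, z.2 ≤ T₀ - d / 8 →
      E * σ (z.1 - (z.2 - t₀), t₀) ≤ σ z := by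
    intro z hz hz8
    have h1 := hgainσ z hz hz8 t₀ le_rfl hz.1
    have hm := hplus z hz hz8 t₀ le_rfl hz.1
    have h2 : 0 ≤ a / d * ∫ u in t₀..z.2, ρ (z.1 + 1 * (u - z.2), u) :=
      mul_nonneg (by positivity) (intervalIntegral.integral_nonneg hz.1
        fun u hu => (hnonneg _ (hm u hu)).1)
    have e : z.1 + 1 * (t₀ - z.2) = z.1 - (z.2 - t₀) := by ring
    rw [e] at h1
    have h3 := mul_nonneg hE0.le h2
    linarith
  -- one switch leads to `ρ`
  have hstep2 : ∀ z ∈ openCone x₀ T₀ t₀, z.2 ≤ T₀ - d / 8 → |z.1 - x₀| + d / 2 ≤ z.2 - t₀ →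
      a * E ^ 2 / 2 * (J / d) ≤ ρ z := by
    intro z hz hz8 hwide
    have h1 := hgainρ z hz hz8 t₀ le_rfl hz.1
    have hm := hminus z hz hz8 t₀ le_rfl hz.1
    have hz2 := abs_lt.1 hz.2
    have habs := abs_le.1 (le_refl |z.1 - x₀|)
    have hσ1 : ContinuousOn (fun u => σ (z.1 + -1 * (u - z.2), u)) (Icc t₀ z.2) := fun u hu =>
      ((h _ (hm u hu)).continuousAt_right.comp
        (f := fun u : ℝ => (z.1 + -1 * (u - z.2), u)) (by fun_prop)).continuousWithinAt
    have hmap : ∀ u ∈ Icc t₀ z.2, z.1 + z.2 + t₀ - 2 * u ∈ Ioo (x₀ - d) (x₀ + d) := fun u hu =>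
      ⟨by linarith [hu.2], by linarith [hu.1]⟩
    have hσ2 : ContinuousOn (fun u => E * σ (z.1 + z.2 + t₀ - 2 * u, t₀)) (Icc t₀ z.2) :=
      continuousOn_const.mul (hσbase.comp (f := fun u : ℝ => z.1 + z.2 + t₀ - 2 * u)
        (by fun_prop) hmap)
    have h2 : ∫ u in t₀..z.2, E * σ (z.1 + z.2 + t₀ - 2 * u, t₀) ≤
        ∫ u in t₀..z.2, σ (z.1 + -1 * (u - z.2), u) := by
      refine intervalIntegral.integral_mono_on hz.1 ?_ ?_ fun u hu => ?_
      · exact ContinuousOn.intervalIntegrable_of_Icc hz.1 hσ2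
      · exact ContinuousOn.intervalIntegrable_of_Icc hz.1 hσ1
      · have h3 := hstep1 _ (hm u hu) (hu.2.trans hz8)
        have e : z.1 + -1 * (u - z.2) - (u - t₀) = z.1 + z.2 + t₀ - 2 * u := by ring
        rwa [e] at h3
    -- Following the backward characteristic of `ρ` and going from its points along those of `σ` to
    -- the base sweeps the base with speed 2, whence the factor `1 / 2`.
    rw [intervalIntegral.integral_const_mul,
      intervalIntegral.integral_comp_sub_mul (fun y => σ (y, t₀)) (two_ne_zero)] at h2
    -- The swept interval is centred at `z.1` with radius `z.2 - t₀`; by `hwide` it contains the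
    -- interval of the average.
    have h3 : J ≤ ∫ y in (z.1 + z.2 + t₀ - 2 * z.2)..(z.1 + z.2 + t₀ - 2 * t₀), σ (y, t₀) := by
      have hsub : Icc (z.1 + z.2 + t₀ - 2 * z.2) (z.1 + z.2 + t₀ - 2 * t₀) ⊆
          Ioo (x₀ - d) (x₀ + d) := fun y hy => ⟨by linarith [hy.1], by linarith [hy.2]⟩
      refine intervalIntegral.integral_mono_interval (by linarith) (by linarith) (by linarith)
        ?_ (ContinuousOn.intervalIntegrable_of_Icc (by linarith [hz.1]) (hσbase.mono hsub))
      refine (MeasureTheory.ae_restrict_mem measurableSet_Ioc).mono fun y hy => ?_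
      have hy' := hsub (Ioc_subset_Icc_self hy)
      exact (hnonneg _ (hbase y (abs_lt.2 ⟨by linarith [hy'.1], by linarith [hy'.2]⟩))).2
    rw [smul_eq_mul] at h2
    refine le_trans ?_ h1
    have h4 : E * (2⁻¹ * J) ≤ ∫ u in t₀..z.2, σ (z.1 + -1 * (u - z.2), u) :=
      le_trans (by gcongr) h2
    have h5 : E * (a / d * (E * (2⁻¹ * J))) ≤
      E * (a / d * ∫ u in t₀..z.2, σ (z.1 + -1 * (u - z.2), u)) := by gcongr
    refine le_trans (le_of_eq ?_) h5
    ring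
  -- The constant collects `a * E ^ 2 / 2` for the passage from the base through `σ` to `ρ`, and a
  -- further `a * E / 8` for the return to `σ` during a time `d / 8`. The bound `1 / 2` in its
  -- definition only serves the later iteration.
  set κ := exchangeConst a Λ with hκ
  set b := a * E ^ 2 / 2 with hb
  have hb0 : 0 < b := by positivity
  have hJd : 0 ≤ J / d := by positivity
  have hκ1 : κ ≤ b := by
    refine (min_le_right _ _).trans ?_
    refine mul_le_of_le_one_right hb0.le (min_le_left _ _)
  have hκ2 : κ ≤ b * (a * E / 8) := by
    refine (min_le_right _ _).trans ?_
    exact mul_le_mul_of_nonneg_left (min_le_right _ _) hb0.le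
  -- On this slice `ρ` is reached by one switch. For `σ` a second switch is made during the
  -- preceding time `d / 8`, in which the characteristic satisfies the width condition of `hstep2`.
  have hslice : ∀ z ∈ openCone x₀ T₀ t₀, z.2 = T₀ - d / 8 →
      κ / d * J ≤ ρ z ∧ κ / d * J ≤ σ z := by
    intro z hz hz8
    have hz2 := hz.2
    rw [hz8] at hz2
    have e : κ / d * J = κ * (J / d) := by ring
    rw [e]
    constructor
    · refine le_trans (mul_le_mul_of_nonneg_right hκ1 hJd)
        (hstep2 z hz hz8.le (by rw [hz8]; linarith))
    · have hs : T₀ - d / 4 ≤ z.2 := by rw [hz8]; linarith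
      have hst : t₀ ≤ T₀ - d / 4 := by linarith
      have h1 := hgainσ z hz hz8.le (T₀ - d / 4) hst hs
      have hm := hplus z hz hz8.le (T₀ - d / 4) hst hs
      have h2 : ∫ _u in (T₀ - d / 4)..z.2, b * (J / d) ≤
          ∫ u in (T₀ - d / 4)..z.2, ρ (z.1 + 1 * (u - z.2), u) := by
        refine intervalIntegral.integral_mono_on hs (by simp) ?_ fun u hu => ?_
        · refine ContinuousOn.intervalIntegrable_of_Icc hs fun u hu => ?_
          exact ((h _ (hm u hu)).continuousAt_left.comp
            (f := fun u : ℝ => (z.1 + 1 * (u - z.2), u)) (by fun_prop)).continuousWithinAt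
        · refine hstep2 _ (hm u hu) (hu.2.trans hz8.le) ?_
          have h3 : |z.1 + 1 * (u - z.2) - x₀| ≤ d / 4 := by
            have := abs_lt.1 hz2
            have h4 := hu.1
            have h5 := hu.2
            rw [hz8] at h5
            rw [abs_le]
            constructor <;> linarith
          have h4 := hu.1
          simp only
          linarith
      rw [intervalIntegral.integral_const, smul_eq_mul] at h2
      have e2 : z.2 - (T₀ - d / 4) = d / 8 := by rw [hz8]; ring
      rw [e2] at h2
      have h3 := (hnonneg _ (hm (T₀ - d / 4) ⟨le_rfl, hs⟩)).2
      refine le_trans ?_ h1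
      have h4 : E * (0 + a / d * (d / 8 * (b * (J / d)))) ≤
          E * (σ (z.1 + 1 * (T₀ - d / 4 - z.2), T₀ - d / 4) +
            a / d * ∫ u in (T₀ - d / 4)..z.2, ρ (z.1 + 1 * (u - z.2), u)) := by gcongr
      refine le_trans ?_ h4
      refine le_trans (mul_le_mul_of_nonneg_right hκ2 hJd) (le_of_eq ?_)
      field_simp
      ring
  intro z hz hz8
  -- Beyond the slice the rates are unbounded, but the minimum principle carries the bound up to the
  -- apex.
  have := exchange_min_principle ha (by linarith : t₀ ≤ T₀ - d / 8) h hslice z hz hz8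
  exact le_min this.1 this.2

end DampedWave
end

/-! ### Decay of oscillation and its application to the derivative quotients -/

noncomputable section

namespace DampedWave

/-- At `z`, the pair `(r, s)` is bounded by `1` and solves the exchange system up to a bounded
damping term. -/
structure IsExchangeAt (a Λ T₀ : ℝ) (r s : ℝ × ℝ → ℝ) (z : ℝ × ℝ) : Prop where
  continuousAt_left : ContinuousAt r z
  continuousAt_right : ContinuousAt s z
  abs_left : |r z| ≤ 1
  abs_right : |s z| ≤ 1
  left : ∃ A b, a / (T₀ - z.2) ≤ A ∧ A ≤ Λ / (T₀ - z.2) ∧ 0 ≤ b ∧ b ≤ 2 ∧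
    HasLineDerivAt ℝ r (A * (s z - r z) - b * r z) z (-1, 1)
  right : ∃ A b, a / (T₀ - z.2) ≤ A ∧ A ≤ Λ / (T₀ - z.2) ∧ 0 ≤ b ∧ b ≤ 2 ∧
    HasLineDerivAt ℝ s (A * (r z - s z) - b * s z) z (1, 1)

namespace IsExchangeAt

variable {a Λ T₀ : ℝ} {r s : ℝ × ℝ → ℝ} {z : ℝ × ℝ}

theorem neg (h : IsExchangeAt a Λ T₀ r s z) :
    IsExchangeAt a Λ T₀ (fun z => -r z) (fun z => -s z) z where
  continuousAt_left := h.continuousAt_left.neg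
  continuousAt_right := h.continuousAt_right.neg
  abs_left := by rw [abs_neg]; exact h.abs_left
  abs_right := by rw [abs_neg]; exact h.abs_right
  left := by
    obtain ⟨A, b, h1, h2, h3, h4, h5⟩ := h.left
    have h6 : HasDerivAt _ _ _ := h5
    exact ⟨A, b, h1, h2, h3, h4, (h6.fun_neg.congr_deriv (by ring) : HasDerivAt _ _ _)⟩
  right := by
    obtain ⟨A, b, h1, h2, h3, h4, h5⟩ := h.right
    have h6 : HasDerivAt _ _ _ := h5
    exact ⟨A, b, h1, h2, h3, h4, (h6.fun_neg.congr_deriv (by ring) : HasDerivAt _ _ _)⟩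

/-- Because `|r| ≤ 1` and `0 ≤ b ≤ 2`, the damping term is at least `-2`, and the added `2 (t - t₀)`
compensates for it. -/
theorem isExchangeSuperAt (h : IsExchangeAt a Λ T₀ r s z) (m t₀ : ℝ) :
    IsExchangeSuperAt a Λ T₀ (fun z => r z - m + 2 * (z.2 - t₀)) (fun z => s z - m + 2 * (z.2 - t₀))
      z where
  continuousAt_left := by
    have := h.continuousAt_left
    fun_prop
  continuousAt_right := by
    have := h.continuousAt_right
    fun_prop
  left := by
    obtain ⟨A, b, h1, h2, h3, h4, h5⟩ := h.left
    refine ⟨A, _, h1, h2, ?_, hasLineDerivAt_add_time h5 m 2 t₀⟩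
    have := abs_le.1 h.abs_left
    nlinarith
  right := by
    obtain ⟨A, b, h1, h2, h3, h4, h5⟩ := h.right
    refine ⟨A, _, h1, h2, ?_, hasLineDerivAt_add_time h5 m 2 t₀⟩
    have := abs_le.1 h.abs_right
    nlinarith

end IsExchangeAt

/-- The Harnack bound applied to `r - m + 2 (t - t₀)` and its partner: a known lower bound `m` is
moved by the fraction `κ` towards the average of `s` over the middle of the base, with an error
proportional to the height of the cone. -/
theorem exchange_lower_step {a Λ x₀ T₀ t₀ m : ℝ} {r s : ℝ × ℝ → ℝ} (ha : 0 < a) (hΛ : 0 < Λ)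
    (ht₀ : t₀ < T₀) (h : ∀ z ∈ openCone x₀ T₀ t₀, IsExchangeAt a Λ T₀ r s z)
    (h₀ : ∀ z ∈ openCone x₀ T₀ t₀, z.2 = t₀ → m ≤ r z ∧ m ≤ s z) :
    ∀ z ∈ openCone x₀ T₀ t₀, T₀ - (T₀ - t₀) / 8 ≤ z.2 →
      m - exchangeConst a Λ * m + exchangeConst a Λ / (T₀ - t₀) *
        (∫ y in (x₀ - (T₀ - t₀) / 2)..(x₀ + (T₀ - t₀) / 2), s (y, t₀)) - 2 * (T₀ - t₀) ≤
          min (r z) (s z) := by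
  intro z hz hz8
  have h1 := exchange_lower_bound ha hΛ ht₀ (fun z hz => (h z hz).isExchangeSuperAt m t₀)
    (fun z hz hzt => by
      obtain ⟨h1, h2⟩ := h₀ z hz hzt
      simp only [hzt, sub_self, mul_zero, add_zero, sub_nonneg]
      exact ⟨h1, h2⟩) z hz hz8
  set d := T₀ - t₀ with hd
  have hd0 : 0 < d := by linarith
  have hint : IntervalIntegrable (fun y => s (y, t₀)) MeasureTheory.volume (x₀ - d / 2)
      (x₀ + d / 2) := by
    refine ContinuousOn.intervalIntegrable_of_Icc (by linarith) fun y hy => ?_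
    have hmem : (y, t₀) ∈ openCone x₀ T₀ t₀ :=
      ⟨le_rfl, abs_lt.2 ⟨by simp only; linarith [hy.1], by simp only; linarith [hy.2]⟩⟩
    exact ((h _ hmem).continuousAt_right.comp (f := fun y : ℝ => (y, t₀))
      (by fun_prop)).continuousWithinAt
  simp only [sub_self, mul_zero, add_zero] at h1
  rw [intervalIntegral.integral_sub hint (by simp), intervalIntegral.integral_const,
    smul_eq_mul] at h1
  have e : exchangeConst a Λ / d * ((∫ y in (x₀ - d / 2)..(x₀ + d / 2), s (y, t₀)) -
      (x₀ + d / 2 - (x₀ - d / 2)) * m) = exchangeConst a Λ / d *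
      (∫ y in (x₀ - d / 2)..(x₀ + d / 2), s (y, t₀)) - exchangeConst a Λ * m := by
    field_simp
    ring
  rw [e, le_min_iff] at h1
  have hzt : z.2 - t₀ ≤ d := by
    have := (abs_nonneg _).trans_lt hz.2
    linarith
  exact le_min (by linarith [h1.1]) (by linarith [h1.2])

/-- The oscillation decreases by a fixed factor when the cone is shrunk to an eighth. -/
theorem exchange_oscillation_step {a Λ x₀ T₀ t₀ m M : ℝ} {r s : ℝ × ℝ → ℝ} (ha : 0 < a)
    (hΛ : 0 < Λ) (ht₀ : t₀ < T₀) (h : ∀ z ∈ openCone x₀ T₀ t₀, IsExchangeAt a Λ T₀ r s z)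
    (h₀ : ∀ z ∈ openCone x₀ T₀ t₀, (m ≤ r z ∧ m ≤ s z) ∧ (r z ≤ M ∧ s z ≤ M)) :
    ∃ m' M', M' - m' ≤ (1 - exchangeConst a Λ) * (M - m) + 4 * (T₀ - t₀) ∧
      ∀ z ∈ openCone x₀ T₀ (T₀ - (T₀ - t₀) / 8), (m' ≤ r z ∧ m' ≤ s z) ∧ (r z ≤ M' ∧ s z ≤ M') := by
  set κ := exchangeConst a Λ
  set J := ∫ y in (x₀ - (T₀ - t₀) / 2)..(x₀ + (T₀ - t₀) / 2), s (y, t₀) with hJ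
  -- The upper bound is the lower one for `(-r, -s)`. The same average `J` occurs in both and
  -- cancels in the difference.
  refine ⟨m - κ * m + κ / (T₀ - t₀) * J - 2 * (T₀ - t₀),
    M - κ * M + κ / (T₀ - t₀) * J + 2 * (T₀ - t₀), le_of_eq (by ring), fun z hz => ?_⟩
  have hz' : z ∈ openCone x₀ T₀ t₀ := ⟨le_trans (by linarith) hz.1, hz.2⟩
  have h1 := exchange_lower_step ha hΛ ht₀ h (fun z hz _ => (h₀ z hz).1) z hz' hz.1
  have h2 := exchange_lower_step (m := -M) ha hΛ ht₀ (fun z hz => (h z hz).neg)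
    (fun z hz _ => ⟨neg_le_neg (h₀ z hz).2.1, neg_le_neg (h₀ z hz).2.2⟩) z hz' hz.1
  rw [intervalIntegral.integral_neg, ← hJ] at h2
  rw [le_min_iff] at h1 h2
  refine ⟨h1, ?_, ?_⟩
  · linarith [h2.1]
  · linarith [h2.2]

/-- The modulus of continuity at the apex of the cone. -/
theorem exchange_modulus {a Λ d₀ : ℝ} (ha : 0 < a) (hΛ : 0 < Λ) (hd₀ : 0 < d₀) {ε : ℝ}
    (hε : 0 < ε) : ∃ δ > 0, ∀ (x₀ T₀ : ℝ) (r s : ℝ × ℝ → ℝ),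
      (∀ z ∈ openCone x₀ T₀ (T₀ - d₀), IsExchangeAt a Λ T₀ r s z) →
      ∃ m M, M - m ≤ ε ∧
        ∀ z ∈ openCone x₀ T₀ (T₀ - δ), (m ≤ r z ∧ m ≤ s z) ∧ (r z ≤ M ∧ s z ≤ M) := by
  set κ := exchangeConst a Λ with hκ
  have hκ0 : 0 < κ := exchangeConst_pos ha
  have hκ1 : κ ≤ 1 / 2 := min_le_left _ _
  -- The recursion `osc' ≤ (1 - κ) osc + 4 d₀ 8⁻ʲ` is satisfied by the bounds `D θ ^ j`: half of the
  -- gain `κ` is given up, and `D κ / 2 = κ + 4 d₀` absorbs the error since `1 / 8 ≤ θ`. The summand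
  -- 2 in `D` covers the initial oscillation.
  set θ := 1 - κ / 2 with hθ
  have hθ0 : 0 < θ := by linarith
  have hθ1 : θ < 1 := by linarith
  set D := 2 + 8 * d₀ / κ with hD
  have hD0 : 0 < D := by positivity
  have key : ∀ (x₀ T₀ : ℝ) (r s : ℝ × ℝ → ℝ),
      (∀ z ∈ openCone x₀ T₀ (T₀ - d₀), IsExchangeAt a Λ T₀ r s z) → ∀ j : ℕ,
      ∃ m M, M - m ≤ D * θ ^ j ∧ ∀ z ∈ openCone x₀ T₀ (T₀ - d₀ * (1 / 8) ^ j),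
        (m ≤ r z ∧ m ≤ s z) ∧ (r z ≤ M ∧ s z ≤ M) := by
    intro x₀ T₀ r s h j
    induction j with
    | zero =>
      refine ⟨-1, 1, ?_, fun z hz => ?_⟩
      · have : 0 ≤ 8 * d₀ / κ := by positivity
        simp only [pow_zero, mul_one, hD]
        linarith
      · simp only [pow_zero, mul_one] at hz
        have h1 := abs_le.1 (h z hz).abs_left
        have h2 := abs_le.1 (h z hz).abs_right
        exact ⟨⟨h1.1, h2.1⟩, h1.2, h2.2⟩
    | succ j ih =>
      obtain ⟨m, M, hmM, hb⟩ := ih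
      have hpow : (0:ℝ) < (1 / 8) ^ j := by positivity
      have hpow1 : ((1:ℝ) / 8) ^ j ≤ 1 := pow_le_one₀ (by norm_num) (by norm_num)
      obtain ⟨m', M', hmM', hb'⟩ := exchange_oscillation_step ha hΛ
        (t₀ := T₀ - d₀ * (1 / 8) ^ j) (by linarith [mul_pos hd₀ hpow])
        (fun z hz => h z ⟨le_trans (by nlinarith) hz.1, hz.2⟩) hb
      refine ⟨m', M', hmM'.trans ?_, ?_⟩
      · have h1 : ((1:ℝ) / 8) ^ j ≤ θ ^ j := pow_le_pow_left₀ (by norm_num) (by linarith) j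
        have h2 : (1 - κ) * (M - m) ≤ (1 - κ) * (D * θ ^ j) :=
          mul_le_mul_of_nonneg_left hmM (by linarith)
        have h3 : D * (κ / 2) = κ + 4 * d₀ := by
          rw [hD]; field_simp; ring
        have h4 : 4 * (d₀ * (1 / 8) ^ j) ≤ D * (κ / 2) * θ ^ j := by
          rw [h3]
          have h5 : 4 * d₀ * (1 / 8) ^ j ≤ 4 * d₀ * θ ^ j := by gcongr
          have h6 : 0 ≤ κ * θ ^ j := by positivity
          linarith
        have e : D * θ ^ (j + 1) = (1 - κ) * (D * θ ^ j) + D * (κ / 2) * θ ^ j := by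
          rw [pow_succ]
          simp only [hθ]
          ring
        rw [e]
        linarith
      · have e : T₀ - (T₀ - (T₀ - d₀ * (1 / 8) ^ j)) / 8 = T₀ - d₀ * (1 / 8) ^ (j + 1) := by
          rw [pow_succ]; ring
        rwa [e] at hb'
  obtain ⟨j, hj⟩ : ∃ j : ℕ, D * θ ^ j < ε := by
    have h1 : Tendsto (fun j : ℕ => D * θ ^ j) atTop (𝓝 (D * 0)) :=
      (tendsto_pow_atTop_nhds_zero_of_lt_one hθ0.le hθ1).const_mul D
    rw [mul_zero] at h1
    exact (h1.eventually_lt_const hε).exists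
  refine ⟨d₀ * (1 / 8) ^ j, by positivity, fun x₀ T₀ r s h => ?_⟩
  obtain ⟨m, M, h1, h2⟩ := key x₀ T₀ r s h j
  exact ⟨m, M, h1.trans hj.le, h2⟩

variable {p μ γ₁ γ₂ k B C T₁ : ℝ} {f g f' g' T : ℝ → ℝ} {τ : ℕ → ℝ → ℝ} {φ ψ : ℝ × ℝ → ℝ}

namespace IsBlowUpProfile

/-- The Lipschitz constant `1 / k < 1` of the curve makes the vertical distance to the curve
comparable with the time left to the apex, throughout the cone. -/
theorem lt_of_mem_cone (P : IsBlowUpProfile p μ γ₁ γ₂ k B T₁ f g f' g' T τ φ ψ)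
    (H : AdmissibleData p μ γ₁ γ₂ k B C f g f' g') {x₀ : ℝ} {z : ℝ × ℝ}
    (h : |z.1 - x₀| < T x₀ - z.2) :
    (k - 1) / k * (T x₀ - z.2) ≤ T z.1 - z.2 ∧ T z.1 - z.2 ≤ 2 * (T x₀ - z.2) := by
  have hk := H.hk
  have h1 := P.lipschitz z.1 x₀
  have h2 := abs_le.1 (le_refl |T z.1 - T x₀|)
  have h3 := abs_nonneg (T z.1 - T x₀)
  constructor
  · rw [div_mul_eq_mul_div, div_le_iff₀ (by linarith)]
    nlinarith
  · nlinarith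

set_option maxHeartbeats 1000000 in
/-- The quotients of space and time derivatives solve an exchange system in every backward cone
with apex on the blow-up curve. -/
theorem exists_isExchangeAt (P : IsBlowUpProfile p μ γ₁ γ₂ k B T₁ f g f' g' T τ φ ψ)
    (H : AdmissibleData p μ γ₁ γ₂ k B C f g f' g') :
    ∃ a Λ, 0 < a ∧ 0 < Λ ∧ ∀ (x₀ : ℝ) (z : ℝ × ℝ), 0 < z.2 → |z.1 - x₀| < T x₀ - z.2 →
      IsExchangeAt a Λ (T x₀) (fun z => dx φ z / dt φ z) (fun z => dx ψ z / dt ψ z) z := by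
  have hp := H.hp
  have hk := H.hk
  have hμ := H.hμ
  set κ := k / (k - 1) with hκ
  have hκ1 : 1 ≤ κ := by
    rw [hκ, le_div_iff₀ (by linarith)]; linarith
  have hκ0 : 0 < κ := by linarith
  set b := (p - 1) * (2:ℝ) ^ (-p) with hb
  have hb0 : 0 < b := mul_pos (by linarith) (by positivity)
  set e := p * (2:ℝ) ^ (-p) with he
  have he0 : 0 < e := by positivity
  -- The rate `A` is the source slope times a quotient of time derivatives. The quotient lies
  -- between `1 / (2 * κ)` and `2 * κ`; `2 * κ * b` and `b / 2` come from the blow-up rate, and the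
  -- remaining 2 and `κ` from replacing `T z.1` by `T x₀`.
  refine ⟨e / 2 / (2 * κ * b) / 2 / (2 * κ), e / (b / 2) * κ * (2 * κ), by positivity,
    by positivity, fun x₀ z hz hcone => ?_⟩
  obtain ⟨c1, c2⟩ := P.lt_of_mem_cone H hcone
  have hs0 : 0 < T x₀ - z.2 := (abs_nonneg _).trans_lt hcone
  have hkk : 0 < (k - 1) / k := div_pos (by linarith) (by linarith)
  have hd0 : 0 < T z.1 - z.2 := lt_of_lt_of_le (mul_pos hkk hs0) c1
  have hzT : z.2 < T z.1 := by linarith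
  have Q := P.isRegularPoint H hz hzT
  have hF0 := Q.source_pos H hz
  obtain ⟨s1, s2, s3, s4⟩ := Q.source_bounds H hz
  obtain ⟨d1, d2, d3, d4⟩ := Q.time_bounds H
  obtain ⟨r1, r2⟩ := P.rate H (x := z.1) (t := z.2) hz hzT
  simp only [Prod.mk.eta] at r1 r2
  have hw : γ₁ + γ₂ ≤ φ z + ψ z := add_le_add Q.lower_left Q.lower_right
  have hw0 : 0 < φ z + ψ z := H.γ_pos.trans_le hw
  have hY := H.pow_ge hw
  set w := φ z + ψ z with hwdef
  set F := source μ p z.2 w with hF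
  set V := sourceSlope p μ z.2 w with hV
  set y := w ^ (1 - p) with hy
  have hy0 : 0 < y := Real.rpow_pos_of_pos hw0 _
  have hwy : w ^ (p - 1) = y⁻¹ := by
    rw [hy, ← Real.rpow_neg hw0.le]; congr 1; ring
  have hP1 : 0 < dt φ z := by linarith
  have hP2 : 0 < dt ψ z := by linarith
  have hV1 : e / 2 / (2 * κ * b) / 2 / (T x₀ - z.2) ≤ V := by
    refine le_trans ?_ s3
    rw [hwy]
    have h1 : y ≤ 2 * κ * b * (2 * (T x₀ - z.2)) :=
      r2.trans (mul_le_mul_of_nonneg_left c2 (by positivity))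
    have h2 : (2 * κ * b * (2 * (T x₀ - z.2)))⁻¹ ≤ y⁻¹ := inv_anti₀ hy0 h1
    have h3 := mul_le_mul_of_nonneg_left h2 (by positivity : 0 ≤ e / 2)
    calc e / 2 / (2 * κ * b) / 2 / (T x₀ - z.2) = e / 2 * (2 * κ * b * (2 * (T x₀ - z.2)))⁻¹ := by
          field_simp
      _ ≤ e / 2 * y⁻¹ := h3
      _ = p * (2 ^ (-p) * y⁻¹) / 2 := by rw [he]; ring
  have hV2 : V ≤ e / (b / 2) * κ / (T x₀ - z.2) := by
    refine s4.trans ?_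
    rw [hwy]
    have h1 : b / 2 * ((k - 1) / k * (T x₀ - z.2)) ≤ y :=
      (mul_le_mul_of_nonneg_left c1 (by positivity)).trans r1
    have h2 : y⁻¹ ≤ (b / 2 * ((k - 1) / k * (T x₀ - z.2)))⁻¹ := inv_anti₀ (by positivity) h1
    have h3 := mul_le_mul_of_nonneg_left h2 he0.le
    have hk1 : k - 1 ≠ 0 := by linarith
    have hk0 : k ≠ 0 := by linarith
    calc p * (2 ^ (-p) * y⁻¹) = e * y⁻¹ := by rw [he]; ring
      _ ≤ e * (b / 2 * ((k - 1) / k * (T x₀ - z.2)))⁻¹ := h3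
      _ = e / (b / 2) * κ / (T x₀ - z.2) := by rw [hκ]; field_simp
  have hquot : ∀ P P' : ℝ, F / 2 ≤ P → P ≤ κ * F → F / 2 ≤ P' → P' ≤ κ * F →
      1 / (2 * κ) ≤ P' / P ∧ P' / P ≤ 2 * κ := by
    intro P P' h1 h2 h3 h4
    have hP : 0 < P := by linarith
    constructor
    · rw [div_le_div_iff₀ (by positivity) hP]
      nlinarith
    · rw [div_le_iff₀ hP]
      nlinarith
  have hA : ∀ q : ℝ, 1 / (2 * κ) ≤ q → q ≤ 2 * κ →
      e / 2 / (2 * κ * b) / 2 / (2 * κ) / (T x₀ - z.2) ≤ V * q ∧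
      V * q ≤ e / (b / 2) * κ * (2 * κ) / (T x₀ - z.2) := by
    intro q h1 h2
    have hq : 0 < q := lt_of_lt_of_le (by positivity) h1
    have hc : 0 < e / 2 / (2 * κ * b) / 2 / (T x₀ - z.2) := by positivity
    constructor
    · have := mul_le_mul hV1 h1 (by positivity) (hc.le.trans hV1)
      refine le_trans (le_of_eq ?_) this
      field_simp
    · have := mul_le_mul hV2 h2 hq.le ((hc.le.trans hV1).trans hV2)
      refine this.trans (le_of_eq ?_)
      field_simp
  -- The numerator is at most `μ w / 2`, while `P ≥ F / 2 ≥ 2⁻ᵖ w ^ p / 4 ≥ μ w / 4`.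
  have hbd : ∀ P, F / 2 ≤ P → 0 ≤ μ / (1 + z.2) ^ 2 * (w / 2) / P ∧
      μ / (1 + z.2) ^ 2 * (w / 2) / P ≤ 2 := by
    intro P hP
    have hP0 : 0 < P := by linarith
    refine ⟨by positivity, ?_⟩
    rw [div_le_iff₀ hP0]
    have h1 : μ / (1 + z.2) ^ 2 ≤ μ := div_le_self hμ.le (by nlinarith)
    have hX : (2:ℝ) ^ (-p) * w ^ p = (2:ℝ) ^ (-p) * w ^ (p - 1) * w := by
      rw [mul_assoc, ← Real.rpow_add_one hw0.ne']; simp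
    have h2 : μ * p * w ≤ (2:ℝ) ^ (-p) * w ^ p := by
      rw [hX]; exact mul_le_mul_of_nonneg_right hY hw0.le
    have h3 : μ * w ≤ μ * p * w := by
      have := mul_pos hμ hw0
      nlinarith
    have h4 : μ / (1 + z.2) ^ 2 * (w / 2) ≤ μ * (w / 2) :=
      mul_le_mul_of_nonneg_right h1 (by linarith)
    linarith
  have habs : ∀ q P : ℝ, 0 < P → k * |q| ≤ P → |q / P| ≤ 1 := by
    intro q P hP h1
    rw [abs_div, abs_of_pos hP, div_le_one hP]
    have := abs_nonneg q
    nlinarith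
  obtain ⟨l1, l2⟩ := Q.ratio_char H hz
  exact
    { continuousAt_left := Q.continuousAt_dx_left.div Q.continuousAt_dt_left hP1.ne'
      continuousAt_right := Q.continuousAt_dx_right.div Q.continuousAt_dt_right hP2.ne'
      abs_left := habs _ _ hP1 Q.slope_left
      abs_right := habs _ _ hP2 Q.slope_right
      left := by
        obtain ⟨q1, q2⟩ := hquot _ _ d1 d3 d2 d4
        obtain ⟨a1, a2⟩ := hA _ q1 q2
        obtain ⟨b1, b2⟩ := hbd _ d1
        exact ⟨_, _, a1, a2, b1, b2, l1⟩
      right := by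
        obtain ⟨q1, q2⟩ := hquot _ _ d2 d4 d1 d3
        obtain ⟨a1, a2⟩ := hA _ q1 q2
        obtain ⟨b1, b2⟩ := hbd _ d2
        exact ⟨_, _, a1, a2, b1, b2, l2⟩ }

end IsBlowUpProfile

end DampedWave
end

/-! ### Uniform convergence of the level slopes and regularity of the curve -/

noncomputable section

namespace DampedWave

/-- The level curve is already given and Lipschitz, so `z - (x, σ x)` is `O(y - x)` along it and the
first order expansion of `F` can be solved for `σ y - σ x`. -/
theorem hasDerivAt_of_level {F : ℝ × ℝ → ℝ} {σ : ℝ → ℝ} {x c : ℝ}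
    (hF : DifferentiableAt ℝ F (x, σ x)) (hσ : ∀ y, |σ y - σ x| ≤ |y - x|)
    (hlevel : ∀ y, F (y, σ y) = c) (hdt : dt F (x, σ x) ≠ 0) :
    HasDerivAt σ (-(dx F (x, σ x) / dt F (x, σ x))) x := by
  have hcont : ContinuousAt σ x := by
    rw [Metric.continuousAt_iff]
    intro ε hε
    refine ⟨ε, hε, fun {y} hy => ?_⟩
    rw [Real.dist_eq] at *
    exact (hσ y).trans_lt hy
  have hpair : Tendsto (fun y => (y, σ y)) (𝓝 x) (𝓝 (x, σ x)) :=
    continuousAt_id.prodMk hcont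
  have h1 := hF.hasFDerivAt.isLittleO.comp_tendsto hpair
  have h2 : ((fun z' : ℝ × ℝ => z' - (x, σ x)) ∘ fun y => (y, σ y)) =O[𝓝 x] fun y => y - x := by
    refine Asymptotics.IsBigO.of_bound 1 (Eventually.of_forall fun y => ?_)
    simp only [Function.comp, Prod.mk_sub_mk, Prod.norm_mk, Real.norm_eq_abs, one_mul]
    exact max_le le_rfl (hσ y)
  have h3 := (h1.trans_isBigO h2).const_mul_left (-(dt F (x, σ x))⁻¹)
  rw [hasDerivAt_iff_isLittleO]
  refine h3.congr_left fun y => ?_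
  simp only [Function.comp, hlevel, Prod.mk_sub_mk, fderiv_apply_eq, smul_eq_mul]
  field_simp
  ring

variable {p μ γ₁ γ₂ k B C T₁ : ℝ} {f g f' g' T : ℝ → ℝ} {τ : ℕ → ℝ → ℝ} {φ ψ : ℝ × ℝ → ℝ}

theorem dx_add {F G : ℝ × ℝ → ℝ} {z : ℝ × ℝ} (hF : DifferentiableAt ℝ F z)
    (hG : DifferentiableAt ℝ G z) : dx (fun z => F z + G z) z = dx F z + dx G z := by
  simp only [dx]
  rw [fderiv_fun_add hF hG]; rfl

theorem dt_add {F G : ℝ × ℝ → ℝ} {z : ℝ × ℝ} (hF : DifferentiableAt ℝ F z)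
    (hG : DifferentiableAt ℝ G z) : dt (fun z => F z + G z) z = dt F z + dt G z := by
  simp only [dt]
  rw [fderiv_fun_add hF hG]; rfl

/-- The slope of the level curves of `φ + ψ`. -/
def levelSlope (φ ψ : ℝ × ℝ → ℝ) (z : ℝ × ℝ) : ℝ :=
  -((dx φ z + dx ψ z) / (dt φ z + dt ψ z))

namespace IsBlowUpProfile

theorem level_rate (P : IsBlowUpProfile p μ γ₁ γ₂ k B T₁ f g f' g' T τ φ ψ)
    (H : AdmissibleData p μ γ₁ γ₂ k B C f g f' g') (n : ℕ) (x : ℝ) :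
    (p - 1) * (2:ℝ) ^ (-p) / 2 * (T x - τ n x) ≤ (2 * B + 1 + n) ^ (1 - p) ∧
    (2 * B + 1 + n) ^ (1 - p) ≤ 2 * (k / (k - 1)) * ((p - 1) * (2:ℝ) ^ (-p)) * (T x - τ n x) := by
  have := P.rate H (P.level_pos n x) (P.level_lt n x)
  rwa [P.level_eq n x] at this

/-- The blow-up curve is the uniform limit of the level curves. -/
theorem exists_level_close (P : IsBlowUpProfile p μ γ₁ γ₂ k B T₁ f g f' g' T τ φ ψ)
    (H : AdmissibleData p μ γ₁ γ₂ k B C f g f' g') {δ : ℝ} (hδ : 0 < δ) :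
    ∃ N : ℕ, ∀ n ≥ N, ∀ x, T x - τ n x < δ := by
  have hp := H.hp
  have hb : 0 < (p - 1) * (2:ℝ) ^ (-p) / 2 :=
    div_pos (mul_pos (by linarith) (by positivity)) two_pos
  have h1 : Tendsto (fun n : ℕ => (2 * B + 1 + n) ^ (1 - p)) atTop (𝓝 0) := by
    have h2 := (tendsto_rpow_neg_atTop (y := p - 1) (by linarith)).comp
      (tendsto_atTop_add_const_left _ (2 * B + 1) (tendsto_natCast_atTop_atTop (R := ℝ)))
    refine h2.congr fun n => ?_
    simp only [Function.comp, neg_sub]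
  obtain ⟨N, hN⟩ := eventually_atTop.1 (h1.eventually_lt_const (mul_pos hb hδ))
  refine ⟨N, fun n hn x => ?_⟩
  have h3 := (P.level_rate H n x).1.trans_lt (hN n hn)
  exact lt_of_mul_lt_mul_left h3 hb.le

/-- Level 0 lies at positive times, and the rate keeps the curve a fixed distance above it. Hence
cones of one common depth fit below all points of the curve, as a uniform modulus requires. -/
theorem exists_pos_le (P : IsBlowUpProfile p μ γ₁ γ₂ k B T₁ f g f' g' T τ φ ψ)
    (H : AdmissibleData p μ γ₁ γ₂ k B C f g f' g') : ∃ d > 0, ∀ x, d ≤ T x := by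
  have hp := H.hp
  have hk := H.hk
  have hB : 0 ≤ B := (abs_nonneg _).trans (H.hfB 0)
  have hc : 0 < 2 * (k / (k - 1)) * ((p - 1) * (2:ℝ) ^ (-p)) :=
    mul_pos (mul_pos two_pos (div_pos (by linarith) (by linarith)))
      (mul_pos (by linarith) (by positivity))
  refine ⟨(2 * B + 1 + (0:ℕ)) ^ (1 - p) / (2 * (k / (k - 1)) * ((p - 1) * (2:ℝ) ^ (-p))),
    div_pos (Real.rpow_pos_of_pos (by push_cast; linarith) _) hc, fun x => ?_⟩
  rw [div_le_iff₀' hc]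
  refine (P.level_rate H 0 x).2.trans (mul_le_mul_of_nonneg_left ?_ hc.le)
  linarith [P.level_pos 0 x]

theorem hasDerivAt_level (P : IsBlowUpProfile p μ γ₁ γ₂ k B T₁ f g f' g' T τ φ ψ)
    (H : AdmissibleData p μ γ₁ γ₂ k B C f g f' g') (n : ℕ) (x : ℝ) :
    HasDerivAt (τ n) (levelSlope φ ψ (x, τ n x)) x := by
  have Q := P.isRegularPoint H (z := (x, τ n x)) (P.level_pos n x) (P.level_lt n x)
  have h0 := Q.source_pos H (P.level_pos n x)
  obtain ⟨h1, h2, -, -⟩ := Q.time_bounds H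
  have d1 := Q.contDiffAt_left.differentiableAt (by norm_num)
  have d2 := Q.contDiffAt_right.differentiableAt (by norm_num)
  have h := hasDerivAt_of_level (F := fun z => φ z + ψ z) (σ := τ n) (x := x)
    (c := 2 * B + 1 + n) (d1.fun_add d2) (fun y => ?_) (P.level_eq n) ?_
  · rwa [dx_add d1 d2, dt_add d1 d2] at h
  · have h3 := P.level_lipschitz n y x
    nlinarith [H.hk, abs_nonneg (τ n y - τ n x)]
  · rw [dt_add d1 d2]
    linarith

theorem continuous_levelSlope (P : IsBlowUpProfile p μ γ₁ γ₂ k B T₁ f g f' g' T τ φ ψ)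
    (H : AdmissibleData p μ γ₁ γ₂ k B C f g f' g') (n : ℕ) :
    Continuous fun x => levelSlope φ ψ (x, τ n x) := by
  rw [continuous_iff_continuousAt]
  intro x
  have Q := P.isRegularPoint H (z := (x, τ n x)) (P.level_pos n x) (P.level_lt n x)
  have h0 := Q.source_pos H (P.level_pos n x)
  obtain ⟨h1, h2, -, -⟩ := Q.time_bounds H
  have h3 : ContinuousAt (levelSlope φ ψ) (x, τ n x) :=
    ((Q.continuousAt_dx_left.add Q.continuousAt_dx_right).div
      (Q.continuousAt_dt_left.add Q.continuousAt_dt_right)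
      (ne_of_gt (add_pos (by linarith) (by linarith)))).neg
  exact h3.comp (f := fun x => (x, τ n x))
    (continuousAt_id.prodMk (P.hasDerivAt_level H n x).continuousAt)

/-- The blow-up curve is continuously differentiable. -/
theorem contDiff (P : IsBlowUpProfile p μ γ₁ γ₂ k B T₁ f g f' g' T τ φ ψ)
    (H : AdmissibleData p μ γ₁ γ₂ k B C f g f' g') : ContDiff ℝ 1 T := by
  obtain ⟨d, hd, hdT⟩ := P.exists_pos_le H
  obtain ⟨a, Λ, ha, hΛ, hex⟩ := P.exists_isExchangeAt H
  -- For large `i, j` the points `(x, τ i x)` and `(x, τ j x)` both lie in the shrunk cone with apex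
  -- `(x, T x)`, uniformly in `x`.
  have hcauchy : UniformCauchySeqOn (fun n x => levelSlope φ ψ (x, τ n x)) atTop univ := by
    rw [Metric.uniformCauchySeqOn_iff]
    intro ε hε
    obtain ⟨δ, hδ, hmod⟩ := exchange_modulus (d₀ := d / 2) ha hΛ (half_pos hd) (half_pos hε)
    obtain ⟨N, hN⟩ := P.exists_level_close H hδ
    refine ⟨N, fun i hi j hj x _ => ?_⟩
    obtain ⟨m, M, hmM, hb⟩ := hmod x (T x) _ _ fun z hz =>
      hex x z (by linarith [hz.1, hdT x]) hz.2
    have key : ∀ n ≥ N, -M ≤ levelSlope φ ψ (x, τ n x) ∧ levelSlope φ ψ (x, τ n x) ≤ -m := by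
      intro n hn
      have Q := P.isRegularPoint H (z := (x, τ n x)) (P.level_pos n x) (P.level_lt n x)
      have h0 := Q.source_pos H (P.level_pos n x)
      obtain ⟨h1, h2, -, -⟩ := Q.time_bounds H
      have p1 : 0 < dt φ (x, τ n x) := by linarith
      have p2 : 0 < dt ψ (x, τ n x) := by linarith
      obtain ⟨⟨b1, b2⟩, b3, b4⟩ := hb (x, τ n x)
        ⟨by linarith [hN n hn x], by simpa using P.level_lt n x⟩
      rw [le_div_iff₀ p1] at b1
      rw [le_div_iff₀ p2] at b2
      rw [div_le_iff₀ p1] at b3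
      rw [div_le_iff₀ p2] at b4
      -- The level slope is minus the mediant of the two quotients, hence it lies between the same
      -- bounds.
      rw [levelSlope, neg_le_neg_iff, neg_le_neg_iff, div_le_iff₀ (by linarith),
        le_div_iff₀ (by linarith)]
      constructor <;> linarith
    obtain ⟨i1, i2⟩ := key i hi
    obtain ⟨j1, j2⟩ := key j hj
    rw [Real.dist_eq]
    exact (abs_le.2 ⟨by linarith, by linarith⟩ : _ ≤ ε / 2).trans_lt (by linarith)
  have hlim : ∀ x, ∃ l, Tendsto (fun n => levelSlope φ ψ (x, τ n x)) atTop (𝓝 l) := fun x =>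
    cauchySeq_tendsto_of_complete (hcauchy.cauchySeq (mem_univ x))
  choose T' hT' using hlim
  have hunif := hcauchy.tendstoUniformlyOn_of_tendsto fun x _ => hT' x
  have hcont : Continuous T' := by
    have h1 := tendstoUniformlyOn_univ.1 hunif
    exact h1.continuous (Frequently.of_forall (P.continuous_levelSlope H))
  have hder : ∀ x, HasDerivAt T (T' x) x := fun x =>
    hasDerivAt_of_tendstoUniformlyOn isOpen_univ hunif
      (Eventually.of_forall fun n y _ => P.hasDerivAt_level H n y)
      (fun y _ => by
        rw [Metric.tendsto_atTop]
        intro ε hε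
        obtain ⟨N, hN⟩ := P.exists_level_close H hε
        refine ⟨N, fun n hn => ?_⟩
        rw [Real.dist_eq, abs_sub_comm, abs_of_pos (by linarith [P.level_lt n y])]
        exact hN n hn y) (mem_univ x)
  rw [contDiff_one_iff_deriv]
  refine ⟨fun x => (hder x).differentiableAt, ?_⟩
  rwa [funext fun x => (hder x).deriv]

end IsBlowUpProfile

end DampedWave
end

/-! ### Uniqueness of the blow-up curve and the solution of the original system -/

noncomputable section

namespace DampedWave

theorem hasDerivAt_time_slice {F : ℝ × ℝ → ℝ} {x t : ℝ} (h : DifferentiableAt ℝ F (x, t)) :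
    HasDerivAt (fun s => F (x, s)) (dt F (x, t)) t :=
  h.hasFDerivAt.comp_hasDerivAt t ((hasDerivAt_const t x).prodMk (hasDerivAt_id t))

theorem hasDerivAt_space_slice {F : ℝ × ℝ → ℝ} {x t : ℝ} (h : DifferentiableAt ℝ F (x, t)) :
    HasDerivAt (fun y => F (y, t)) (dx F (x, t)) x :=
  h.hasFDerivAt.comp_hasDerivAt x ((hasDerivAt_id x).prodMk (hasDerivAt_const x t))

section Geometry

variable {R : ℝ} {T : ℝ → ℝ}

theorem mem_domainBelow {z : ℝ × ℝ} :
    z ∈ domainBelow R T ↔ ∃ x, |x| < R ∧ 0 < z.2 ∧ |z.1 - x| < T x - z.2 := by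
  simp only [domainBelow, backwardCone, mem_iUnion, mem_ball_zero_iff, Real.norm_eq_abs,
    mem_ofPred_eq, exists_prop]

theorem mem_baseBelow {y : ℝ} : y ∈ baseBelow R T ↔ ∃ x, |x| < R ∧ |y - x| < T x := by
  simp [baseBelow, Real.dist_eq]

theorem isOpen_domainBelow : IsOpen (domainBelow R T) :=
  isOpen_biUnion fun _ _ => (isOpen_lt continuous_const continuous_snd).inter
    (isOpen_lt (continuous_fst.sub continuous_const).abs (continuous_const.sub continuous_snd))

theorem pos_of_mem_domainBelow {z : ℝ × ℝ} (hz : z ∈ domainBelow R T) : 0 < z.2 := by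
  obtain ⟨x, -, h, -⟩ := mem_domainBelow.1 hz
  exact h

theorem mem_domainBelow_of_lt {x t : ℝ} (hx : |x| < R) (ht : 0 < t) (htT : t < T x) :
    (x, t) ∈ domainBelow R T :=
  mem_domainBelow.2 ⟨x, hx, ht, by simpa using htT⟩

theorem mem_domainBelow_of_mem_closedCone {x t : ℝ} (hx : |x| < R) (htT : t < T x) {z : ℝ × ℝ}
    (hz : z ∈ closedCone 0 (x, t)) (hz0 : 0 < z.2) : z ∈ domainBelow R T :=
  mem_domainBelow.2 ⟨x, hx, hz0, hz.2.trans_lt (by simp only; linarith)⟩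

theorem mem_baseBelow_of_mem_closedCone {x t : ℝ} (hx : |x| < R) (htT : t < T x) {z : ℝ × ℝ}
    (hz : z ∈ closedCone 0 (x, t)) : z.1 ∈ baseBelow R T :=
  mem_baseBelow.2 ⟨x, hx, hz.2.trans_lt (by have := hz.1; simp only; linarith)⟩

theorem baseBelow_subset_ball {Ts : ℝ} (hT : ∀ x ∈ Metric.ball (0:ℝ) R, 0 < T x ∧ T x < Ts) :
    baseBelow R T ⊆ Metric.ball 0 (R + Ts) := by
  intro y hy
  obtain ⟨x, hx, hyx⟩ := mem_baseBelow.1 hy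
  rw [mem_ball_zero_iff, Real.norm_eq_abs]
  have h1 := (hT x (by simpa using hx)).2
  have h2 := abs_add_le (y - x) x
  rw [sub_add_cancel] at h2
  linarith

end Geometry

/-- The extension of `φ` by its initial values. -/
def extendInit (f : ℝ → ℝ) (φ : ℝ × ℝ → ℝ) (z : ℝ × ℝ) : ℝ := if 0 < z.2 then φ z else f z.1

theorem extendInit_eventuallyEq (f : ℝ → ℝ) (φ : ℝ × ℝ → ℝ) {z : ℝ × ℝ} (hz : 0 < z.2) :
    extendInit f φ =ᶠ[𝓝 z] φ := by
  filter_upwards [continuousAt_snd.eventually_const_lt hz] with y hy using if_pos hy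

theorem continuousOn_extendInit {f : ℝ → ℝ} {φ : ℝ × ℝ → ℝ} {R : ℝ} {T : ℝ → ℝ}
    (hf : ContinuousOn f (baseBelow R T)) (hφ : ContinuousOn φ (domainBelow R T))
    (h0 : ∀ x ∈ baseBelow R T, Tendsto φ (𝓝[domainBelow R T] (x, 0)) (𝓝 (f x)))
    {x t : ℝ} (hx : |x| < R) (htT : t < T x) :
    ContinuousOn (extendInit f φ) (closedCone 0 (x, t)) := by
  intro z hz
  rcases hz.1.eq_or_lt with h | h
  · have e : z = (z.1, 0) := by rw [h]
    have hb := mem_baseBelow_of_mem_closedCone hx htT hz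
    have e1 : extendInit f φ z = f z.1 := if_neg (by rw [← h]; exact lt_irrefl _)
    rw [ContinuousWithinAt, e1]
    unfold extendInit
    refine Tendsto.if ?_ ?_
    · rw [nhdsWithin, inf_assoc, inf_principal, ← nhdsWithin]
      have h1 := h0 z.1 hb
      rw [← e] at h1
      exact h1.mono_left (nhdsWithin_mono _ fun y hy =>
        mem_domainBelow_of_mem_closedCone hx htT hy.1 hy.2)
    · rw [nhdsWithin, inf_assoc, inf_principal, ← nhdsWithin]
      have h1 : ContinuousWithinAt f (baseBelow R T) z.1 := hf z.1 hb
      exact h1.tendsto.comp (tendsto_nhdsWithin_iff.2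
        ⟨continuousAt_fst.tendsto.mono_left nhdsWithin_le_nhds,
          eventually_nhdsWithin_of_forall fun y hy =>
            mem_baseBelow_of_mem_closedCone hx htT hy.1⟩)
  · have h1 := mem_domainBelow_of_mem_closedCone hx htT hz h
    exact ((hφ.continuousAt (isOpen_domainBelow.mem_nhds h1)).congr
      (extendInit_eventuallyEq f φ h).symm).continuousWithinAt

/-- The source term is Lipschitz on bounded intervals. -/
theorem abs_source_sub_le {μ p M t w w' : ℝ} (hμ : 0 < μ) (hp : 1 < p) (ht : 0 ≤ t)
    (hw : |w| ≤ M) (hw' : |w'| ≤ M) :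
    |source μ p t w - source μ p t w'| ≤ ((2:ℝ) ^ (-p) * (p * M ^ (p - 1)) + μ) * |w - w'| := by
  have hd : ∀ y, HasDerivAt (source μ p t)
      ((2:ℝ) ^ (-p) * (p * |y| ^ (p - 2) * y) - μ / (1 + t) * (1 / 2)) y := fun y =>
    ((hasDerivAt_abs_rpow y hp).const_mul _).sub (((hasDerivAt_id y).div_const 2).const_mul _)
  refine (convex_Icc (-M) M).norm_image_sub_le_of_norm_hasDerivWithin_le
    (fun y _ => (hd y).hasDerivWithinAt) (fun y hy => ?_) (abs_le.1 hw') (abs_le.1 hw)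
  have h1 : |p * |y| ^ (p - 2) * y| ≤ p * M ^ (p - 1) := by
    rw [abs_mul, abs_mul, abs_of_pos (by linarith : 0 < p),
      abs_of_nonneg (Real.rpow_nonneg (abs_nonneg y) _), mul_assoc]
    refine mul_le_mul_of_nonneg_left ?_ (by linarith)
    rcases eq_or_ne y 0 with h | h
    · rw [h, abs_zero, mul_zero]
      exact Real.rpow_nonneg ((abs_nonneg w).trans hw) _
    · rw [← Real.rpow_add_one (abs_ne_zero.2 h), show p - 2 + 1 = p - 1 by ring]
      exact Real.rpow_le_rpow (abs_nonneg _) (abs_le.2 hy) (by linarith)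
  have h2 : μ / (1 + t) ≤ μ := div_le_self hμ.le (by linarith)
  have h3 : 0 ≤ μ / (1 + t) := div_nonneg hμ.le (by linarith)
  rw [Real.norm_eq_abs]
  refine (abs_sub _ _).trans (add_le_add ?_ ?_)
  · rw [abs_mul, abs_of_nonneg (by positivity : (0:ℝ) ≤ 2 ^ (-p))]
    exact mul_le_mul_of_nonneg_left h1 (by positivity)
  · rw [abs_of_nonneg (by positivity)]
    linarith

namespace IsSystemSolution

variable {μ p R Ts : ℝ} {f g S T : ℝ → ℝ} {φ ψ φ' ψ' : ℝ × ℝ → ℝ}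

theorem hasLineDerivAt_left (h : IsSystemSolution μ p f g R T φ ψ) {z : ℝ × ℝ}
    (hz : z ∈ domainBelow R T) : HasLineDerivAt ℝ φ (source μ p z.2 (φ z + ψ z)) z (-1, 1) := by
  have h1 := hasLineDerivAt_of_differentiableAt ((h.contDiffOn_left.contDiffAt
    (isOpen_domainBelow.mem_nhds hz)).differentiableAt (by norm_num)) (-1) 1
  rw [← h.eq_left z hz]
  convert h1 using 1
  rw [Dminus]; ring

theorem hasLineDerivAt_right (h : IsSystemSolution μ p f g R T φ ψ) {z : ℝ × ℝ}
    (hz : z ∈ domainBelow R T) : HasLineDerivAt ℝ ψ (source μ p z.2 (φ z + ψ z)) z (1, 1) := by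
  have h1 := hasLineDerivAt_of_differentiableAt ((h.contDiffOn_right.contDiffAt
    (isOpen_domainBelow.mem_nhds hz)).differentiableAt (by norm_num)) 1 1
  rw [← h.eq_right z hz]
  convert h1 using 1
  rw [Dplus]; ring

theorem continuousOn_sum (h : IsSystemSolution μ p f g R T φ ψ) :
    ContinuousOn (fun z => φ z + ψ z) (domainBelow R T) :=
  h.contDiffOn_left.continuousOn.add h.contDiffOn_right.continuousOn

/-- Two solutions with the same data agree below both curves. -/
theorem eq_of_lt (hμ : 0 < μ) (hp : 1 < p) (h : IsSystemSolution μ p f g R S φ ψ)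
    (h' : IsSystemSolution μ p f g R T φ' ψ')
    (hfS : ContinuousOn f (baseBelow R S)) (hgS : ContinuousOn g (baseBelow R S))
    (hfT : ContinuousOn f (baseBelow R T)) (hgT : ContinuousOn g (baseBelow R T))
    {x t : ℝ} (hx : |x| < R) (ht : 0 < t) (htS : t < S x) (htT : t < T x) :
    φ (x, t) = φ' (x, t) ∧ ψ (x, t) = ψ' (x, t) := by
  have c1 := continuousOn_extendInit hfS h.contDiffOn_left.continuousOn h.init_left hx htS
  have c2 := continuousOn_extendInit hgS h.contDiffOn_right.continuousOn h.init_right hx htS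
  have c3 := continuousOn_extendInit hfT h'.contDiffOn_left.continuousOn h'.init_left hx htT
  have c4 := continuousOn_extendInit hgT h'.contDiffOn_right.continuousOn h'.init_right hx htT
  -- Both sums are bounded on the compact cone, which provides a Lipschitz constant for the source.
  obtain ⟨M, hM⟩ := (isCompact_closedCone 0 (x, t)).exists_bound_of_continuousOn (c1.add c2)
  obtain ⟨M', hM'⟩ := (isCompact_closedCone 0 (x, t)).exists_bound_of_continuousOn (c3.add c4)
  have hmax : 0 ≤ max M M' :=
    le_max_of_le_left ((norm_nonneg _).trans (hM _ (apex_mem_closedCone ht.le)))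
  have hsrc : ∀ z ∈ closedCone 0 (x, t), 0 < z.2 →
      |source μ p z.2 (φ z + ψ z) - source μ p z.2 (φ' z + ψ' z)| ≤
      ((2:ℝ) ^ (-p) * (p * (max M M') ^ (p - 1)) + μ) *
        |extendInit f φ z - extendInit f φ' z + (extendInit g ψ z - extendInit g ψ' z)| := by
    intro z hz hz0
    have b1 := hM z hz
    have b2 := hM' z hz
    simp only [Pi.add_apply, extendInit, if_pos hz0, Real.norm_eq_abs] at b1 b2 ⊢
    rw [← add_sub_add_comm]
    exact abs_source_sub_le hμ hp hz0.le (b1.trans (le_max_left _ _)) (b2.trans (le_max_right _ _))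
  have key := eq_zero_of_abs_lineDeriv_le (t₀ := 0) (z₁ := (x, t))
    (a := fun z => extendInit f φ z - extendInit f φ' z)
    (b := fun z => extendInit g ψ z - extendInit g ψ' z)
    (by positivity) (c1.sub c3) (c2.sub c4)
    (fun z _ h0 => by simp [extendInit, h0]) (fun z _ h0 => by simp [extendInit, h0])
    (fun z hz hz0 => by
      have d1 := h.hasLineDerivAt_left (mem_domainBelow_of_mem_closedCone hx htS hz hz0)
      have d2 := h'.hasLineDerivAt_left (mem_domainBelow_of_mem_closedCone hx htT hz hz0)
      exact HasDerivAt.fun_sub (d1.congr_of_eventuallyEq (extendInit_eventuallyEq f φ hz0))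
        (d2.congr_of_eventuallyEq (extendInit_eventuallyEq f φ' hz0)))
    (fun z hz hz0 => by
      have d1 := h.hasLineDerivAt_right (mem_domainBelow_of_mem_closedCone hx htS hz hz0)
      have d2 := h'.hasLineDerivAt_right (mem_domainBelow_of_mem_closedCone hx htT hz hz0)
      exact HasDerivAt.fun_sub (d1.congr_of_eventuallyEq (extendInit_eventuallyEq g ψ hz0))
        (d2.congr_of_eventuallyEq (extendInit_eventuallyEq g ψ' hz0)))
    hsrc hsrc (x, t) (apex_mem_closedCone ht.le)
  simp only [extendInit, if_pos ht, sub_eq_zero] at key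
  exact key

/-- If `S x < T x`, then the second solution is continuous at `(x, S x)` and equals the first one
just below, which contradicts the blow-up of the latter. -/
theorem le_of_tendsto_atTop (hμ : 0 < μ) (hp : 1 < p) (h : IsSystemSolution μ p f g R S φ ψ)
    (h' : IsSystemSolution μ p f g R T φ' ψ')
    (hfS : ContinuousOn f (baseBelow R S)) (hgS : ContinuousOn g (baseBelow R S))
    (hfT : ContinuousOn f (baseBelow R T)) (hgT : ContinuousOn g (baseBelow R T))
    {x : ℝ} (hx : |x| < R) (hS : 0 < S x)
    (hblow : Tendsto (fun t => φ (x, t) + ψ (x, t)) (𝓝[<] (S x)) atTop) : T x ≤ S x := by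
  by_contra! hlt
  have h1 : ContinuousAt (fun z => φ' z + ψ' z) (x, S x) :=
    h'.continuousOn_sum.continuousAt (isOpen_domainBelow.mem_nhds (mem_domainBelow_of_lt hx hS hlt))
  have h2 : Tendsto (fun t => φ' (x, t) + ψ' (x, t)) (𝓝[<] (S x)) (𝓝 (φ' (x, S x) + ψ' (x, S x))) :=
    (h1.comp (f := fun t => (x, t)) (by fun_prop)).tendsto.mono_left nhdsWithin_le_nhds
  refine not_tendsto_nhds_of_tendsto_atTop hblow _ (h2.congr' ?_)
  filter_upwards [Ioo_mem_nhdsLT hS] with t ht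
  obtain ⟨e1, e2⟩ := eq_of_lt hμ hp h h' hfS hgS hfT hgT hx ht.1 ht.2 (ht.2.trans hlt)
  rw [e1, e2]

/-- The blow-up curve of `φ + ψ` is determined by the initial data. -/
theorem eqOn_of_tendsto_atTop (hμ : 0 < μ) (hp : 1 < p) (h : IsSystemSolution μ p f g R S φ ψ)
    (h' : IsSystemSolution μ p f g R T φ' ψ')
    (hf : ContinuousOn f (Metric.ball 0 (R + Ts))) (hg : ContinuousOn g (Metric.ball 0 (R + Ts)))
    (hS : ∀ x ∈ Metric.ball (0:ℝ) R, 0 < S x ∧ S x < Ts)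
    (hT : ∀ x ∈ Metric.ball (0:ℝ) R, 0 < T x ∧ T x < Ts)
    (hbS : ∀ x ∈ Metric.ball (0:ℝ) R,
      Tendsto (fun t => φ (x, t) + ψ (x, t)) (𝓝[<] (S x)) atTop)
    (hbT : ∀ x ∈ Metric.ball (0:ℝ) R,
      Tendsto (fun t => φ' (x, t) + ψ' (x, t)) (𝓝[<] (T x)) atTop) :
    EqOn S T (Metric.ball 0 R) := by
  intro x hx
  have hx' : |x| < R := by simpa using hx
  have fS := hf.mono (baseBelow_subset_ball hS)
  have gS := hg.mono (baseBelow_subset_ball hS)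
  have fT := hf.mono (baseBelow_subset_ball hT)
  have gT := hg.mono (baseBelow_subset_ball hT)
  exact le_antisymm (le_of_tendsto_atTop hμ hp h' h fT gT fS gS hx' (hT x hx).1 (hbT x hx))
    (le_of_tendsto_atTop hμ hp h h' fS gS fT gT hx' (hS x hx).1 (hbS x hx))

theorem congr_data {f' g' : ℝ → ℝ} (h : IsSystemSolution μ p f g R T φ ψ)
    (hf : EqOn f f' (baseBelow R T)) (hg : EqOn g g' (baseBelow R T)) :
    IsSystemSolution μ p f' g' R T φ ψ :=
  { h with
    init_left := fun x hx => hf hx ▸ h.init_left x hx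
    init_right := fun x hx => hg hx ▸ h.init_right x hx }

end IsSystemSolution

namespace IsBlowUpProfile

variable {p μ γ₁ γ₂ k B C T₁ : ℝ} {f g f' g' T : ℝ → ℝ} {τ : ℕ → ℝ → ℝ} {φ ψ : ℝ × ℝ → ℝ}

/-- A curve with Lipschitz constant below 1 stays above all light cones with apex on it, so the
union of the cones does not leave the region below the graph. -/
theorem lt_of_mem_domainBelow (P : IsBlowUpProfile p μ γ₁ γ₂ k B T₁ f g f' g' T τ φ ψ)
    (H : AdmissibleData p μ γ₁ γ₂ k B C f g f' g') {R : ℝ} {z : ℝ × ℝ}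
    (hz : z ∈ domainBelow R T) : z.2 < T z.1 := by
  obtain ⟨x, -, -, h⟩ := mem_domainBelow.1 hz
  have h1 := (P.lt_of_mem_cone H h).1
  have hk := H.hk
  have h2 : 0 < (k - 1) / k * (T x - z.2) :=
    mul_pos (div_pos (by linarith) (by linarith)) ((abs_nonneg _).trans_lt h)
  linarith

theorem isSystemSolution (P : IsBlowUpProfile p μ γ₁ γ₂ k B T₁ f g f' g' T τ φ ψ)
    (H : AdmissibleData p μ γ₁ γ₂ k B C f g f' g') (R : ℝ) :
    IsSystemSolution μ p f g R T φ ψ := by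
  have hreg : ∀ z ∈ domainBelow R T, IsRegularPoint p μ γ₁ γ₂ k φ ψ z := fun z hz =>
    P.isRegularPoint H (pos_of_mem_domainBelow hz) (P.lt_of_mem_domainBelow H hz)
  refine ⟨fun z hz => (hreg z hz).contDiffAt_left.contDiffWithinAt,
    fun z hz => (hreg z hz).contDiffAt_right.contDiffWithinAt,
    fun z hz => (hreg z hz).eq_left, fun z hz => (hreg z hz).eq_right, fun x _ => ?_, fun x _ => ?_⟩
  all_goals
    obtain ⟨n, φ', ψ', q, r, -, S, -, hev⟩ := P.local_eq (x, 0) le_rfl (P.pos x)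
    have hdom : ∀ᶠ y in 𝓝[domainBelow R T] (x, 0), φ y = φ' y ∧ ψ y = ψ' y := by
      filter_upwards [nhdsWithin_le_nhds hev, self_mem_nhdsWithin] with y hy hy'
        using hy (pos_of_mem_domainBelow hy').le
  · have h1 : Tendsto φ' (𝓝[domainBelow R T] (x, 0)) (𝓝 (φ' (x, 0))) :=
      S.contDiff_left.continuous.continuousAt.tendsto.mono_left nhdsWithin_le_nhds
    rw [S.init_left] at h1
    exact h1.congr' (hdom.mono fun y hy => hy.1.symm)
  · have h1 : Tendsto ψ' (𝓝[domainBelow R T] (x, 0)) (𝓝 (ψ' (x, 0))) :=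
      S.contDiff_right.continuous.continuousAt.tendsto.mono_left nhdsWithin_le_nhds
    rw [S.init_right] at h1
    exact h1.congr' (hdom.mono fun y hy => hy.2.symm)

theorem tendsto_sum_atTop (P : IsBlowUpProfile p μ γ₁ γ₂ k B T₁ f g f' g' T τ φ ψ) (x : ℝ) :
    Tendsto (fun t => φ (x, t) + ψ (x, t)) (𝓝[<] (T x)) atTop := by
  refine tendsto_atTop.2 fun b => ?_
  obtain ⟨n, hn⟩ := exists_nat_ge (b - (2 * B + 1))
  filter_upwards [Ioo_mem_nhdsLT (P.level_lt n x)] with t ht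
  linarith [P.level_le n x t ht.1.le ht.2]

/-- Both components blow up, since their time derivatives are comparable. -/
theorem tendsto_atTop_of_time_comparable {a b : ℝ × ℝ → ℝ} {x t₀ s c : ℝ} (hc : 0 < c)
    (ht : t₀ < s) (ha : ∀ t ∈ Ico t₀ s, DifferentiableAt ℝ a (x, t))
    (hb : ∀ t ∈ Ico t₀ s, DifferentiableAt ℝ b (x, t))
    (hcomp : ∀ t ∈ Ico t₀ s, c * dt b (x, t) ≤ dt a (x, t))
    (hsum : Tendsto (fun t => a (x, t) + b (x, t)) (𝓝[<] s) atTop) :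
    Tendsto (fun t => a (x, t)) (𝓝[<] s) atTop := by
  have hder : ∀ t ∈ Ico t₀ s, HasDerivAt (fun t => a (x, t) - c * b (x, t))
      (dt a (x, t) - c * dt b (x, t)) t := fun t h =>
    (hasDerivAt_time_slice (ha t h)).sub ((hasDerivAt_time_slice (hb t h)).const_mul c)
  -- Since `a - c b` is nondecreasing, `b` is bounded by a constant plus `a / c`, so the growth of
  -- the sum forces that of `a`.
  have hmono : MonotoneOn (fun t => a (x, t) - c * b (x, t)) (Ico t₀ s) := by
    refine monotoneOn_of_deriv_nonneg (convex_Ico _ _)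
      (fun t h => (hder t h).continuousAt.continuousWithinAt)
      (fun t h => (hder t (interior_subset h)).differentiableAt.differentiableWithinAt)
      (fun t h => ?_)
    rw [(hder t (interior_subset h)).deriv]
    linarith [hcomp t (interior_subset h)]
  refine tendsto_atTop.2 fun M => ?_
  filter_upwards [hsum.eventually_ge_atTop ((M * (1 + c) - (a (x, t₀) - c * b (x, t₀))) / c),
    Ioo_mem_nhdsLT ht] with t h1 h2
  have h3 := hmono (left_mem_Ico.2 ht) ⟨h2.1.le, h2.2⟩ h2.1.le
  rw [div_le_iff₀ hc] at h1
  simp only at h3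
  by_contra! h4
  nlinarith

theorem tendsto_atTop (P : IsBlowUpProfile p μ γ₁ γ₂ k B T₁ f g f' g' T τ φ ψ)
    (H : AdmissibleData p μ γ₁ γ₂ k B C f g f' g') (x : ℝ) :
    Tendsto (fun t => φ (x, t)) (𝓝[<] (T x)) atTop ∧
    Tendsto (fun t => ψ (x, t)) (𝓝[<] (T x)) atTop := by
  have hk := H.hk
  have hκ : 0 < k / (k - 1) := div_pos (by linarith) (by linarith)
  have hreg : ∀ t ∈ Ico (τ 0 x) (T x), IsRegularPoint p μ γ₁ γ₂ k φ ψ (x, t) := fun t h =>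
    P.isRegularPoint H ((P.level_pos 0 x).trans_le h.1) h.2
  have hl : ∀ t ∈ Ico (τ 0 x) (T x), DifferentiableAt ℝ φ (x, t) := fun t h =>
    (hreg t h).contDiffAt_left.differentiableAt (by norm_num)
  have hr : ∀ t ∈ Ico (τ 0 x) (T x), DifferentiableAt ℝ ψ (x, t) := fun t h =>
    (hreg t h).contDiffAt_right.differentiableAt (by norm_num)
  have hcmp : ∀ u v F : ℝ, F / 2 ≤ u → v ≤ k / (k - 1) * F → 1 / (2 * (k / (k - 1))) * v ≤ u := by
    intro u v F h1 h2
    rw [div_mul_eq_mul_div, one_mul, div_le_iff₀ (by positivity)]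
    nlinarith
  constructor
  · refine tendsto_atTop_of_time_comparable (c := 1 / (2 * (k / (k - 1)))) (by positivity)
      (P.level_lt 0 x) hl hr (fun t h => ?_) (P.tendsto_sum_atTop x)
    obtain ⟨h1, h2, h3, h4⟩ := (hreg t h).time_bounds H
    exact hcmp _ _ _ h1 h4
  · refine tendsto_atTop_of_time_comparable (c := 1 / (2 * (k / (k - 1)))) (by positivity)
      (P.level_lt 0 x) hr hl (fun t h => ?_) ?_
    · obtain ⟨h1, h2, h3, h4⟩ := (hreg t h).time_bounds H
      exact hcmp _ _ _ h2 h3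
    · simpa only [add_comm] using P.tendsto_sum_atTop x

end IsBlowUpProfile

end DampedWave
end

/-! ### From the wave equation to the system -/

noncomputable section

namespace DampedWave

/-- The open upper half plane `t > 0`. -/
def upperHalf : Set (ℝ × ℝ) := {z | 0 < z.2}

/-- Near a base point only the constraint `t > 0` is active, so limits at the initial line do not
depend on the curve. -/
theorem nhdsWithin_domainBelow {R : ℝ} {T : ℝ → ℝ} {y : ℝ} (hy : y ∈ baseBelow R T) :
    𝓝[domainBelow R T] (y, 0) = 𝓝[upperHalf] (y, 0) := by
  obtain ⟨x, hx, hyx⟩ := mem_baseBelow.1 hy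
  have hU : IsOpen {z : ℝ × ℝ | |z.1 - x| < T x - z.2} :=
    isOpen_lt (continuous_fst.sub continuous_const).abs (continuous_const.sub continuous_snd)
  refine nhdsWithin_eq_nhdsWithin (by simpa using hyx : (y, (0:ℝ)) ∈ _) hU ?_
  ext z
  exact ⟨fun h => ⟨pos_of_mem_domainBelow h.1, h.2⟩,
    fun h => ⟨mem_domainBelow.2 ⟨x, hx, h.1, h.2⟩, h.2⟩⟩

theorem eventually_upperHalf_iff {P : ℝ × ℝ → Prop} {x : ℝ} :
    (∀ᶠ z in 𝓝[upperHalf] (x, 0), P z) ↔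
      ∃ δ > 0, ∀ y t, |y - x| < δ → 0 < t → t < δ → P (y, t) := by
  rw [eventually_nhdsWithin_iff, Metric.eventually_nhds_iff]
  refine exists_congr fun δ => and_congr_right fun _ => ?_
  constructor
  · intro h y t hy ht htδ
    refine h (y := (y, t)) ?_ ht
    rw [Prod.dist_eq, max_lt_iff, Real.dist_eq, Real.dist_eq, sub_zero, abs_of_pos ht]
    exact ⟨hy, htδ⟩
  · intro h z hz ht
    rw [Prod.dist_eq, max_lt_iff, Real.dist_eq, Real.dist_eq, sub_zero] at hz
    exact h z.1 z.2 hz.1 ht ((le_abs_self _).trans_lt hz.2)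

/-- A function with bounded derivative along a characteristic family has limits on the line
`t = 0`. -/
theorem exists_tendsto_of_char_bound {a : ℝ × ℝ → ℝ} {x c K : ℝ} (hc : |c| ≤ 1) (hK : 0 < K)
    (h : ∀ᶠ z in 𝓝[upperHalf] (x, 0),
      DifferentiableAt ℝ a z ∧ |c * dx a z + dt a z| ≤ K) :
    ∃ l, Tendsto a (𝓝[upperHalf] (x, 0)) (𝓝 l) := by
  obtain ⟨δ, hδ, hbox⟩ := eventually_upperHalf_iff.1 h
  have hne : (𝓝[upperHalf] ((x, 0) : ℝ × ℝ)).NeBot := by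
    rw [← frequently_true_iff_neBot]
    intro hfalse
    obtain ⟨ε, hε, h1⟩ := eventually_upperHalf_iff.1 hfalse
    exact h1 x (ε / 2) (by simpa using hε) (half_pos hε) (half_lt_self hε) trivial
  -- The reference value is taken at the end, at time `η`, of the characteristic through `(x, 0)`.
  -- From a nearby point the parallel characteristic changes `a` by at most `K η` and ends close to
  -- the reference point, where `a` is continuous.
  have hosc : ∀ ε > 0, ∃ v, ∀ᶠ z in 𝓝[upperHalf] (x, 0), |a z - v| < ε := by
    intro ε hε
    set η := min (δ / 2) (ε / (2 * K)) with hη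
    have hη0 : 0 < η := lt_min (half_pos hδ) (by positivity)
    have hη1 : 2 * η ≤ δ := by linarith [min_le_left (δ / 2) (ε / (2 * K))]
    have hη2 : K * η ≤ ε / 2 := by
      have := min_le_right (δ / 2) (ε / (2 * K))
      rw [← hη, le_div_iff₀ (by positivity)] at this
      linarith
    have hcη : |c * η| ≤ η := by
      rw [abs_mul, abs_of_pos hη0]
      nlinarith
    refine ⟨a (x + c * η, η), ?_⟩
    have hcont : ContinuousAt a (x + c * η, η) :=
      (hbox _ _ (by rw [add_sub_cancel_left]; linarith) hη0 (by linarith)).1.continuousAt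
    have h2 : Tendsto (fun z : ℝ × ℝ => a (z.1 + c * (η - z.2), η)) (𝓝 (x, 0))
        (𝓝 (a (x + c * η, η))) := by
      have h3 : Tendsto (fun z : ℝ × ℝ => (z.1 + c * (η - z.2), η)) (𝓝 (x, 0))
          (𝓝 (x + c * η, η)) := by
        have : Continuous fun z : ℝ × ℝ => (z.1 + c * (η - z.2), η) := by fun_prop
        simpa using this.tendsto (x, 0)
      exact hcont.tendsto.comp h3
    have h4 : ∀ᶠ z in 𝓝[upperHalf] ((x, 0) : ℝ × ℝ), |z.1 - x| < η ∧ 0 < z.2 ∧ z.2 < η :=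
      eventually_upperHalf_iff.2 ⟨η, hη0, fun y t hy ht htη => ⟨hy, ht, htη⟩⟩
    filter_upwards [nhdsWithin_le_nhds ((Metric.tendsto_nhds.1 h2) (ε / 2) (half_pos hε)), h4]
      with z hz ⟨hz1, hz2, hz3⟩
    rw [Real.dist_eq] at hz
    have hpt : ∀ t ∈ Icc z.2 η, DifferentiableAt ℝ a (z.1 + c * (t - z.2), t) ∧
        |c * dx a (z.1 + c * (t - z.2), t) + dt a (z.1 + c * (t - z.2), t)| ≤ K := by
      intro t ht
      refine hbox _ _ ?_ (hz2.trans_le ht.1) (by linarith [ht.2])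
      have h5 : |c * (t - z.2)| ≤ η := by
        rw [abs_mul, abs_of_nonneg (sub_nonneg.2 ht.1)]
        have := sub_nonneg.2 ht.1
        nlinarith [ht.2, abs_nonneg c]
      have h6 := abs_add_le (z.1 - x) (c * (t - z.2))
      rw [show z.1 + c * (t - z.2) - x = z.1 - x + c * (t - z.2) by ring]
      linarith
    have hder : ∀ t ∈ Icc z.2 η, HasDerivWithinAt (fun t => a (z.1 + c * (t - z.2), t))
        (c * dx a (z.1 + c * (t - z.2), t) + dt a (z.1 + c * (t - z.2), t)) (Icc z.2 η) t := by
      intro t ht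
      have h5 : HasDerivAt (fun t : ℝ => (z.1 + c * (t - z.2), t)) (c, 1) t := by
        refine HasDerivAt.prodMk ?_ (hasDerivAt_id t)
        simpa using (((hasDerivAt_id t).sub_const z.2).const_mul c).const_add z.1
      have h6 := HasFDerivAt.comp_hasDerivAt (f := fun t : ℝ => (z.1 + c * (t - z.2), t)) t
        (hpt t ht).1.hasFDerivAt h5
      rw [fderiv_apply_eq, one_mul] at h6
      exact h6.hasDerivWithinAt
    have h7 := (convex_Icc z.2 η).norm_image_sub_le_of_norm_hasDerivWithin_le hder
      (fun t ht => (hpt t ht).2) (left_mem_Icc.2 hz3.le) (right_mem_Icc.2 hz3.le)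
    simp only [sub_self, mul_zero, add_zero, Real.norm_eq_abs, Prod.mk.eta] at h7
    rw [abs_of_pos (sub_pos.2 hz3), abs_sub_comm] at h7
    have h8 := abs_sub_le (a z) (a (z.1 + c * (η - z.2), η)) (a (x + c * η, η))
    nlinarith
  refine cauchy_map_iff_exists_tendsto.1 (Metric.cauchy_iff.2 ⟨hne.map a, fun ε hε => ?_⟩)
  obtain ⟨v, hv⟩ := hosc (ε / 2) (half_pos hε)
  refine ⟨Metric.ball v (ε / 2), ?_, fun y hy y' hy' => ?_⟩
  · exact mem_map.2 (hv.mono fun z hz => by rwa [Metric.mem_ball, Real.dist_eq])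
  · have := dist_triangle_right y y' v
    rw [Metric.mem_ball] at hy hy'
    linarith

/-- The space derivative passes to the limit on the line `t = 0`. -/
theorem hasDerivAt_of_tendsto_dx {u : ℝ × ℝ → ℝ} {u₀ : ℝ → ℝ} {x v : ℝ}
    (hd : ∀ᶠ z in 𝓝[upperHalf] (x, 0), DifferentiableAt ℝ u z)
    (hv : Tendsto (dx u) (𝓝[upperHalf] (x, 0)) (𝓝 v))
    (h0 : ∀ᶠ y in 𝓝 x, Tendsto u (𝓝[upperHalf] (y, 0)) (𝓝 (u₀ y))) : HasDerivAt u₀ v x := by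
  rw [hasDerivAt_iff_isLittleO, Asymptotics.isLittleO_iff]
  intro ε hε
  obtain ⟨δ, hδ, hbox⟩ := eventually_upperHalf_iff.1
    (hd.and ((Metric.tendsto_nhds.1 hv) ε hε))
  filter_upwards [h0, Metric.ball_mem_nhds x hδ] with y hy hyx
  have hslice : ∀ y, Tendsto (fun t : ℝ => (y, t)) (𝓝[>] 0) (𝓝[upperHalf] (y, 0)) := fun y =>
    tendsto_nhdsWithin_iff.2 ⟨((by fun_prop : Continuous fun t : ℝ => (y, t)).tendsto
      0).mono_left nhdsWithin_le_nhds, self_mem_nhdsWithin⟩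
  have h1 := (hy.comp (hslice y)).sub (h0.self_of_nhds.comp (hslice x))
  have h2 := (h1.sub_const ((y - x) * v)).norm
  simp only [smul_eq_mul]
  refine le_of_tendsto h2 ?_
  filter_upwards [Ioo_mem_nhdsGT hδ] with t ht
  have hder : ∀ y' ∈ Metric.ball x δ, HasDerivWithinAt (fun y' => u (y', t) - y' * v)
      (dx u (y', t) - v) (Metric.ball x δ) y' := fun y' hy' => by
    have h3 := hasDerivAt_space_slice (hbox y' t hy' ht.1 ht.2).1
    simpa using (h3.fun_sub ((hasDerivAt_id' y').mul_const v)).hasDerivWithinAt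
  have h4 := (convex_ball x δ).norm_image_sub_le_of_norm_hasDerivWithin_le (C := ε) hder
    (fun y' hy' => le_of_lt (by simpa [Real.dist_eq] using (hbox y' t hy' ht.1 ht.2).2))
    (Metric.mem_ball_self hδ) hyx
  refine le_trans (le_of_eq ?_) h4
  simp only [Function.comp]
  congr 1
  ring

theorem source_two_mul (μ p t v : ℝ) : source μ p t (2 * v) = |v| ^ p - μ / (1 + t) * v := by
  rw [source, abs_mul, Real.mul_rpow (by norm_num) (abs_nonneg _), abs_two, ← mul_assoc,
    ← Real.rpow_add two_pos, neg_add_cancel, Real.rpow_zero, one_mul]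
  ring

namespace IsWaveSolution

variable {μ p R : ℝ} {u₀ u₁ f g T : ℝ → ℝ} {u : ℝ × ℝ → ℝ}

theorem contDiffOn_dx (h : IsWaveSolution μ p u₀ u₁ R T u) :
    ContDiffOn ℝ 1 (dx u) (domainBelow R T) :=
  (h.contDiffOn.fderiv_of_isOpen isOpen_domainBelow (by norm_num)).clm_apply contDiffOn_const

theorem contDiffOn_dt (h : IsWaveSolution μ p u₀ u₁ R T u) :
    ContDiffOn ℝ 1 (dt u) (domainBelow R T) :=
  (h.contDiffOn.fderiv_of_isOpen isOpen_domainBelow (by norm_num)).clm_apply contDiffOn_const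

theorem dt_dx (h : IsWaveSolution μ p u₀ u₁ R T u) {z : ℝ × ℝ} (hz : z ∈ domainBelow R T) :
    dt (dx u) z = dx (dt u) z := by
  have hz' := isOpen_domainBelow.mem_nhds hz
  have h1 : DifferentiableAt ℝ (fderiv ℝ u) z :=
    ((h.contDiffOn.fderiv_of_isOpen isOpen_domainBelow (m := 1)
      (by norm_num)).contDiffAt hz').differentiableAt (by norm_num)
  have h2 := (h.contDiffOn.contDiffAt hz').isSymmSndFDerivAt (by simp) (1, 0) (0, 1)
  have h3 : ∀ e v : ℝ × ℝ, fderiv ℝ (fun z => fderiv ℝ u z e) z v = fderiv ℝ (fderiv ℝ u) z v e := by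
    intro e v
    rw [fderiv_clm_apply h1 (differentiableAt_const e)]
    simp
  exact ((h3 (1, 0) (0, 1)).trans h2.symm).trans (h3 (0, 1) (1, 0)).symm

theorem char_left (h : IsWaveSolution μ p u₀ u₁ R T u) {z : ℝ × ℝ} (hz : z ∈ domainBelow R T) :
    Dminus (fun z => dt u z + dx u z) z = source μ p z.2 (2 * dt u z) := by
  have hz' := isOpen_domainBelow.mem_nhds hz
  have d1 := (h.contDiffOn_dt.contDiffAt hz').differentiableAt (by norm_num)
  have d2 := (h.contDiffOn_dx.contDiffAt hz').differentiableAt (by norm_num)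
  rw [Dminus, dt_add d1 d2, dx_add d1 d2, h.dt_dx hz, source_two_mul, ← h.eq z hz]
  ring

theorem char_right (h : IsWaveSolution μ p u₀ u₁ R T u) {z : ℝ × ℝ} (hz : z ∈ domainBelow R T) :
    Dplus (fun z => dt u z - dx u z) z = source μ p z.2 (2 * dt u z) := by
  have hz' := isOpen_domainBelow.mem_nhds hz
  have d1 := (h.contDiffOn_dt.contDiffAt hz').differentiableAt (by norm_num)
  have d2 := (h.contDiffOn_dx.contDiffAt hz').differentiableAt (by norm_num)
  have e1 : dt (fun z => dt u z - dx u z) z = dt (dt u) z - dt (dx u) z := by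
    rw [dt, fderiv_fun_sub d1 d2]; rfl
  have e2 : dx (fun z => dt u z - dx u z) z = dx (dt u) z - dx (dx u) z := by
    rw [dx, fderiv_fun_sub d1 d2]; rfl
  rw [Dplus, e1, e2, h.dt_dx hz, source_two_mul, ← h.eq z hz]
  ring

/-- The characteristic derivatives of a solution of the damped wave equation solve the system. -/
theorem isSystemSolution (hμ : 0 < μ) (hp : 1 < p) (h : IsWaveSolution μ p u₀ u₁ R T u)
    (hf : ∀ x ∈ baseBelow R T, f x = u₁ x + deriv u₀ x)
    (hg : ∀ x ∈ baseBelow R T, g x = u₁ x - deriv u₀ x) :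
    IsSystemSolution μ p f g R T (fun z => dt u z + dx u z) (fun z => dt u z - dx u z) := by
  have hsum : ∀ z, dt u z + dx u z + (dt u z - dx u z) = 2 * dt u z := fun z => by ring
  -- Initial values are prescribed for `u` and `∂ₜu` only; that `∂ₓu` attains the derivative of `u₀`
  -- has to be derived from the equation.
  have hlim : ∀ x ∈ baseBelow R T,
      Tendsto (dx u) (𝓝[domainBelow R T] (x, 0)) (𝓝 (deriv u₀ x)) := by
    intro x hx
    have ht := h.init_dt x hx
    have hdom : ∀ᶠ z in 𝓝[domainBelow R T] ((x, 0) : ℝ × ℝ), z ∈ domainBelow R T :=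
      self_mem_nhdsWithin
    have hopen : IsOpen (baseBelow R T) := isOpen_biUnion fun _ _ => Metric.isOpen_ball
    -- Near the base point `∂ₜu` is bounded because it converges. Hence the source, which is the
    -- characteristic derivative of `∂ₜu + ∂ₓu`, is bounded and the limit exists.
    obtain ⟨l, hl⟩ : ∃ l, Tendsto (fun z => dt u z + dx u z) (𝓝[upperHalf] (x, 0)) (𝓝 l) := by
      refine exists_tendsto_of_char_bound (c := -1) (by norm_num)
        (K := ((2:ℝ) ^ (-p) * (p * (2 * (|u₁ x| + 1)) ^ (p - 1)) + μ) * (2 * (|u₁ x| + 1)))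
        (by positivity) ?_
      rw [← nhdsWithin_domainBelow hx]
      filter_upwards [hdom, (Metric.tendsto_nhds.1 ht) 1 one_pos] with z hz hz1
      have hz' := isOpen_domainBelow.mem_nhds hz
      refine ⟨((h.contDiffOn_dt.add h.contDiffOn_dx).contDiffAt hz').differentiableAt (by norm_num),
        ?_⟩
      have e : -1 * dx (fun z => dt u z + dx u z) z + dt (fun z => dt u z + dx u z) z =
          source μ p z.2 (2 * dt u z) := by
        rw [← h.char_left hz, Dminus]; ring
      rw [Real.dist_eq] at hz1
      have hw : |2 * dt u z| ≤ 2 * (|u₁ x| + 1) := by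
        rw [abs_mul, abs_two]
        have := abs_sub_abs_le_abs_sub (dt u z) (u₁ x)
        linarith
      have h0 : source μ p z.2 0 = 0 := by
        simp [source, Real.zero_rpow (by linarith : p ≠ 0)]
      have h1 := abs_source_sub_le hμ hp (pos_of_mem_domainBelow hz).le hw
        (w' := 0) (by rw [abs_zero]; positivity)
      rw [h0, sub_zero, sub_zero] at h1
      rw [e]
      exact h1.trans (mul_le_mul_of_nonneg_left hw (by positivity))
    have hdx : Tendsto (dx u) (𝓝[upperHalf] (x, 0)) (𝓝 (l - u₁ x)) := by
      rw [nhdsWithin_domainBelow hx] at ht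
      simpa using hl.sub ht
    have hder := hasDerivAt_of_tendsto_dx (u₀ := u₀)
      (by
        rw [← nhdsWithin_domainBelow hx]
        filter_upwards [hdom] with z hz
        exact (h.contDiffOn.contDiffAt (isOpen_domainBelow.mem_nhds hz)).differentiableAt
          (by norm_num)) hdx
      (by
        filter_upwards [hopen.mem_nhds hx] with y hy
        rw [← nhdsWithin_domainBelow hy]
        exact h.init y hy)
    rw [nhdsWithin_domainBelow hx, hder.deriv]
    exact hdx
  refine ⟨h.contDiffOn_dt.add h.contDiffOn_dx, h.contDiffOn_dt.sub h.contDiffOn_dx,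
    fun z hz => ?_, fun z hz => ?_, fun x hx => ?_, fun x hx => ?_⟩
  · rw [hsum, h.char_left hz]
  · rw [hsum, h.char_right hz]
  · rw [hf x hx]
    exact (h.init_dt x hx).add (hlim x hx)
  · rw [hg x hx]
    exact (h.init_dt x hx).sub (hlim x hx)

end IsWaveSolution

end DampedWave
end

/-! ### From the system to the wave equation -/

noncomputable section

namespace DampedWave

/-- The differential `(φ - ψ) / 2 dx + (φ + ψ) / 2 dt` of the solution of the wave equation. -/
def potentialForm (φ ψ : ℝ × ℝ → ℝ) (z : ℝ × ℝ) : ℝ × ℝ →L[ℝ] ℝ :=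
  ((φ z - ψ z) / 2) • ContinuousLinearMap.fst ℝ ℝ ℝ +
    ((φ z + ψ z) / 2) • ContinuousLinearMap.snd ℝ ℝ ℝ

theorem potentialForm_apply (φ ψ : ℝ × ℝ → ℝ) (z v : ℝ × ℝ) :
    potentialForm φ ψ z v = (φ z - ψ z) / 2 * v.1 + (φ z + ψ z) / 2 * v.2 := by
  simp [potentialForm]

/-- The form is closed since `∂ₜ(φ - ψ) = ∂ₓ(φ + ψ)` says exactly that `D₋φ = D₊ψ`. The truncated
solution is used because it lives on the whole plane, where the Poincaré lemma applies; the additive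
constant is fixed on the line `t = 0`. -/
theorem IsC1Solution.exists_potential {f g f' g' U : ℝ → ℝ} {G V : ℝ → ℝ → ℝ}
    {φ ψ q r : ℝ × ℝ → ℝ} (S : IsC1Solution f g f' g' G V φ ψ q r)
    (hU : ∀ x, HasDerivAt U ((f x - g x) / 2) x) :
    ∃ u, (∀ z, HasFDerivAt u (potentialForm φ ψ z) z) ∧ ∀ x, u (x, 0) = U x := by
  have hω : ∀ z, HasFDerivAt (potentialForm φ ψ)
      (((2:ℝ)⁻¹ • (fderiv ℝ φ z - fderiv ℝ ψ z)).smulRight (ContinuousLinearMap.fst ℝ ℝ ℝ) +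
        ((2:ℝ)⁻¹ • (fderiv ℝ φ z + fderiv ℝ ψ z)).smulRight (ContinuousLinearMap.snd ℝ ℝ ℝ)) z := by
    intro z
    have d1 := (S.differentiable_left z).hasFDerivAt
    have d2 := (S.differentiable_right z).hasFDerivAt
    have h1 := ((d1.fun_sub d2).const_mul (2:ℝ)⁻¹).smul_const (ContinuousLinearMap.fst ℝ ℝ ℝ)
    have h2 := ((d1.fun_add d2).const_mul (2:ℝ)⁻¹).smul_const (ContinuousLinearMap.snd ℝ ℝ ℝ)
    refine (h1.fun_add h2).congr_of_eventuallyEq (Eventually.of_forall fun y => ?_)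
    simp only [potentialForm]
    congr 2 <;> ring
  obtain ⟨v, hv⟩ := convex_univ.exists_forall_hasFDerivAt_of_fderiv_symmetric isOpen_univ
    (fun z _ => (hω z).differentiableAt.differentiableWithinAt) (fun z _ x y => by
      have e1 := congrFun S.dt_left_eq z
      have e2 := congrFun S.dt_right_eq z
      have e3 := congrFun S.dx_left_eq z
      have e4 := congrFun S.dx_right_eq z
      obtain ⟨x1, x2⟩ := x
      obtain ⟨y1, y2⟩ := y
      rw [(hω z).fderiv]
      simp only [add_apply, ContinuousLinearMap.smulRight_apply, smul_apply, sub_apply,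
        fderiv_apply_eq, ContinuousLinearMap.coe_fst', ContinuousLinearMap.coe_snd', smul_eq_mul]
      rw [e1, e2, e3, e4]
      ring)
  have hconst : ∀ x, v (x, 0) - U x = v (0, 0) - U 0 := by
    have hder : ∀ x, HasDerivAt (fun x => v (x, 0) - U x) 0 x := fun x => by
      have h1 := HasFDerivAt.comp_hasDerivAt (f := fun x : ℝ => (x, (0:ℝ))) x (hv (x, 0) trivial)
        ((hasDerivAt_id x).prodMk (hasDerivAt_const x (0:ℝ)))
      refine (h1.sub (hU x)).congr_deriv ?_
      rw [potentialForm_apply, S.init_left, S.init_right]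
      ring
    exact fun x => is_const_of_deriv_eq_zero (fun x => (hder x).differentiableAt)
      (fun x => (hder x).deriv) x 0
  refine ⟨fun z => v z - (v (0, 0) - U 0), fun z => (hv z trivial).sub_const _, fun x => ?_⟩
  linarith [hconst x]

/-- The solution of the wave equation with initial value `U` and time derivative `(φ + ψ) / 2`. -/
def wavePotential (U : ℝ → ℝ) (φ ψ : ℝ × ℝ → ℝ) (z : ℝ × ℝ) : ℝ :=
  U z.1 + ∫ s in (0:ℝ)..z.2, (φ (z.1, s) + ψ (z.1, s)) / 2

namespace IsBlowUpProfile

variable {p μ γ₁ γ₂ k B C T₁ : ℝ} {f g f' g' T U : ℝ → ℝ} {τ : ℕ → ℝ → ℝ}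
  {φ ψ φ' ψ' q r : ℝ × ℝ → ℝ}

theorem eq_truncated (P : IsBlowUpProfile p μ γ₁ γ₂ k B T₁ f g f' g' T τ φ ψ)
    (H : AdmissibleData p μ γ₁ γ₂ k B C f g f' g') {n : ℝ} (hn : γ₁ + γ₂ ≤ n)
    (S : IsC1Solution f g f' g' (truncSource p μ (γ₁ + γ₂) n) (truncSlope p μ (γ₁ + γ₂) n)
      φ' ψ' q r) {z : ℝ × ℝ} (hz : 0 ≤ z.2) (hzT : z.2 < T z.1) (h : φ' z + ψ' z ≤ n) :
    φ z = φ' z ∧ ψ z = ψ' z := by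
  obtain ⟨m, φ₂, ψ₂, q₂, r₂, hm, S₂, hlt, hev⟩ := P.local_eq z hz hzT
  obtain ⟨e1, e2⟩ := hev.self_of_nhds hz
  rw [e1, e2]
  rcases le_total n m with hnm | hnm
  · obtain ⟨e3, e4⟩ := H.truncated_eq hn hm S S₂ hz h (h.trans hnm)
    exact ⟨e3.symm, e4.symm⟩
  · exact H.truncated_eq hm hn S₂ S hz hlt.le (hlt.le.trans hnm)

/-- The truncated sum increases in time, so on the vertical segment below `z` it stays under the
truncation level and may replace the original integrand. -/
theorem wavePotential_eq (P : IsBlowUpProfile p μ γ₁ γ₂ k B T₁ f g f' g' T τ φ ψ)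
    (H : AdmissibleData p μ γ₁ γ₂ k B C f g f' g') {n : ℝ} (hn : γ₁ + γ₂ ≤ n)
    (S : IsC1Solution f g f' g' (truncSource p μ (γ₁ + γ₂) n) (truncSlope p μ (γ₁ + γ₂) n)
      φ' ψ' q r) {u : ℝ × ℝ → ℝ} (hu : ∀ z, HasFDerivAt u (potentialForm φ' ψ' z) z)
    (hu0 : ∀ x, u (x, 0) = U x) {z : ℝ × ℝ} (hz : 0 ≤ z.2) (hzT : z.2 < T z.1)
    (h : φ' z + ψ' z ≤ n) : wavePotential U φ ψ z = u z := by
  have h1 : ∫ s in (0:ℝ)..z.2, (φ (z.1, s) + ψ (z.1, s)) / 2 =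
      ∫ s in (0:ℝ)..z.2, (φ' (z.1, s) + ψ' (z.1, s)) / 2 := by
    refine intervalIntegral.integral_congr fun s hs => ?_
    rw [uIcc_of_le hz] at hs
    have hle : φ' (z.1, s) + ψ' (z.1, s) ≤ φ' z + ψ' z := by
      refine H.sum_le_of_timelike hn S hs.1 ?_
      rw [sub_self, abs_zero]
      exact mul_nonneg (by linarith [H.hk]) (sub_nonneg.2 hs.2)
    obtain ⟨e1, e2⟩ := P.eq_truncated H hn S (z := (z.1, s)) hs.1 (hs.2.trans_lt hzT)
      (hle.trans h)
    simp only [e1, e2]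
  have h2 : ∫ s in (0:ℝ)..z.2, (φ' (z.1, s) + ψ' (z.1, s)) / 2 = u (z.1, z.2) - u (z.1, 0) := by
    refine intervalIntegral.integral_eq_sub_of_hasDerivAt (f := fun s => u (z.1, s))
      (fun s _ => ?_) ?_
    · have h3 := HasFDerivAt.comp_hasDerivAt (f := fun s : ℝ => (z.1, s)) s (hu (z.1, s))
        ((hasDerivAt_const s z.1).prodMk (hasDerivAt_id s))
      refine h3.congr_deriv ?_
      rw [potentialForm_apply]
      ring
    · have h4 := S.continuous_sum
      exact ((h4.comp (by fun_prop : Continuous fun s : ℝ => (z.1, s))).div_const 2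
        ).intervalIntegrable _ _
  rw [wavePotential, h1, h2, hu0]
  simp

/-- One local potential serves both for interior differentiability and for the limit at the initial
line, which is why `z.2 = 0` is allowed. -/
theorem wavePotential_local_eq (P : IsBlowUpProfile p μ γ₁ γ₂ k B T₁ f g f' g' T τ φ ψ)
    (H : AdmissibleData p μ γ₁ γ₂ k B C f g f' g') (hU : ∀ x, HasDerivAt U ((f x - g x) / 2) x)
    {z : ℝ × ℝ} (hz : 0 ≤ z.2) (hzT : z.2 < T z.1) :
    ∃ u, Continuous u ∧ (∀ x, u (x, 0) = U x) ∧ ∀ᶠ y in 𝓝 z, 0 ≤ y.2 →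
      wavePotential U φ ψ y = u y ∧ HasFDerivAt u (potentialForm φ ψ y) y := by
  obtain ⟨n, φ', ψ', q, r, hn, S, hlt, -⟩ := P.local_eq z hz hzT
  obtain ⟨u, hu, hu0⟩ := S.exists_potential hU
  refine ⟨u, continuous_iff_continuousAt.2 fun y => (hu y).continuousAt, hu0, ?_⟩
  have hT : Continuous fun y : ℝ × ℝ => T y.1 := (P.contDiff H).continuous.comp continuous_fst
  filter_upwards [S.continuous_sum.continuousAt.eventually_lt_const hlt,
    continuousAt_snd.eventually_lt hT.continuousAt hzT] with y h1 h2 hy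
  refine ⟨P.wavePotential_eq H hn S hu hu0 hy h2 h1.le, ?_⟩
  obtain ⟨e1, e2⟩ := P.eq_truncated H hn S hy h2 h1.le
  have := hu y
  rwa [potentialForm, ← e1, ← e2, ← potentialForm] at this

end IsBlowUpProfile

/-- A potential of a solution of the system solves the damped wave equation. -/
theorem IsSystemSolution.isWaveSolution {μ p R : ℝ} {f g T u₀ u₁ : ℝ → ℝ} {φ ψ u : ℝ × ℝ → ℝ}
    (h : IsSystemSolution μ p f g R T φ ψ)
    (hu : ∀ z ∈ domainBelow R T, HasFDerivAt u (potentialForm φ ψ z) z)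
    (hinit : ∀ x ∈ baseBelow R T, Tendsto u (𝓝[domainBelow R T] (x, 0)) (𝓝 (u₀ x)))
    (hu₁ : ∀ x ∈ baseBelow R T, (f x + g x) / 2 = u₁ x) :
    IsWaveSolution μ p u₀ u₁ R T u ∧ ∀ z ∈ domainBelow R T, dt u z = (φ z + ψ z) / 2 := by
  have hdt : EqOn (dt u) (fun z => 2⁻¹ * (φ z + ψ z)) (domainBelow R T) := fun z hz => by
    simp only [dt]
    rw [(hu z hz).fderiv, potentialForm_apply]
    ring
  have hdx : EqOn (dx u) (fun z => 2⁻¹ * (φ z - ψ z)) (domainBelow R T) := fun z hz => by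
    simp only [dx]
    rw [(hu z hz).fderiv, potentialForm_apply]
    ring
  refine ⟨⟨?_, fun z hz => ?_, hinit, fun x hx => ?_⟩, fun z hz => by rw [hdt hz]; ring⟩
  · rw [show (2 : WithTop ℕ∞) = 1 + 1 by norm_num,
      contDiffOn_succ_iff_fderiv_of_isOpen isOpen_domainBelow]
    refine ⟨fun z hz => (hu z hz).differentiableAt.differentiableWithinAt, by simp, ?_⟩
    have h1 : ContDiffOn ℝ 1 (potentialForm φ ψ) (domainBelow R T) :=
      (((h.contDiffOn_left.sub h.contDiffOn_right).div_const 2).smul contDiffOn_const).add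
        (((h.contDiffOn_left.add h.contDiffOn_right).div_const 2).smul contDiffOn_const)
    exact h1.congr fun z hz => (hu z hz).fderiv
  · have hz' := isOpen_domainBelow.mem_nhds hz
    have d1 := (h.contDiffOn_left.contDiffAt hz').differentiableAt (by norm_num)
    have d2 := (h.contDiffOn_right.contDiffAt hz').differentiableAt (by norm_num)
    have e1 : dt (dt u) z = 2⁻¹ * (dt φ z + dt ψ z) := by
      rw [dt_congr (hdt.eventuallyEq_of_mem hz'), dt, fderiv_const_mul (d1.fun_add d2),
        fderiv_fun_add d1 d2]
      rfl
    have e2 : dx (dx u) z = 2⁻¹ * (dx φ z - dx ψ z) := by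
      rw [dx_congr (hdx.eventuallyEq_of_mem hz'), dx, fderiv_const_mul (d1.fun_sub d2),
        fderiv_fun_sub d1 d2]
      rfl
    have e3 := h.eq_left z hz
    have e4 := h.eq_right z hz
    rw [show φ z + ψ z = 2 * dt u z by rw [hdt hz]; ring, source_two_mul] at e3 e4
    rw [Dminus] at e3
    rw [Dplus] at e4
    rw [e1, e2]
    linarith
  · rw [← hu₁ x hx]
    have h1 := ((h.init_left x hx).add (h.init_right x hx)).div_const 2
    refine h1.congr' ?_
    filter_upwards [self_mem_nhdsWithin] with z hz
    rw [hdt hz]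
    ring

namespace IsBlowUpProfile

variable {p μ γ₁ γ₂ k B C T₁ : ℝ} {f g f' g' T U : ℝ → ℝ} {τ : ℕ → ℝ → ℝ} {φ ψ : ℝ × ℝ → ℝ}

theorem hasFDerivAt_wavePotential (P : IsBlowUpProfile p μ γ₁ γ₂ k B T₁ f g f' g' T τ φ ψ)
    (H : AdmissibleData p μ γ₁ γ₂ k B C f g f' g') (hU : ∀ x, HasDerivAt U ((f x - g x) / 2) x)
    {z : ℝ × ℝ} (hz : 0 < z.2) (hzT : z.2 < T z.1) :
    HasFDerivAt (wavePotential U φ ψ) (potentialForm φ ψ z) z := by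
  obtain ⟨u, -, -, hev⟩ := P.wavePotential_local_eq H hU hz.le hzT
  refine (hev.self_of_nhds hz.le).2.congr_of_eventuallyEq ?_
  filter_upwards [hev, continuousAt_snd.eventually_const_lt hz] with y h1 h2 using (h1 h2.le).1

theorem tendsto_wavePotential (P : IsBlowUpProfile p μ γ₁ γ₂ k B T₁ f g f' g' T τ φ ψ)
    (H : AdmissibleData p μ γ₁ γ₂ k B C f g f' g') (hU : ∀ x, HasDerivAt U ((f x - g x) / 2) x)
    (R x : ℝ) : Tendsto (wavePotential U φ ψ) (𝓝[domainBelow R T] (x, 0)) (𝓝 (U x)) := by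
  obtain ⟨u, hu, hu0, hev⟩ := P.wavePotential_local_eq H hU (z := (x, 0)) le_rfl (P.pos x)
  rw [← hu0]
  refine (hu.continuousAt.tendsto.mono_left nhdsWithin_le_nhds).congr' ?_
  filter_upwards [nhdsWithin_le_nhds hev, self_mem_nhdsWithin] with y h1 h2
    using (h1 (pos_of_mem_domainBelow h2).le).1.symm

end IsBlowUpProfile

end DampedWave
end

/-! ### Extension of the data to the whole line -/

noncomputable section

namespace DampedWave

/-- A truncation of the identity with values in a ball. -/
theorem exists_cutoff {r₁ r₂ : ℝ} (h0 : 0 < r₁) (h12 : r₁ < r₂) :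
    ∃ σ χ : ℝ → ℝ, ContDiff ℝ 2 σ ∧ (∀ x, HasDerivAt σ (χ x) x) ∧ HasCompactSupport χ ∧
      (∀ x, |χ x| ≤ 1) ∧ (∀ x, |x| ≤ r₁ → σ x = x) ∧ ∀ x, |σ x| ≤ r₂ := by
  -- A primitive of a bump function is the identity where the bump is 1 and constant beyond `r₂`;
  -- its slope is at most 1, so composition with it does not increase derivatives.
  let b : ContDiffBump (0:ℝ) := ⟨r₁, r₂, h0, h12⟩
  have hb1 : ∀ x, |b x| ≤ 1 := fun x => by rw [abs_of_nonneg b.nonneg]; exact b.le_one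
  have hd : ∀ x, HasDerivAt (fun x => ∫ s in (0:ℝ)..x, b s) (b x) x := fun x =>
    intervalIntegral.integral_hasDerivAt_right (b.continuous.intervalIntegrable _ _)
      (b.continuous.stronglyMeasurableAtFilter _ _) b.continuous.continuousAt
  have hshort : ∀ x, |x| ≤ r₂ → |∫ s in (0:ℝ)..x, b s| ≤ r₂ := fun x hx => by
    have h := intervalIntegral.norm_integral_le_of_norm_le_const (a := 0) (b := x) (f := b)
      (C := 1) fun s _ => hb1 s
    rw [sub_zero, one_mul, Real.norm_eq_abs] at h
    exact h.trans hx
  have hconst : ∀ x y, (∀ s ∈ uIcc x y, r₂ ≤ |s|) →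
      ∫ s in (0:ℝ)..y, b s = ∫ s in (0:ℝ)..x, b s := fun x y h => by
    rw [← intervalIntegral.integral_add_adjacent_intervals
      (b.continuous.intervalIntegrable 0 x) (b.continuous.intervalIntegrable x y)]
    have : ∫ s in x..y, b s = ∫ s in x..y, (0:ℝ) :=
      intervalIntegral.integral_congr fun s hs => b.zero_of_le_dist (by simpa using h s hs)
    rw [this, intervalIntegral.integral_zero, add_zero]
  refine ⟨fun x => ∫ s in (0:ℝ)..x, b s, b, ?_, hd, b.hasCompactSupport, hb1, fun x hx => ?_,
    fun x => ?_⟩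
  · rw [show (2 : WithTop ℕ∞) = 1 + 1 by norm_num, contDiff_succ_iff_deriv]
    refine ⟨fun x => (hd x).differentiableAt, by simp, ?_⟩
    rw [funext fun x => (hd x).deriv]
    exact b.contDiff
  · have : ∫ s in (0:ℝ)..x, b s = ∫ s in (0:ℝ)..x, (1:ℝ) :=
      intervalIntegral.integral_congr fun s hs => b.one_of_mem_closedBall (by
        have h1 := abs_sub_left_of_mem_uIcc hs
        rw [sub_zero, sub_zero] at h1
        simpa using h1.trans hx)
    simp [this]
  · rcases le_or_gt |x| r₂ with hx | hx
    · exact hshort x hx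
    · have hr2 : 0 < r₂ := h0.trans h12
      rcases lt_abs.1 hx with h | h
      · simp only
        rw [hconst r₂ x fun s hs => ?_]
        · exact hshort r₂ (abs_of_pos hr2).le
        · rw [uIcc_of_le h.le] at hs
          exact hs.1.trans (le_abs_self s)
      · simp only
        rw [hconst (-r₂) x fun s hs => ?_]
        · exact hshort (-r₂) (by rw [abs_neg, abs_of_pos hr2])
        · rw [uIcc_of_ge (by linarith)] at hs
          exact (by linarith [hs.2] : r₂ ≤ -s).trans (neg_le_abs s)

/-- Composition with a truncation of the identity gives globally defined, bounded data. -/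
theorem exists_bounds_comp {h σ χ : ℝ → ℝ} {r r₂ : ℝ} (hr : r₂ < r)
    (hh : ContDiffOn ℝ 2 h (Metric.ball 0 r)) (hσ : ContDiff ℝ 2 σ)
    (hσχ : ∀ x, HasDerivAt σ (χ x) x) (hχ : HasCompactSupport χ) (hσr : ∀ x, |σ x| ≤ r₂) :
    (∀ x, HasDerivAt (h ∘ σ) (deriv h (σ x) * χ x) x) ∧
      ∃ B C, (∀ x, |h (σ x)| ≤ B) ∧ (∀ x, |deriv h (σ x) * χ x| ≤ B) ∧
        ∀ x y, |deriv h (σ x) * χ x - deriv h (σ y) * χ y| ≤ C * |x - y| := by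
  have hmem : ∀ x, σ x ∈ Metric.ball (0:ℝ) r := fun x => by
    rw [mem_ball_zero_iff, Real.norm_eq_abs]
    exact (hσr x).trans_lt hr
  have hd : ∀ x, HasDerivAt (h ∘ σ) (deriv h (σ x) * χ x) x := fun x =>
    ((hh.contDiffAt (Metric.isOpen_ball.mem_nhds (hmem x))).differentiableAt
      (by norm_num)).hasDerivAt.comp x (hσχ x)
  have hc : ContDiff ℝ 2 (h ∘ σ) := contDiffOn_univ.1 (hh.comp hσ.contDiffOn fun x _ => hmem x)
  have hc' : ContDiff ℝ 1 fun x => deriv h (σ x) * χ x := by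
    rw [show (2 : WithTop ℕ∞) = 1 + 1 by norm_num, contDiff_succ_iff_deriv,
      funext fun x => (hd x).deriv] at hc
    exact hc.2.2
  have hsupp : HasCompactSupport fun x => deriv h (σ x) * χ x := hχ.mul_left
  obtain ⟨B₁, hB₁⟩ := (isCompact_closedBall (0:ℝ) r₂).exists_bound_of_continuousOn
    (hh.continuousOn.mono (Metric.closedBall_subset_ball hr))
  obtain ⟨B₂, hB₂⟩ := hsupp.exists_bound_of_continuous hc'.continuous
  obtain ⟨C, hC⟩ := hc'.lipschitzWith_of_hasCompactSupport hsupp (by norm_num)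
  refine ⟨hd, max B₁ B₂, C, fun x => (hB₁ (σ x) ?_).trans (le_max_left _ _),
    fun x => (hB₂ x).trans (le_max_right _ _), fun x y => ?_⟩
  · rw [mem_closedBall_zero_iff]
    exact hσr x
  · simpa [Real.dist_eq] using hC.dist_le_mul x y

theorem exists_abs_deriv_le {h : ℝ → ℝ} {r : ℝ} (hr : 0 < r)
    (hh : ContDiffOn ℝ 1 h (Metric.closedBall 0 r)) :
    ∃ K, ∀ x ∈ Metric.ball (0:ℝ) r, |deriv h x| ≤ K := by
  have hu : UniqueDiffOn ℝ (Metric.closedBall (0:ℝ) r) :=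
    uniqueDiffOn_convex (convex_closedBall 0 r) (by
      rw [interior_closedBall _ hr.ne']
      exact Metric.nonempty_ball.2 hr)
  obtain ⟨K, hK⟩ := (isCompact_closedBall (0:ℝ) r).exists_bound_of_continuousOn
    (hh.continuousOn_derivWithin hu le_rfl)
  refine ⟨K, fun x hx => ?_⟩
  have h1 := hK x (Metric.ball_subset_closedBall hx)
  rwa [derivWithin_of_mem_nhds (mem_of_superset (Metric.isOpen_ball.mem_nhds hx)
    Metric.ball_subset_closedBall)] at h1

/-- Continuity of the derivatives up to the closed ball bounds the set. This matters since `sSup` of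
an unbounded set of reals is 0, and `maxSlope` would then control nothing. -/
theorem abs_deriv_add_le_maxSlope {f g : ℝ → ℝ} {r : ℝ} (hr : 0 < r)
    (hf : ContDiffOn ℝ 1 f (Metric.closedBall 0 r)) (hg : ContDiffOn ℝ 1 g (Metric.closedBall 0 r))
    {x : ℝ} (hx : x ∈ Metric.ball (0:ℝ) r) : |deriv f x| + |deriv g x| ≤ maxSlope f g r := by
  obtain ⟨K, hK⟩ := exists_abs_deriv_le hr hf
  obtain ⟨L, hL⟩ := exists_abs_deriv_le hr hg
  refine le_csSup ⟨K + L, ?_⟩ (mem_image_of_mem _ hx)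
  rintro _ ⟨y, hy, rfl⟩
  exact add_le_add (hK y hy) (hL y hy)

theorem mul_le_of_max_lt {p μ γ : ℝ} (hμ : 0 < μ) (hp : 1 < p)
    (h : max 1 ((μ * p * (2 : ℝ) ^ p) ^ (1 / (p - 1))) < γ) :
    μ * p ≤ (2:ℝ) ^ (-p) * γ ^ (p - 1) := by
  have hX : 0 ≤ μ * p * (2:ℝ) ^ p := by positivity
  have h1 := Real.rpow_le_rpow (Real.rpow_nonneg hX _) ((le_max_right _ _).trans h.le)
    (by linarith : 0 ≤ p - 1)
  rw [← Real.rpow_mul hX, one_div_mul_cancel (by linarith), Real.rpow_one] at h1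
  rw [Real.rpow_neg two_pos.le, inv_mul_eq_div, le_div_iff₀ (by positivity)]
  exact h1

/-- The data extend from a neighbourhood of the domain of dependence to the whole line. -/
theorem exists_admissibleData {p μ γ₁ γ₂ r₁ r ε : ℝ} {f g : ℝ → ℝ} (hμ : 0 < μ) (hp : 1 < p)
    (hr₁ : 0 < r₁) (hr : r₁ < r) (hε : 0 < ε) (hγ₁ : 0 < γ₁) (hγ₂ : 0 < γ₂)
    (hγ : max 1 ((μ * p * (2 : ℝ) ^ p) ^ (1 / (p - 1))) < γ₁ + γ₂)
    (hfg : ∀ x ∈ Metric.ball (0 : ℝ) r, γ₁ ≤ f x ∧ γ₂ ≤ g x)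
    (hf : ContDiffOn ℝ 2 f (Metric.closedBall 0 r)) (hg : ContDiffOn ℝ 2 g (Metric.closedBall 0 r))
    (hslope : (2 + ε) * maxSlope f g r ≤
      (2 : ℝ) ^ (-p) * (γ₁ + γ₂) ^ p - μ / 2 * (γ₁ + γ₂)) :
    ∃ (B C : ℝ) (F G F' G' : ℝ → ℝ), AdmissibleData p μ γ₁ γ₂ (1 + ε) B C F G F' G' ∧
      EqOn F f (Metric.ball 0 r₁) ∧ EqOn G g (Metric.ball 0 r₁) := by
  have hr0 : 0 < r := hr₁.trans hr
  -- Composition with `σ` keeps the lower bounds, because only values inside the ball occur, and the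
  -- slope bound, because `|χ| ≤ 1`. The choice `k = 1 + ε` turns the factor `2 + ε` into `1 + k`.
  obtain ⟨σ, χ, hσ, hσχ, hχ, hχ1, hσid, hσr⟩ := exists_cutoff hr₁ (left_lt_add_div_two.2 hr)
  have hlt : (r₁ + r) / 2 < r := add_div_two_lt_right.2 hr
  obtain ⟨hF, B₁, C₁, f1, f2, f3⟩ := exists_bounds_comp hlt
    (hf.mono Metric.ball_subset_closedBall) hσ hσχ hχ hσr
  obtain ⟨hG, B₂, C₂, g1, g2, g3⟩ := exists_bounds_comp hlt
    (hg.mono Metric.ball_subset_closedBall) hσ hσχ hχ hσr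
  have hmem : ∀ x, σ x ∈ Metric.ball (0:ℝ) r := fun x => by
    rw [mem_ball_zero_iff, Real.norm_eq_abs]
    exact (hσr x).trans_lt hlt
  have hid : ∀ x ∈ Metric.ball (0:ℝ) r₁, σ x = x := fun x hx =>
    hσid x (by simpa using (mem_ball_zero_iff.1 hx).le)
  refine ⟨max B₁ B₂, max C₁ C₂, f ∘ σ, g ∘ σ, fun x => deriv f (σ x) * χ x,
    fun x => deriv g (σ x) * χ x, ⟨hμ, hp, by linarith, hγ₁, hγ₂, mul_le_of_max_lt hμ hp hγ, hF, hG,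
      fun x => (f1 x).trans (le_max_left _ _), fun x => (g1 x).trans (le_max_right _ _),
      fun x => (f2 x).trans (le_max_left _ _), fun x => (g2 x).trans (le_max_right _ _),
      fun x y => (f3 x y).trans (mul_le_mul_of_nonneg_right (le_max_left _ _) (abs_nonneg _)),
      fun x y => (g3 x y).trans (mul_le_mul_of_nonneg_right (le_max_right _ _) (abs_nonneg _)),
      fun x => (hfg _ (hmem x)).1, fun x => (hfg _ (hmem x)).2, fun x => ?_⟩,
    fun x hx => by simp [hid x hx], fun x hx => by simp [hid x hx]⟩
  refine le_trans ?_ hslope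
  have h1 := abs_deriv_add_le_maxSlope hr0 (hf.of_le (by norm_num)) (hg.of_le (by norm_num)) (hmem x)
  rw [show 1 + (1 + ε) = 2 + ε by ring, abs_mul, abs_mul]
  refine mul_le_mul_of_nonneg_left (le_trans ?_ h1) (by linarith)
  have h2 := hχ1 x
  have h3 := mul_le_of_le_one_right (abs_nonneg (deriv f (σ x))) h2
  have h4 := mul_le_of_le_one_right (abs_nonneg (deriv g (σ x))) h2
  linarith

theorem IsBlowUpProfile.baseBelow_subset_ball {p μ γ₁ γ₂ k B T₁ : ℝ} {f g f' g' T : ℝ → ℝ}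
    {τ : ℕ → ℝ → ℝ} {φ ψ : ℝ × ℝ → ℝ} (P : IsBlowUpProfile p μ γ₁ γ₂ k B T₁ f g f' g' T τ φ ψ)
    (R : ℝ) : baseBelow R T ⊆ Metric.ball 0 (R + T₁) := by
  intro y hy
  obtain ⟨x, hx, hyx⟩ := mem_baseBelow.1 hy
  rw [mem_ball_zero_iff, Real.norm_eq_abs]
  have h1 := P.le x
  have h2 := abs_add_le (y - x) x
  rw [sub_add_cancel] at h2
  linarith

/-- A primitive on the line of half the difference of the data that extends `u₀`. -/
theorem exists_primitive {F G f g u₀ u₁ : ℝ → ℝ} {r r' : ℝ} (hr : 0 < r) (hrr : r ≤ r')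
    (hF : Continuous F) (hG : Continuous G) (hFf : EqOn F f (Metric.ball 0 r))
    (hGg : EqOn G g (Metric.ball 0 r)) (hu₀ : DifferentiableOn ℝ u₀ (Metric.ball 0 r'))
    (hf : ∀ x ∈ Metric.ball (0 : ℝ) r', f x = u₁ x + deriv u₀ x)
    (hg : ∀ x ∈ Metric.ball (0 : ℝ) r', g x = u₁ x - deriv u₀ x) :
    ∃ U : ℝ → ℝ, (∀ x, HasDerivAt U ((F x - G x) / 2) x) ∧ EqOn U u₀ (Metric.ball 0 r) := by
  have hsub : Metric.ball (0:ℝ) r ⊆ Metric.ball 0 r' := Metric.ball_subset_ball hrr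
  have hc : Continuous fun x => (F x - G x) / 2 := (hF.sub hG).div_const 2
  have hU : ∀ x, HasDerivAt (fun x => u₀ 0 + ∫ s in (0:ℝ)..x, (F s - G s) / 2)
      ((F x - G x) / 2) x := fun x =>
    (intervalIntegral.integral_hasDerivAt_right (hc.intervalIntegrable _ _)
      (hc.stronglyMeasurableAtFilter _ _) hc.continuousAt).const_add _
  refine ⟨_, hU, ?_⟩
  refine Metric.isOpen_ball.eqOn_of_deriv_eq (convex_ball (0:ℝ) r).isPreconnected
    (fun x _ => (hU x).differentiableAt.differentiableWithinAt) (hu₀.mono hsub) (fun x hx => ?_)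
    (Metric.mem_ball_self hr) (by simp)
  rw [(hU x).deriv, hFf hx, hGg hx, hf x (hsub hx), hg x (hsub hx)]
  ring

end DampedWave
end

/-! ### The main theorem -/

theorem theorem3p4
    (p μ R Ts γ₁ γ₂ T₁ : ℝ) (f g u₀ u₁ : ℝ → ℝ)
    (hμ : 0 < μ) (hp : 1 < p) (hp_lt : p < 1 + 2 / μ)
    (hpow : ContDiffOn ℝ 4 (fun s : ℝ => s ^ p) (Set.Ici 0))
    (hR : 0 < R) (hTs : 0 < Ts)
    (hγ₁ : 0 < γ₁) (hγ₂ : 0 < γ₂)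
    (hγ : max 1 ((μ * p * (2 : ℝ) ^ p) ^ (1 / (p - 1))) < γ₁ + γ₂)
    (hT₁ : DampedWave.IsODEBlowUpTime μ p γ₁ γ₂ T₁)
    (hA1 : T₁ < Ts)
    (hA2 : ∀ x ∈ Metric.ball (0 : ℝ) (R + Ts), γ₁ ≤ f x ∧ γ₂ ≤ g x)
    (hA3 : ContDiffOn ℝ 4 f (Metric.closedBall 0 (R + Ts)) ∧
      ContDiffOn ℝ 4 g (Metric.closedBall 0 (R + Ts)))
    (hA4 : ∃ ε₀ : ℝ, 0 < ε₀ ∧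
      (2 + ε₀) * DampedWave.maxSlope f g (R + Ts) ≤
        (2 : ℝ) ^ (-p) * (γ₁ + γ₂) ^ p - μ / 2 * (γ₁ + γ₂))
    (hA5 : ∃ ε₁ : ℝ, ε₁ ≠ -1 ∧
      0 < (2 : ℝ) ^ (-p) * (2 * p - 1) * (1 + ε₁ / (2 * (1 + ε₁))) * (1 - 1 / (2 * p))
        - (2 : ℝ) ^ (-p + 1) * p - μ ∧
      (2 + ε₁) * DampedWave.maxSlope f g (R + Ts) ≤
        (2 : ℝ) ^ (-p) * (γ₁ + γ₂) ^ p - μ / 2 * (γ₁ + γ₂))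
    (hu₀ : DifferentiableOn ℝ u₀ (Metric.ball 0 (R + Ts)))
    (hf : ∀ x ∈ Metric.ball (0 : ℝ) (R + Ts), f x = u₁ x + deriv u₀ x)
    (hg : ∀ x ∈ Metric.ball (0 : ℝ) (R + Ts), g x = u₁ x - deriv u₀ x) :
    ∃ T : ℝ → ℝ,
      ContDiffOn ℝ 1 T (Metric.ball 0 R) ∧
      DampedWave.IsSystemBlowUpCurve μ p f g R Ts T ∧
      (∀ S : ℝ → ℝ, DampedWave.IsSystemBlowUpCurve μ p f g R Ts S →
        Set.EqOn S T (Metric.ball 0 R)) ∧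
      DampedWave.IsWaveBlowUpCurve μ p u₀ u₁ R Ts T ∧
      (∀ S : ℝ → ℝ, DampedWave.IsWaveBlowUpCurve μ p u₀ u₁ R Ts S →
        Set.EqOn S T (Metric.ball 0 R)) := by
  have hT₁0 : 0 < T₁ := hT₁.1
  obtain ⟨ε, hε, hslope⟩ := hA4
  -- The bases of the cones below the constructed curve lie in the ball of radius `R + T₁`, since `T
  -- ≤ T₁`; the gap between `T₁` and `Ts` leaves room for the cutoff.
  obtain ⟨B, C, F, G, F', G', H, hFf, hGg⟩ := DampedWave.exists_admissibleData (r₁ := R + T₁) hμ hp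
    (by linarith) (by linarith : R + T₁ < R + Ts) hε hγ₁ hγ₂ hγ hA2 (hA3.1.of_le (by norm_num))
    (hA3.2.of_le (by norm_num)) hslope
  obtain ⟨T, τ, φ, ψ, P⟩ := H.exists_blowUpProfile hT₁
  have hFc : Continuous F := continuous_iff_continuousAt.2 fun x => (H.hf x).continuousAt
  have hGc : Continuous G := continuous_iff_continuousAt.2 fun x => (H.hg x).continuousAt
  obtain ⟨U, hU, hUu⟩ := DampedWave.exists_primitive (by linarith) (by linarith) hFc hGc hFf hGg
    hu₀ hf hg
  have hT : ∀ x ∈ Metric.ball (0:ℝ) R, 0 < T x ∧ T x < Ts := fun x _ =>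
    ⟨P.pos x, (P.le x).trans_lt hA1⟩
  have hbase := P.baseBelow_subset_ball R
  have hbase' := DampedWave.baseBelow_subset_ball hT
  have hsol : DampedWave.IsSystemSolution μ p f g R T φ ψ :=
    (P.isSystemSolution H R).congr_data (hFf.mono hbase) (hGg.mono hbase)
  have hfc : ContinuousOn f (Metric.ball 0 (R + Ts)) :=
    hA3.1.continuousOn.mono Metric.ball_subset_closedBall
  have hgc : ContinuousOn g (Metric.ball 0 (R + Ts)) :=
    hA3.2.continuousOn.mono Metric.ball_subset_closedBall
  have hblow : ∀ x ∈ Metric.ball (0:ℝ) R,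
      Tendsto (fun t => φ (x, t) + ψ (x, t)) (𝓝[<] (T x)) atTop := fun x _ => P.tendsto_sum_atTop x
  obtain ⟨hwave, hdt⟩ := hsol.isWaveSolution (u₀ := u₀) (u₁ := u₁)
    (fun z hz => P.hasFDerivAt_wavePotential H hU (DampedWave.pos_of_mem_domainBelow hz)
      (P.lt_of_mem_domainBelow H hz))
    (fun x hx => by
      rw [← hUu (hbase hx)]
      exact P.tendsto_wavePotential H hU R x)
    (fun x hx => by
      rw [hf x (hbase' hx), hg x (hbase' hx)]
      ring)
  refine ⟨T, (P.contDiff H).contDiffOn, ⟨hT, φ, ψ, hsol, fun x _ => P.tendsto_atTop H x⟩, ?_,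
    ⟨hT, _, hwave, fun x hx => ?_⟩, ?_⟩
  -- A competing curve is only known to satisfy `S < Ts`, so its base may leave the smaller ball;
  -- the comparison is made with the original data `f, g`.
  · rintro S ⟨hS, φ', ψ', hsol', hblow'⟩
    exact hsol'.eqOn_of_tendsto_atTop hμ hp hsol hfc hgc hS hT
      (fun x hx => (hblow' x hx).1.atTop_add_atTop (hblow' x hx).2) hblow
  · refine ((hblow x hx).atTop_div_const two_pos).congr' ?_
    filter_upwards [Ioo_mem_nhdsLT (P.pos x)] with t ht
    rw [hdt _ (DampedWave.mem_domainBelow_of_lt (by simpa using hx) ht.1 ht.2)]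
  · rintro S ⟨hS, u, hu, hblow'⟩
    have hbS := DampedWave.baseBelow_subset_ball hS
    have hsol' := hu.isSystemSolution (f := f) (g := g) hμ hp (fun x hx => hf x (hbS hx))
      (fun x hx => hg x (hbS hx))
    refine hsol'.eqOn_of_tendsto_atTop hμ hp hsol hfc hgc hS hT (fun x hx => ?_) hblow
    refine ((hblow' x hx).const_mul_atTop two_pos).congr fun t => ?_
    ring
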